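/- **Model.** All graphs are undirected on the vertex set $\{0,\dots,n-1\}$ with nonnegative real edge weights (connectedness is not assumed); $\log=\log_2$; $d_G$ is the weighted distance. A $t$-spanner of $G$ is a subgraph $H\subseteq G$ on all the vertices with $d_H\le t\cdot d_G$. Algorithms run on a word RAM with unit-cost instructions: integer words of $O(\log n)$ bits ($+,-,\cdot,/,\bmod$, comparison, memory access) and weight words, which can be copied, added and compared and initially hold only lengths of paths of the graph. The query program is fixed, independent of $n$ and of the graph. Space is the number of memory cells, query workspace included; a query leaves the memory as it found it. A path-reporting oracle outputs, for a query $(u,v)$, the vertices of a $u$–$v$ walk $\Pi$ of $G$ in order and its length (an empty output if $v$ is not reachable from $u$); its stretch is $\alpha$ if the length of $\Pi$ is always at most $\alpha\, d_G(u,v)$, and its query time is $O(q)$ if every query takes $O(q+|\Pi|)$ steps, $|\Pi|$ being the number of edges of $\Pi$. **The oracle $\Lambda_h$** ($h\ge1$) on an $n$-vertex graph $H$ with $m$ edges. Put $\rho_i=n^{1-(3/4)^{h-i+1}}$. Random landmark sets $L_1,\dots,L_h$ are chosen: all events $\{v\in L_i\}$ are independent, and $v\in L_i$ if at least one of $\lceil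 \deg_H(v)/(m/n)\rceil$ copies of $v$, each selected independently with probability $\rho_i/n$, is selected. Let $r_i(v)$ be the distance in $H$ from $v$ to $L_i$ ($\infty$ if $L_i$ is not reachable) and $\ell_i(v)$ a closest $i$-landmark of $v$. For a query $(u,v)$ put $u^{(0)}=u$, $v^{(0)}=v$, $u^{(j+1)}=\ell_{j+1}(u^{(j)})$, $v^{(j+1)}=\ell_{j+1}(v^{(j)})$, and let $p$ be the least $j$ such that $j=h$, or $j=0$ and $d_H(u,v)<\max(r_1(u),r_1(v))$, or $0<j<h$ and $d_H(u^{(j)},v^{(j)})<\tfrac13\max(r_{j+1}(u^{(j)}),r_{j+1}(v^{(j)}))$. The oracle reports the concatenation of shortest paths of $H$ through $u^{(0)},\dots,u^{(p)},v^{(p)},\dots,v^{(0)}$. **Theorem.** (a) There is a constant $c_0$ such that every $n$-vertex weighted graph ($n\ge2$) has a $c_0\log n$-spanner with at most $c_0n$ edges and, for $n\ge 3$ and every real $k$ with $\frac{\log n}{\log\log n}\le k\le\log n$, a $c_0k$-spanner with at most $c_0n^{1+1/k}$ edges. (b) Let $\varepsilon>0$ and $c$ be constants and let $h\ge 1$ be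 a constant integer with $h\ge\lceil\log_{4/3}\varepsilon^{-1}\rceil$. Then there are a fixed query program and constants (depending only on $\varepsilon,h,c$) such that, for every $n$-vertex weighted graph $G$, $n\ge2$: * if $H$ is a $c\log n$-spanner of $G$ with at most $cn$ edges, then $\Lambda_h$ on $H$ is implemented as a path-reporting distance oracle for $G$ with space $O(n)$, stretch $O(\log n)$ and query time $O(n^{\varepsilon})$; * if $n\ge 3$, $\frac{\log n}{\log\log n}\le k\le\log n$ with $k$ real, and $H$ is a $ck$-spanner of $G$ with at most $cn^{1+1/k}$ edges, then $\Lambda_h$ on $H$ is implemented as a path-reporting distance oracle for $G$ with space $O(n^{1+1/k})$, stretch $O(k)$ and query time $O(n^{\varepsilon+1/k})$. Here, if $(3/4)^h=\varepsilon$ exactly, the query time bound carries an additional factor that is a constant power of $\log n$; there is no such factor if $(3/4)^h<\varepsilon$. The stretch bound, and the form of the reported path, hold for every choice of the landmarks. The query time bound holds for all pairs simultaneously with probability at least $1-n^{-2}$. The space bound holds in expectation. With probability at least $1/2$, the space bound and the query time bound hold together; in particular some choice of landmarks gives an oracle with all of the stated bounds. -/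

import Mathlib

open scoped NNReal ENNReal

noncomputable section

namespace PathOracle

/-! ### Weighted undirected graphs

A weighted graph on the vertex set `Fin n` is a `SimpleGraph (Fin n)` together with a nonnegative
real weight for every edge (the values of the weight function off the edge set are irrelevant). -/

variable {n : ℕ}

/-- The length of a walk: the sum of the weights of its edges. -/
def len (wt : Sym2 (Fin n) → ℝ≥0) {H : SimpleGraph (Fin n)} {u v : Fin n} (p : H.Walk u v) : ℝ≥0 :=
  (p.edges.map wt).sum

/-- The distance in the weighted graph `(H, wt)`; it is `⊤` if there is no walk. -/
def dist (wt : Sym2 (Fin n) → ℝ≥0) (H : SimpleGraph (Fin n)) (u v : Fin n) : ℝ≥0∞ :=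
  ⨅ p : H.Walk u v, (len wt p : ℝ≥0∞)

/-- The distance from a vertex to a set of vertices; it is `⊤` if the set is not reachable. -/
def distTo (wt : Sym2 (Fin n) → ℝ≥0) (H : SimpleGraph (Fin n)) (S : Finset (Fin n)) (v : Fin n) :
    ℝ≥0∞ :=
  ⨅ x ∈ S, dist wt H v x

/-- A walk is a shortest one between its endpoints. -/
def IsShortest (wt : Sym2 (Fin n) → ℝ≥0) {H : SimpleGraph (Fin n)} {u v : Fin n}
    (p : H.Walk u v) : Prop :=
  ∀ q : H.Walk u v, len wt p ≤ len wt q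

/-- `H` is a `t`-spanner of the weighted graph `(G, wt)`. -/
def IsSpanner (wt : Sym2 (Fin n) → ℝ≥0) (G H : SimpleGraph (Fin n)) (t : ℝ) : Prop :=
  H ≤ G ∧ ∀ u v, dist wt H u v ≤ ENNReal.ofReal t * dist wt G u v

/-! ### The random landmark hierarchy of the multilevel oracle -/

/-- A hierarchy of landmark sets `L₁, …, L_h`. -/
abbrev Hierarchy (h n : ℕ) : Type := ↥(Finset.Icc 1 h) → Finset (Fin n)

/-- The set `L_i`; `L₀` is the set of all vertices. -/
def landmarks {h : ℕ} (L : Hierarchy h n) (i : ℕ) : Finset (Fin n) :=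
  if hi : i ∈ Finset.Icc 1 h then L ⟨i, hi⟩ else Finset.univ

/-- The sampling rate `p_i = ρ_i / n`, where `ρ_i = n ^ α_i` and `α_i = 1 - (3/4)^(h-i+1)`. -/
def rate (h n i : ℕ) : ℝ :=
  (n : ℝ) ^ (1 - (3 / 4 : ℝ) ^ (h + 1 - i)) / n

/-- The number `⌈deg v / λ⌉` of virtual copies of `v`, where `λ = m / n` for a graph with
`m` edges. -/
def copies (H : SimpleGraph (Fin n)) (v : Fin n) : ℕ :=
  ⌈((H.neighborSet v).ncard : ℝ) / ((H.edgeSet.ncard : ℝ) / n)⌉₊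

/-- The probability that `v` becomes an `i`-landmark: every one of its copies is selected
independently with probability `p_i`, and `v` is a landmark if some copy is selected. -/
def selProb (h : ℕ) (H : SimpleGraph (Fin n)) (i : ℕ) (v : Fin n) : ℝ :=
  1 - (1 - rate h n i) ^ copies H v

/-- The probability of a hierarchy: all the events `v ∈ L_i` are independent. -/
def prob {h : ℕ} (H : SimpleGraph (Fin n)) (L : Hierarchy h n) : ℝ :=
  ∏ i, ∏ v, if v ∈ L i then selProb h H i v else 1 - selProb h H i v

/-! ### The path that the multilevel oracle `Λ_h` reports -/

/-- `ell i v` is a closest `i`-landmark of `v`, whenever some `i`-landmark is reachable. -/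
def IsNearest {h : ℕ} (wt : Sym2 (Fin n) → ℝ≥0) (H : SimpleGraph (Fin n)) (L : Hierarchy h n)
    (ell : ℕ → Fin n → Fin n) : Prop :=
  ∀ i ∈ Finset.Icc 1 h, ∀ v, distTo wt H (landmarks L i) v < ⊤ →
    ell i v ∈ landmarks L i ∧ dist wt H v (ell i v) = distTo wt H (landmarks L i) v

/-- The query algorithm ends at level `j` with the pair `x, y`. At level `0`, this means that one
of the two vertices lies in the `1`-ball of the other; at a level `0 < j < h`, that one of them lies
in the one-third `(j+1)`-ball of the other; at level `h`, it is always the case. -/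
def Stops {h : ℕ} (wt : Sym2 (Fin n) → ℝ≥0) (H : SimpleGraph (Fin n)) (L : Hierarchy h n)
    (j : ℕ) (x y : Fin n) : Prop :=
  if j = 0 then
    dist wt H x y < distTo wt H (landmarks L 1) x ∨ dist wt H y x < distTo wt H (landmarks L 1) y
  else if j = h then True
  else
    dist wt H x y < distTo wt H (landmarks L (j + 1)) x / 3 ∨
      dist wt H y x < distTo wt H (landmarks L (j + 1)) y / 3

/-- The walks that the query algorithm of `Λ_h` may report for the pair of `j`-level landmarks
`x, y`: a shortest path between `x` and `y` if the algorithm ends here; otherwise a shortest path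
from `x` to its closest `(j+1)`-landmark, followed by the answer for the two closest
`(j+1)`-landmarks and by a shortest path back to `y`. -/
inductive IsAnswer {h : ℕ} (wt : Sym2 (Fin n) → ℝ≥0) (H : SimpleGraph (Fin n))
    (L : Hierarchy h n) (ell : ℕ → Fin n → Fin n) :
    ℕ → (x y : Fin n) → H.Walk x y → Prop
  | here (j : ℕ) (x y : Fin n) (p : H.Walk x y) :
      Stops wt H L j x y → IsShortest wt p → IsAnswer wt H L ell j x y p
  | up (j : ℕ) (x y : Fin n) (p : H.Walk x (ell (j + 1) x)) (q : H.Walk y (ell (j + 1) y))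
      (r : H.Walk (ell (j + 1) x) (ell (j + 1) y)) :
      ¬ Stops wt H L j x y → IsShortest wt p → IsShortest wt q →
      IsAnswer wt H L ell (j + 1) (ell (j + 1) x) (ell (j + 1) y) r →
      IsAnswer wt H L ell j x y (p.append (r.append q.reverse))

/-! ### The machine: a RAM with integer words and with weight words

Integer words hold numbers below a word bound `W`; weight words hold nonnegative reals, which can
only be copied, added and compared. There are finitely many registers in use by a program, and two
random access memories of `S` cells each. Every elementary instruction and every evaluation of a
test costs one unit of time. -/

/-- Arithmetic instructions on integer words. -/
inductive Op
  | add | sub | mul | div | mod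

/-- The value of an arithmetic operation (before reduction modulo the word bound). -/
def Op.eval : Op → ℕ → ℕ → ℕ
  | .add, a, b => a + b
  | .sub, a, b => a - b
  | .mul, a, b => a * b
  | .div, a, b => a / b
  | .mod, a, b => a % b

/-- Tests on registers: `<` and `=` on integers, `<` on weights. -/
inductive Test
  | ilt (a b : ℕ)
  | ieq (a b : ℕ)
  | wlt (a b : ℕ)

/-- Programs. The numerical arguments, except the constant of `iset`, are names of registers. -/
inductive Prog
  | skip
  /-- integer register `d := c` -/
  | iset (d c : ℕ)
  /-- integer register `d := a o b` -/
  | iop (o : Op) (d a b : ℕ)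
  /-- integer register `d :=` integer memory cell with the address in register `a` -/
  | iload (d a : ℕ)
  /-- integer memory cell with the address in register `a := ` integer register `b` -/
  | istore (a b : ℕ)
  /-- weight register `d := 0` -/
  | wzero (d : ℕ)
  /-- weight register `d := a + b` -/
  | wadd (d a b : ℕ)
  /-- weight register `d :=` weight memory cell with the address in integer register `a` -/
  | wload (d a : ℕ)
  /-- weight memory cell with the address in integer register `a := ` weight register `b` -/
  | wstore (a b : ℕ)
  /-- append the content of integer register `a` to the output -/
  | emit (a : ℕ)
  | seq (P Q : Prog)
  | cond (t : Test) (P Q : Prog)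
  | loop (t : Test) (P : Prog)

/-- The state of the machine. -/
structure State where
  ireg : ℕ → ℕ
  wreg : ℕ → ℝ≥0
  imem : ℕ → ℕ
  wmem : ℕ → ℝ≥0
  out : List ℕ

/-- The truth of a test in a state. -/
def Test.Holds : Test → State → Prop
  | .ilt a b, s => s.ireg a < s.ireg b
  | .ieq a b, s => s.ireg a = s.ireg b
  | .wlt a b, s => s.wreg a < s.wreg b

/-- `Run W S P s s' τ`: with word bound `W` and memories of `S` cells, the program `P` started in
the state `s` halts in the state `s'` after `τ` steps. An access to an address that is not below
`S` blocks the machine. -/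
inductive Run (W S : ℕ) : Prog → State → State → ℕ → Prop
  | skip (s : State) : Run W S .skip s s 1
  | iset (s : State) (d c : ℕ) :
      Run W S (.iset d c) s { s with ireg := Function.update s.ireg d (c % W) } 1
  | iop (s : State) (o : Op) (d a b : ℕ) :
      Run W S (.iop o d a b) s
        { s with ireg := Function.update s.ireg d (o.eval (s.ireg a) (s.ireg b) % W) } 1
  | iload (s : State) (d a : ℕ) : s.ireg a < S →
      Run W S (.iload d a) s { s with ireg := Function.update s.ireg d (s.imem (s.ireg a)) } 1
  | istore (s : State) (a b : ℕ) : s.ireg a < S →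
      Run W S (.istore a b) s { s with imem := Function.update s.imem (s.ireg a) (s.ireg b) } 1
  | wzero (s : State) (d : ℕ) :
      Run W S (.wzero d) s { s with wreg := Function.update s.wreg d 0 } 1
  | wadd (s : State) (d a b : ℕ) :
      Run W S (.wadd d a b) s
        { s with wreg := Function.update s.wreg d (s.wreg a + s.wreg b) } 1
  | wload (s : State) (d a : ℕ) : s.ireg a < S →
      Run W S (.wload d a) s { s with wreg := Function.update s.wreg d (s.wmem (s.ireg a)) } 1
  | wstore (s : State) (a b : ℕ) : s.ireg a < S →
      Run W S (.wstore a b) s { s with wmem := Function.update s.wmem (s.ireg a) (s.wreg b) } 1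
  | emit (s : State) (a : ℕ) :
      Run W S (.emit a) s { s with out := s.out ++ [s.ireg a] } 1
  | seq (P Q : Prog) (s s' s'' : State) (τ τ' : ℕ) :
      Run W S P s s' τ → Run W S Q s' s'' τ' → Run W S (.seq P Q) s s'' (τ + τ')
  | cond_true (t : Test) (P Q : Prog) (s s' : State) (τ : ℕ) :
      t.Holds s → Run W S P s s' τ → Run W S (.cond t P Q) s s' (τ + 1)
  | cond_false (t : Test) (P Q : Prog) (s s' : State) (τ : ℕ) :
      ¬ t.Holds s → Run W S Q s s' τ → Run W S (.cond t P Q) s s' (τ + 1)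
  | loop_true (t : Test) (P : Prog) (s s' s'' : State) (τ τ' : ℕ) :
      t.Holds s → Run W S P s s' τ → Run W S (.loop t P) s' s'' τ' →
      Run W S (.loop t P) s s'' (τ + τ' + 1)
  | loop_false (t : Test) (P : Prog) (s : State) :
      ¬ t.Holds s → Run W S (.loop t P) s s 1

/-! ### Distance oracles as data structures of the machine -/

/-- A data structure: the number of memory cells of each kind (workspace of the queries
included) and their contents. -/
structure Store where
  size : ℕ
  imem : ℕ → ℕ
  wmem : ℕ → ℝ≥0

/-- The stored integers fit into words, and every stored weight is the length of some path of the
graph (so that weight words cannot be used to store other information). -/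
def Store.Admissible (D : Store) (W : ℕ) (wt : Sym2 (Fin n) → ℝ≥0) (H : SimpleGraph (Fin n)) :
    Prop :=
  (∀ a, D.imem a < W) ∧ ∀ a, ∃ (x y : Fin n) (p : H.Walk x y), p.IsPath ∧ D.wmem a = len wt p

/-- The initial state of a query: `u` and `v` are in the integer registers `0` and `1`. -/
def Store.start (D : Store) (u v : Fin n) : State where
  ireg := fun r => if r = 0 then (u : ℕ) else if r = 1 then (v : ℕ) else 0
  wreg := fun _ => 0
  imem := D.imem
  wmem := D.wmem
  out := []

/-- The query `(u, v)` takes `τ` steps, outputs the list `o` and the estimate `δ` (in the weight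
register `0`), and leaves the data structure as it was. -/
def Store.Query (D : Store) (W : ℕ) (Q : Prog) (u v : Fin n) (o : List ℕ) (δ : ℝ≥0) (τ : ℕ) :
    Prop :=
  ∃ s, Run W D.size Q (D.start u v) s τ ∧
    s.out = o ∧ s.wreg 0 = δ ∧ s.imem = D.imem ∧ s.wmem = D.wmem

/-- The query program `Q`, on words below `W`, implements `Λ_h` on the graph `H ≤ G`, with
stretch `α` with respect to `G`. For the random hierarchy `L` of landmarks there is a data
structure `D L` such that

* for every `L` and every pair `u, v`, the query reports a walk `p` of `H` (its vertices, in order,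
  and its length) that is an answer of `Λ_h` and has length at most `α * d_G(u, v)`; if
  `v` is not reachable from `u`, the output is empty;
* there is an event `Good` of probability at least `1 - n⁻²` in which all queries take at most
  `C * (T + |p|)` steps, where `|p|` is the number of edges of the reported path;
* the expected number of memory cells is at most `C * space`;
* with probability at least `1/2`, the event `Good` holds and the number of memory cells is at most
  `C * space`. -/
def ImplementsLambda (Q : Prog) (W h : ℕ) (wt : Sym2 (Fin n) → ℝ≥0) (G H : SimpleGraph (Fin n))
    (C space α T : ℝ) : Prop :=
  ∃ (D : Hierarchy h n → Store) (ell : Hierarchy h n → ℕ → Fin n → Fin n)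
    (Good : Finset (Hierarchy h n)),
    (∀ L, (D L).Admissible W wt H ∧ IsNearest wt H L (ell L) ∧ ∀ u v,
      (G.Reachable u v → ∃ (p : H.Walk u v) (τ : ℕ),
        (D L).Query W Q u v (p.support.map (fun x => (x : ℕ))) (len wt p) τ ∧
        IsAnswer wt H L (ell L) 0 u v p ∧
        (len wt p : ℝ≥0∞) ≤ ENNReal.ofReal α * dist wt G u v ∧
        (L ∈ Good → (τ : ℝ) ≤ C * (T + p.length))) ∧
      (¬ G.Reachable u v → ∃ (δ : ℝ≥0) (τ : ℕ),
        (D L).Query W Q u v [] δ τ ∧ (L ∈ Good → (τ : ℝ) ≤ C * T))) ∧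
    1 - 1 / (n : ℝ) ^ 2 ≤ ∑ L ∈ Good, prob H L ∧
    ∑ L, prob H L * (D L).size ≤ C * space ∧
    1 / 2 ≤ ∑ L ∈ Good with ((D L).size : ℝ) ≤ C * space, prob H L

end PathOracle

end

open PathOracle

/-!
The sparse spanners are greedy: process the edges by increasing weight, and keep an edge unless its
ends are joined by at most `2 * K - 1` of the edges kept before (`exists_greedy`). The edges that
are kept form a graph of girth more than `2 * K`, and the Moore bound limits their number
(`ncard_edgeSet_le_of_egirth`). The parameters are `K = ⌈log n⌉` and `K = ⌈k⌉`.

The oracle stores, for every level `i`, a pointer from each vertex towards its nearest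
`i`-landmark, the paths between those pairs of `i`-landmarks at which a query of level `i` may
stop, and the graph `H` itself. A query decides about level `0` by Dijkstra's algorithm from that
one of its two vertices whose distance from the `1`-landmarks is larger, within the ball of this
radius. At a higher level, it follows the pointers from both vertices and searches the keys of the
stored pairs. The program and its running time are verified for an intermediate machine with arrays
(`levels_spec`, `query_spec`), each instruction of which takes a bounded number of steps of the
word RAM (`run_instr`). The stretch satisfies the recursion `σ (i + 1) = 6 + 7 * σ i`: if a query
does not stop at a level, then both landmarks of the next level are within three times the distance
(`IsAnswer.len_le`).

The space is what requires care, as the stored paths may be long, and only a constant number of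
cells per pair of pairs can be afforded. A lexicographic perturbation of the weights by powers of
two makes shortest paths unique and closed under taking subpaths (`Best.eq`). Hence two stored
paths differ in at most two of their common vertices (`card_differ_le`). At a vertex `x` where all
stored paths of a level go the same way, the sum of the two neighbours of `x` is stored; from this
sum and the predecessor, the successor can be recovered, in either direction. At the other
vertices, the successor is read from a list that belongs to the path. The lists have, in total, at
most two entries for each pair of stored paths that meet, and one entry for each path. If two
stored paths of level `j` meet, then all four landmarks lie in the ball around one of them that is
bounded by the `(j + 1)`-landmarks (`exists_center`), because stopping requires the distance to be
less than a third of the radius. So the data of level `j` have at most the size of the sum, over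
the `j`-landmarks `c`, of the cubes of the numbers of `j`-landmarks in the ball around `c`
(`sum_length_pathEntries_le`).

Let `p j` be the rate of the landmarks of level `j`. The ball around `c` contains about `1 / p (j +
1)` copies of vertices, with exponential tails (`sum_exp_load_le`), and therefore about `p j / p (j
+ 1)` landmarks of level `j`. The expected sum of cubes is of the order `n * p j * (p j / p (j +
1)) ^ 3`, and the rates are such that `p j ^ 4 = p (j + 1) ^ 3`, so that it is linear
(`sum_prob_mul_cube_le`). As copies are distributed according to the degrees, a ball with few
copies has few edges, and the exponential tails bound all balls of level `0` at the same time with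
high probability (`sum_prob_good`, `searchBound_le`). The search takes `O(n ^ (3 / 4) ^ h * log n ^
2)` steps, up to the density of `H`, and the logarithms disappear if `(3 / 4) ^ h < ε`
(`exists_growth_const`).
-/

namespace PathOracle

/-! ### Instructions with array access -/

section Arrays

/-- Instructions of an intermediate machine, whose memory is divided into numbered arrays with the
same number of cells, one family for integers and one for weights. In `ld d f a`, the cell of the
integer array `f` with the index in register `a` is copied to register `d`; `st f a b` stores
register `b` there; `wld` and `wst` do the same for weights. -/
inductive Instr
  | set (d k : ℕ)
  | op (o : Op) (d a b : ℕ)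
  | opi (o : Op) (d a k : ℕ)
  | ld (d f a : ℕ)
  | st (f a b : ℕ)
  | wz (d : ℕ)
  | wa (d a b : ℕ)
  | wld (d f a : ℕ)
  | wst (f a b : ℕ)
  | emit (a : ℕ)

/-- The states of the intermediate machine: integer registers, weight registers, integer arrays,
weight arrays, and the output. -/
structure Cfg where
  r : ℕ → ℕ
  w : ℕ → ℝ≥0
  A : ℕ → ℕ → ℕ
  B : ℕ → ℕ → ℝ≥0
  out : List ℕ

/-- The effect of an instruction. -/
def Instr.exec : Instr → Cfg → Cfg
  | .set d k, c => { c with r := Function.update c.r d k }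
  | .op o d a b, c => { c with r := Function.update c.r d (o.eval (c.r a) (c.r b)) }
  | .opi o d a k, c => { c with r := Function.update c.r d (o.eval (c.r a) k) }
  | .ld d f a, c => { c with r := Function.update c.r d (c.A f (c.r a)) }
  | .st f a b, c =>
    { c with A := Function.update c.A f (Function.update (c.A f) (c.r a) (c.r b)) }
  | .wz d, c => { c with w := Function.update c.w d 0 }
  | .wa d a b, c => { c with w := Function.update c.w d (c.w a + c.w b) }
  | .wld d f a, c => { c with w := Function.update c.w d (c.B f (c.r a)) }
  | .wst f a b, c =>
    { c with B := Function.update c.B f (Function.update (c.B f) (c.r a) (c.w b)) }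
  | .emit a, c => { c with out := c.out ++ [c.r a] }

/-- The condition under which an instruction has its effect on words below `W` and `F` arrays of
`N` cells: no overflow, and addresses within the arrays. -/
def Instr.Ok (W F N : ℕ) : Instr → Cfg → Prop
  | .set _ k, _ => k < W
  | .op o _ a b, c => o.eval (c.r a) (c.r b) < W
  | .opi o _ a k, c => k < W ∧ o.eval (c.r a) k < W
  | .ld _ f a, c => f < F ∧ c.r a < N
  | .st f a _, c => f < F ∧ c.r a < N
  | .wld _ f a, c => f < F ∧ c.r a < N
  | .wst f a _, c => f < F ∧ c.r a < N
  | _, _ => True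

/-- The address of a cell is computed in the register `3`: the register `2` holds the length of the
arrays. -/
def address (f a : ℕ) : Prog :=
  .seq (.iset 3 f) (.seq (.iop .mul 3 3 2) (.iop .add 3 3 (a + 5)))

/-- The translation of the instructions; register `a` is register `a + 5` of the machine. -/
def Instr.code : Instr → Prog
  | .set d k => .iset (d + 5) k
  | .op o d a b => .iop o (d + 5) (a + 5) (b + 5)
  | .opi o d a k => .seq (.iset 3 k) (.iop o (d + 5) (a + 5) 3)
  | .ld d f a => .seq (address f a) (.iload (d + 5) 3)
  | .st f a b => .seq (address f a) (.istore 3 (b + 5))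
  | .wz d => .wzero d
  | .wa d a b => .wadd d a b
  | .wld d f a => .seq (address f a) (.wload d 3)
  | .wst f a b => .seq (address f a) (.wstore 3 b)
  | .emit a => .emit (a + 5)

/-- A sequence of instructions. -/
def blk : List Instr → Prog
  | [] => .skip
  | i :: l => .seq i.code (blk l)

/-- The effect of a sequence of instructions. -/
def execAll : List Instr → Cfg → Cfg
  | [], c => c
  | i :: l, c => execAll l (i.exec c)

/-- The condition under which a sequence of instructions has its effect. -/
def OkAll (W F N : ℕ) : List Instr → Cfg → Prop
  | [], _ => True
  | i :: l, c => i.Ok W F N c ∧ OkAll W F N l (i.exec c)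

/-- The test of `r a < r b`, for registers of the intermediate machine: the machine keeps the
register `a` in its register `a + 5`. -/
def lt (a b : ℕ) : Test := .ilt (a + 5) (b + 5)

/-- The test of `r a = r b`. -/
def eq (a b : ℕ) : Test := .ieq (a + 5) (b + 5)

/-- The test of `0 < r a`; register `4` of the machine holds `0`. -/
def pos (a : ℕ) : Test := .ilt 4 (a + 5)

/-- The state `s` of the machine represents the state `c` of the intermediate machine, with arrays
of `N` cells: cell `x` of the array `f` is at the address `f * N + x`. The registers `2`, `3` and
`4` of the machine are reserved for `N`, for addresses, and for `0`. -/
structure Rep (N : ℕ) (c : Cfg) (s : State) : Prop where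
  len : s.ireg 2 = N
  zero : s.ireg 4 = 0
  ireg : ∀ a, s.ireg (a + 5) = c.r a
  wreg : s.wreg = c.w
  imem : s.imem = fun a => c.A (a / N) (a % N)
  wmem : s.wmem = fun a => c.B (a / N) (a % N)
  out : s.out = c.out

/-- The program `P`, started in a state that represents `c`, halts within `t` steps in a state that
represents some `c'` with `R c'`. Here words are below `W`, and there are `F` arrays of `N` cells.
The lemmas about `Ex` are the rules of a program logic with running times; as `R` may again be of
the form `Ex`, the parts of a program are treated one after the other. -/
def Ex (W F N : ℕ) (P : Prog) (c : Cfg) (t : ℕ) (R : Cfg → Prop) : Prop :=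
  0 < N → F * N ≤ W → ∀ s, Rep N c s →
    ∃ s' τ c', Run W (F * N) P s s' τ ∧ τ ≤ t ∧ Rep N c' s' ∧ R c'

variable {W F N : ℕ} {P Q : Prog} {c : Cfg} {t t₁ t₂ : ℕ} {R R' : Cfg → Prop}

lemma Ex.mono (h : Ex W F N P c t₁ R) (ht : t₁ ≤ t) (hR : ∀ c', R c' → R' c') :
    Ex W F N P c t R' := by
  intro h0 h1 s hs
  obtain ⟨s', τ, c', h2, h3, h4, h5⟩ := h h0 h1 s hs
  exact ⟨s', τ, c', h2, h3.trans ht, h4, hR _ h5⟩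

lemma Ex.seq (h : Ex W F N P c t₁ fun c' => Ex W F N Q c' t₂ R) :
    Ex W F N (.seq P Q) c (t₁ + t₂) R := by
  intro h0 h1 s hs
  obtain ⟨s', τ, c', h2, h3, h4, h5⟩ := h h0 h1 s hs
  obtain ⟨s'', τ', c'', h2', h3', h4', h5'⟩ := h5 h0 h1 s' h4
  exact ⟨s'', τ + τ', c'', .seq _ _ _ _ _ _ _ h2 h2', by omega, h4', h5'⟩

lemma Ex.skip (h : R c) : Ex W F N .skip c 1 R :=
  fun _ _ s hs => ⟨s, 1, c, .skip s, le_rfl, hs, h⟩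

/-- The truth of a test of the intermediate machine. -/
def Test.On (T : Test) (c : Cfg) : Prop :=
  match T with
  | .ilt a b => (if a = 4 then 0 else c.r (a - 5)) < c.r (b - 5)
  | .ieq a b => c.r (a - 5) = c.r (b - 5)
  | .wlt a b => c.w a < c.w b

/-- The tests that do not refer to the reserved registers of the machine. -/
def Test.Fine : Test → Prop
  | .ilt a b => 4 ≤ a ∧ 5 ≤ b
  | .ieq a b => 5 ≤ a ∧ 5 ≤ b
  | .wlt _ _ => True

@[simp] lemma fine_lt (a b : ℕ) : (lt a b).Fine := ⟨by omega, by omega⟩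
@[simp] lemma fine_eq (a b : ℕ) : (eq a b).Fine := ⟨by omega, by omega⟩
@[simp] lemma fine_pos (a : ℕ) : (pos a).Fine := ⟨by omega, by omega⟩
@[simp] lemma fine_wlt (a b : ℕ) : (Test.wlt a b).Fine := trivial
@[simp] lemma on_lt (a b : ℕ) : (lt a b).On c ↔ c.r a < c.r b := by simp [lt, Test.On]
@[simp] lemma on_eq (a b : ℕ) : (eq a b).On c ↔ c.r a = c.r b := by simp [eq, Test.On]
@[simp] lemma on_pos (a : ℕ) : (pos a).On c ↔ 0 < c.r a := by simp [pos, Test.On]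
@[simp] lemma on_wlt (a b : ℕ) : (Test.wlt a b).On c ↔ c.w a < c.w b := Iff.rfl

lemma Rep.holds {s : State} (hs : Rep N c s) {T : Test} (hT : T.Fine) : T.Holds s ↔ T.On c := by
  have h5 : ∀ a, 5 ≤ a → s.ireg a = c.r (a - 5) := fun a ha => by
    rw [← hs.ireg, Nat.sub_add_cancel ha]
  cases T with
  | ilt a b =>
    have hb := h5 b hT.2
    by_cases ha : a = 4
    · subst ha
      simp [Test.Holds, Test.On, hb, hs.zero]
    · have := h5 a (by have := hT.1; omega)
      simp [Test.Holds, Test.On, hb, this, ha]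
  | ieq a b => simp [Test.Holds, Test.On, h5 a hT.1, h5 b hT.2]
  | wlt a b => simp [Test.Holds, Test.On, hs.wreg]

lemma Ex.cond {T : Test} (hT : T.Fine) (h1 : T.On c → Ex W F N P c t R)
    (h2 : ¬ T.On c → Ex W F N Q c t R) : Ex W F N (.cond T P Q) c (t + 1) R := by
  intro h0 hW s hs
  by_cases h : T.On c
  · obtain ⟨s', τ, c', a, b, d, e⟩ := h1 h h0 hW s hs
    exact ⟨s', τ + 1, c', .cond_true _ _ _ _ _ _ ((hs.holds hT).2 h) a, by omega, d, e⟩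
  · obtain ⟨s', τ, c', a, b, d, e⟩ := h2 h h0 hW s hs
    exact ⟨s', τ + 1, c', .cond_false _ _ _ _ _ _ (fun h' => h ((hs.holds hT).1 h')) a, by omega,
      d, e⟩

lemma Ex.loop_stop {T : Test} (hT : T.Fine) (h : ¬ T.On c) (hR : R c) :
    Ex W F N (.loop T P) c 1 R :=
  fun _ _ s hs =>
    ⟨s, 1, c, .loop_false _ _ _ (fun h' => h ((hs.holds hT).1 h')), le_rfl, hs, hR⟩

lemma Ex.loop_step {T : Test} (hT : T.Fine) (h : T.On c)
    (hP : Ex W F N P c t₁ fun c' => Ex W F N (.loop T P) c' t₂ R) :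
    Ex W F N (.loop T P) c (t₁ + t₂ + 1) R := by
  intro h0 h1 s hs
  obtain ⟨s', τ, c', h2, h3, h4, h5⟩ := hP h0 h1 s hs
  obtain ⟨s'', τ', c'', h2', h3', h4', h5'⟩ := h5 h0 h1 s' h4
  exact ⟨s'', τ + τ' + 1, c'', .loop_true _ _ _ _ _ _ _ ((hs.holds hT).2 h) h2 h2', by omega, h4',
    h5'⟩

lemma run_address {s : State} (hs : Rep N c s) (f a : ℕ) (hN : 0 < N) (hW : F * N ≤ W) (hf : f < F)
    (ha : c.r a < N) :
    ∃ s', Run W (F * N) (address f a) s s' 3 ∧ Rep N c s' ∧ s'.ireg 3 = f * N + c.r a ∧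
      f * N + c.r a < F * N := by
  have h1 : f * N + c.r a < F * N := by
    have : (f + 1) * N ≤ F * N := Nat.mul_le_mul_right _ hf
    rw [Nat.succ_mul] at this
    omega
  have h2 : f < W := by
    have : f * 1 ≤ f * N := Nat.mul_le_mul_left _ hN
    omega
  refine ⟨_, .seq _ _ _ _ _ 1 2 (.iset _ _ _) (.seq _ _ _ _ _ 1 1 (.iop _ _ _ _ _)
    (.iop _ _ _ _ _)), ⟨?_, ?_, ?_, ?_, ?_, ?_, ?_⟩, ?_, h1⟩
  all_goals simp [Op.eval, hs.len, hs.zero, hs.ireg, hs.wreg, hs.imem, hs.wmem, hs.out,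
    Nat.mod_eq_of_lt h2,
    Nat.mod_eq_of_lt (h1.trans_le hW)]

/-- A write to a cell of an array changes one cell of the linear memory. -/
lemma update_cells {α : Type*} (A : ℕ → ℕ → α) (f x : ℕ) (y : α) (hx : x < N) :
    Function.update (fun a => A (a / N) (a % N)) (f * N + x) y =
      fun a => Function.update A f (Function.update (A f) x y) (a / N) (a % N) := by
  have hN : 0 < N := by omega
  have h1 : (f * N + x) / N = f := by
    rw [mul_comm, Nat.mul_add_div hN, Nat.div_eq_of_lt hx, add_zero]
  have h2 : (f * N + x) % N = x := by
    rw [mul_comm, Nat.mul_add_mod, Nat.mod_eq_of_lt hx]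
  funext a
  by_cases ha : a = f * N + x
  · subst ha
    simp [h1, h2]
  · rw [Function.update_of_ne ha]
    by_cases hf : a / N = f
    · have : a % N ≠ x := by
        intro h
        apply ha
        rw [← hf, ← h, mul_comm, Nat.div_add_mod]
      simp [hf, this]
    · simp [hf]

/-- Each instruction of the intermediate machine is simulated in at most four steps. -/
lemma run_instr (i : Instr) {s : State} (hs : Rep N c s) (hN : 0 < N) (hW : F * N ≤ W)
    (hi : i.Ok W F N c) :
    ∃ s' τ, Run W (F * N) i.code s s' τ ∧ τ ≤ 4 ∧ Rep N (i.exec c) s' := by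
  have hN' : ∀ f x, x < N → (f * N + x) / N = f ∧ (f * N + x) % N = x := fun f x hx =>
    ⟨by rw [mul_comm, Nat.mul_add_div hN, Nat.div_eq_of_lt hx, add_zero],
      by rw [mul_comm, Nat.mul_add_mod, Nat.mod_eq_of_lt hx]⟩
  cases i with
  | set d k =>
    refine ⟨_, _, .iset _ _ _, by omega, ⟨?_, ?_, ?_, ?_, ?_, ?_, ?_⟩⟩
    all_goals simp [Instr.exec, hs.len, hs.zero, hs.ireg, hs.wreg, hs.imem, hs.wmem, hs.out,
      Nat.mod_eq_of_lt hi, Function.update_apply]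
  | op o d a b =>
    refine ⟨_, _, .iop _ _ _ _ _, by omega, ⟨?_, ?_, ?_, ?_, ?_, ?_, ?_⟩⟩
    all_goals simp [Instr.exec, hs.len, hs.zero, hs.ireg, hs.wreg, hs.imem, hs.wmem, hs.out,
      Nat.mod_eq_of_lt hi, Function.update_apply]
  | opi o d a k =>
    refine ⟨_, _, .seq _ _ _ _ _ _ _ (.iset _ _ _) (.iop _ _ _ _ _), by omega,
      ⟨?_, ?_, ?_, ?_, ?_, ?_, ?_⟩⟩
    all_goals simp [Instr.exec, hs.len, hs.zero, hs.ireg, hs.wreg, hs.imem, hs.wmem, hs.out,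
      Nat.mod_eq_of_lt hi.1, Nat.mod_eq_of_lt hi.2, Function.update_apply]
  | ld d f a =>
    obtain ⟨s1, h1, hs, h3, h4⟩ := run_address hs f a hN hW hi.1 hi.2
    refine ⟨_, _, .seq _ _ _ _ _ _ _ h1 (.iload _ _ _ (h3 ▸ h4)), by omega,
      ⟨?_, ?_, ?_, ?_, ?_, ?_, ?_⟩⟩
    all_goals simp [Instr.exec, hs.len, hs.zero, hs.ireg, hs.wreg, hs.imem, hs.wmem, hs.out,
      Function.update_apply, h3, hN' f _ hi.2]
  | st f a b =>
    obtain ⟨s1, h1, hs, h3, h4⟩ := run_address hs f a hN hW hi.1 hi.2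
    refine ⟨_, _, .seq _ _ _ _ _ _ _ h1 (.istore _ _ _ (h3 ▸ h4)), by omega,
      ⟨?_, ?_, ?_, ?_, ?_, ?_, ?_⟩⟩
    all_goals simp [Instr.exec, hs.len, hs.zero, hs.ireg, hs.wreg, hs.imem, hs.wmem, hs.out,
      h3, update_cells _ f _ _ hi.2]
  | wz d =>
    refine ⟨_, _, .wzero _ _, by omega, ⟨?_, ?_, ?_, ?_, ?_, ?_, ?_⟩⟩
    all_goals simp [Instr.exec, hs.len, hs.zero, hs.ireg, hs.wreg, hs.imem, hs.wmem, hs.out]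
  | wa d a b =>
    refine ⟨_, _, .wadd _ _ _ _, by omega, ⟨?_, ?_, ?_, ?_, ?_, ?_, ?_⟩⟩
    all_goals simp [Instr.exec, hs.len, hs.zero, hs.ireg, hs.wreg, hs.imem, hs.wmem, hs.out]
  | wld d f a =>
    obtain ⟨s1, h1, hs, h3, h4⟩ := run_address hs f a hN hW hi.1 hi.2
    refine ⟨_, _, .seq _ _ _ _ _ _ _ h1 (.wload _ _ _ (h3 ▸ h4)), by omega,
      ⟨?_, ?_, ?_, ?_, ?_, ?_, ?_⟩⟩
    all_goals simp [Instr.exec, hs.len, hs.zero, hs.ireg, hs.wreg, hs.imem, hs.wmem, hs.out,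
      h3, hN' f _ hi.2]
  | wst f a b =>
    obtain ⟨s1, h1, hs, h3, h4⟩ := run_address hs f a hN hW hi.1 hi.2
    refine ⟨_, _, .seq _ _ _ _ _ _ _ h1 (.wstore _ _ _ (h3 ▸ h4)), by omega,
      ⟨?_, ?_, ?_, ?_, ?_, ?_, ?_⟩⟩
    all_goals simp [Instr.exec, hs.len, hs.zero, hs.ireg, hs.wreg, hs.imem, hs.wmem, hs.out,
      h3, update_cells _ f _ _ hi.2]
  | emit a =>
    refine ⟨_, _, .emit _ _, by omega, ⟨?_, ?_, ?_, ?_, ?_, ?_, ?_⟩⟩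
    all_goals simp [Instr.exec, hs.len, hs.zero, hs.ireg, hs.wreg, hs.imem, hs.wmem, hs.out]

lemma Ex.blk (l : List Instr) (hl : OkAll W F N l c) (h : R (execAll l c)) :
    Ex W F N (blk l) c (4 * l.length + 1) R := by
  induction l generalizing c with
  | nil => exact Ex.skip h
  | cons i l ih =>
    intro h0 h1 s hs
    obtain ⟨s', τ, a, b, d⟩ := run_instr i hs h0 h1 hl.1
    obtain ⟨s'', τ', c'', h2', h3', h4', h5'⟩ := ih hl.2 h h0 h1 s' d
    exact ⟨s'', τ + τ', c'', .seq _ _ _ _ _ _ _ a h2', by simp only [List.length_cons]; omega, h4',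
      h5'⟩

end Arrays

/-! ### Following pointers and the stack -/

section Pointers

variable {n : ℕ} {H : SimpleGraph (Fin n)} {W F N : ℕ}

/-- The vertices of a walk, as numbers. -/
def verts {u v : Fin n} (p : H.Walk u v) : List ℕ := p.support.map Fin.val

/-- The vertices of a walk except the last one. -/
def inits : {u v : Fin n} → H.Walk u v → List ℕ
  | _, _, .nil => []
  | u, _, .cons _ p => (u : ℕ) :: inits p

lemma verts_append {u v w : Fin n} (p : H.Walk u v) (q : H.Walk v w) :
    verts (p.append q) = inits p ++ verts q := by
  induction p with
  | nil => simp [inits]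
  | cons h p ih => simpa [inits, verts] using ih q

lemma verts_eq {u v : Fin n} (p : H.Walk u v) : verts p = inits p ++ [(v : ℕ)] := by
  simpa [verts] using verts_append p (.nil' v)

lemma verts_reverse {u v : Fin n} (p : H.Walk u v) :
    verts p.reverse = (v : ℕ) :: (inits p).reverse := by
  have : verts p.reverse = (verts p).reverse := by
    simp [verts]
  simp [this, verts_eq p]

lemma verts_detour {u v x y : Fin n} (p : H.Walk u x) (r : H.Walk x y) (q : H.Walk v y) :
    verts (p.append (r.append q.reverse)) = inits p ++ (verts r ++ (inits q).reverse) := by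
  rw [verts_append, verts_append, verts_reverse, verts_eq r]
  simp

lemma length_inits {u v : Fin n} (p : H.Walk u v) : (inits p).length = p.length := by
  induction p with
  | nil => rfl
  | cons h p ih => simp [inits, ih]

/-- The walk `p` is obtained by following the pointers `f`: `f x` is `w + 1` if `w` is the next
vertex after `x`, and `0` if the walk ends in `x`. -/
def Follows (f : ℕ → ℕ) : {u v : Fin n} → H.Walk u v → Prop
  | u, _, .nil => f u = 0
  | u, _, .cons (v := w) _ p => f u = w + 1 ∧ Follows f p

/-- Output the vertices, except the last one, of the walk that starts at register `0` and follows
the pointers in the array `f`; register `0` moves to the last vertex. -/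
def followEmit (f : ℕ) : Prog :=
  .seq (blk [.ld 2 f 0]) (.loop (pos 2) (blk [.emit 0, .opi .sub 0 2 1, .ld 2 f 0]))

/-- Push the vertices, except the last one, of the walk that starts at register `1` and follows the
pointers in the array `f`; register `1` moves to the last vertex. The stack is the array `8`, with
its height in register `18`. -/
def followPush (f : ℕ) : Prog :=
  .seq (blk [.ld 2 f 1])
    (.loop (pos 2) (blk [.st 8 18 1, .opi .add 18 18 1, .opi .sub 1 2 1, .ld 2 f 1]))

/-- Output the stack from its top to its bottom, and erase it. -/
def popAll : Prog :=
  .loop (pos 18) (blk [.opi .sub 18 18 1, .ld 2 8 18, .emit 2, .set 3 0, .st 8 18 3])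

/-- The stack holds the list `l`, bottom first. -/
def Stack (c : Cfg) (l : List ℕ) : Prop :=
  c.r 18 = l.length ∧ c.A 8 = fun i => l.getD i 0

lemma followEmit_spec {u v : Fin n} (p : H.Walk u v) {f : ℕ} {c : Cfg} (hp : Follows (c.A f) p)
    (hu : c.r 0 = u) (hf : f < F) (hn : n ≤ N) (hnW : n < W) :
    Ex W F N (followEmit f) c (14 * p.length + 6) fun c' =>
      c'.r 0 = v ∧ c'.out = c.out ++ inits p ∧ c'.A = c.A ∧ c'.B = c.B ∧ c'.w = c.w ∧
        ∀ a, a ≠ 0 → a ≠ 2 → c'.r a = c.r a := by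
  have key : ∀ c : Cfg, Follows (c.A f) p → c.r 0 = u → c.r 2 = c.A f u →
      Ex W F N (.loop (pos 2) (blk [.emit 0, .opi .sub 0 2 1, .ld 2 f 0])) c (14 * p.length + 1)
        fun c' => c'.r 0 = v ∧ c'.out = c.out ++ inits p ∧ c'.A = c.A ∧ c'.B = c.B ∧ c'.w = c.w ∧
          ∀ a, a ≠ 0 → a ≠ 2 → c'.r a = c.r a := by
    clear hp hu c
    induction p with
    | nil =>
      intro c hp h0 h2
      refine (Ex.loop_stop (by simp) ?_ ?_)
      · simp [h2, show c.A f _ = 0 from hp]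
      · simp [h0, inits]
    | @cons u w v h p ih =>
      intro c hp h0 h2
      obtain ⟨hp1, hp2⟩ := hp
      have hw := w.2
      refine Ex.mono (t₁ := 13 + (14 * p.length + 1) + 1)
        (Ex.loop_step (by simp) (by simp [h2, hp1]) (Ex.blk _ ?_ ?_)) (by simp; omega)
        (fun c' h => h)
      · simp [OkAll, Instr.Ok, Instr.exec, Op.eval, h2, hp1]
        omega
      · refine Ex.mono (ih _ ?_ ?_ ?_) le_rfl ?_
        · exact hp2
        · simp [execAll, Instr.exec, Op.eval, h2, hp1]
        · simp [execAll, Instr.exec, Op.eval, h2, hp1]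
        · rintro c' ⟨h1, h2, h3, h4, h5, h6⟩
          refine ⟨h1, ?_, h3, h4, h5, ?_⟩
          · simp [h2, execAll, Instr.exec, inits, h0]
          · intro a ha ha'
            simp [h6 a ha ha', execAll, Instr.exec, ha, ha']
  have hu' := u.2
  refine Ex.mono (Ex.seq (Ex.blk (R := fun c' => Ex W F N _ c' (14 * p.length + 1) _) _ ?_
    (Ex.mono (key _ ?_ ?_ ?_) le_rfl ?_))) (t₁ := 5 + (14 * p.length + 1)) (by omega)
    (fun c' h => h)
  · simp [OkAll, Instr.Ok, hu, hf]
    omega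
  · exact hp
  · simp [execAll, Instr.exec, hu]
  · simp [execAll, Instr.exec, hu]
  · rintro c' ⟨h1, h2, h3, h4, h5, h6⟩
    refine ⟨h1, h2, h3, h4, h5, fun a ha ha' => ?_⟩
    simp [h6 a ha ha', execAll, Instr.exec, ha']

/-- The effect of a push on the array that holds the stack. -/
lemma getD_append_singleton (l : List ℕ) (x : ℕ) :
    Function.update (fun i => l.getD i 0) l.length x = fun i => (l ++ [x]).getD i 0 := by
  funext i
  rcases lt_trichotomy i l.length with h | h | h
  · rw [Function.update_of_ne h.ne]
    simp [List.getD_eq_getElem?_getD, List.getElem?_append_left h]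
  · subst h
    simp [List.getD_eq_getElem?_getD]
  · rw [Function.update_of_ne h.ne']
    rw [List.getD_eq_default _ _ h.le, List.getD_eq_default _ _ (by simp; omega)]

lemma followPush_spec {u v : Fin n} (p : H.Walk u v) {f : ℕ} {c : Cfg} {l : List ℕ}
    (hp : Follows (c.A f) p) (hf8 : f ≠ 8) (hl : Stack c l) (hlN : l.length + p.length ≤ N)
    (hu : c.r 1 = u) (hf : f < F) (hF : 8 < F) (hn : n ≤ N) (hNW : N < W) :
    Ex W F N (followPush f) c (18 * p.length + 6) fun c' =>
      c'.r 1 = v ∧ Stack c' (l ++ inits p) ∧ c'.out = c.out ∧ (∀ g, g ≠ 8 → c'.A g = c.A g) ∧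
        c'.B = c.B ∧ c'.w = c.w ∧ ∀ a, a ≠ 1 → a ≠ 2 → a ≠ 18 → c'.r a = c.r a := by
  have key : ∀ (c : Cfg) (l : List ℕ), Follows (c.A f) p → c.r 1 = u → c.r 2 = c.A f u →
      Stack c l → l.length + p.length ≤ N →
      Ex W F N (.loop (pos 2) (blk [.st 8 18 1, .opi .add 18 18 1, .opi .sub 1 2 1, .ld 2 f 1])) c
        (18 * p.length + 1) fun c' => c'.r 1 = v ∧ Stack c' (l ++ inits p) ∧ c'.out = c.out ∧
          (∀ g, g ≠ 8 → c'.A g = c.A g) ∧ c'.B = c.B ∧ c'.w = c.w ∧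
          ∀ a, a ≠ 1 → a ≠ 2 → a ≠ 18 → c'.r a = c.r a := by
    clear hp hu hl hlN l c
    induction p with
    | nil =>
      intro c l hp h0 h2 hl hlN
      refine (Ex.loop_stop (by simp) ?_ ?_)
      · simp [h2, show c.A f _ = 0 from hp]
      · simp [h0, inits, hl]
    | @cons u w v h p ih =>
      intro c l hp h0 h2 hl hlN
      obtain ⟨hp1, hp2⟩ := hp
      obtain ⟨hl1, hl2⟩ := hl
      have hw := w.2
      rw [SimpleGraph.Walk.length_cons] at hlN
      refine Ex.mono (t₁ := 17 + (18 * p.length + 1) + 1)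
        (Ex.loop_step (by simp) (by simp [h2, hp1]) (Ex.blk _ ?_ ?_)) (by simp; omega)
        (fun c' h => h)
      · simp [OkAll, Instr.Ok, Instr.exec, Op.eval, h2, hp1, hl1]
        omega
      · refine Ex.mono (ih _ (l ++ [(u : ℕ)]) ?_ ?_ ?_ ?_ ?_) le_rfl ?_
        · simpa [execAll, Instr.exec, hf8] using hp2
        · simp [execAll, Instr.exec, Op.eval, h2, hp1]
        · simp [execAll, Instr.exec, Op.eval, h2, hp1]
        · simp [execAll, Instr.exec, Op.eval, Stack, hl1, hl2, h0]
          exact getD_append_singleton l u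
        · simp
          omega
        · rintro c' ⟨h1, h2, h3, h4, h5, h6, h7⟩
          refine ⟨h1, ?_, h3, ?_, h5, h6, ?_⟩
          · simpa [inits] using h2
          · intro g hg
            simp [h4 g hg, execAll, Instr.exec, hg]
          · intro a ha ha' ha''
            simp [h7 a ha ha' ha'', execAll, Instr.exec, ha, ha', ha'']
  have hu' := u.2
  refine Ex.mono (Ex.seq (Ex.blk (R := fun c' => Ex W F N _ c' (18 * p.length + 1) _) _ ?_
    (Ex.mono (key _ l ?_ ?_ ?_ ?_ hlN) le_rfl ?_))) (t₁ := 5 + (18 * p.length + 1)) (by omega)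
    (fun c' h => h)
  · simp [OkAll, Instr.Ok, hu, hf]
    omega
  · exact hp
  · simp [execAll, Instr.exec, hu]
  · simp [execAll, Instr.exec, hu]
  · simpa [execAll, Instr.exec, Stack] using hl
  · rintro c' ⟨h1, h2, h3, h4, h5, h6, h7⟩
    refine ⟨h1, h2, h3, h4, h5, h6, fun a ha ha' ha'' => ?_⟩
    simp [h7 a ha ha' ha'', execAll, Instr.exec, ha']

lemma popAll_spec {c : Cfg} {l : List ℕ} (hl : Stack c l) (hlN : l.length ≤ N) (hF : 8 < F)
    (hNW : N < W) :
    Ex W F N popAll c (22 * l.length + 1) fun c' =>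
      Stack c' [] ∧ c'.out = c.out ++ l.reverse ∧ (∀ g, g ≠ 8 → c'.A g = c.A g) ∧
        c'.B = c.B ∧ c'.w = c.w ∧ ∀ a, a ≠ 2 → a ≠ 3 → a ≠ 18 → c'.r a = c.r a := by
  induction l using List.reverseRecOn generalizing c with
  | nil =>
    refine (Ex.loop_stop (by simp) ?_ ?_)
    · simp [hl.1]
    · simp [hl]
  | append_singleton l x ih =>
    obtain ⟨hl1, hl2⟩ := hl
    simp only [List.length_append, List.length_singleton] at hl1 hlN
    refine Ex.mono (t₁ := 21 + (22 * l.length + 1) + 1)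
      (Ex.loop_step (by simp) (by simp [hl1]) (Ex.blk _ ?_ ?_)) (by simp; omega)
      (fun c' h => h)
    · simp [OkAll, Instr.Ok, Instr.exec, Op.eval, hl1]
      omega
    · refine Ex.mono (ih ⟨?_, ?_⟩ (by omega)) le_rfl ?_
      · simp [execAll, Instr.exec, Op.eval, hl1]
      · simp only [execAll, Instr.exec, Op.eval, hl1, hl2]
        simp only [Function.update_self, Nat.add_sub_cancel, ne_eq, Nat.reduceEqDiff,
          not_false_eq_true, Function.update_of_ne]
        rw [← getD_append_singleton, Function.update_idem]
        funext i
        by_cases hi : i = l.length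
        · subst hi; simp
        · simp [hi]
      · rintro c' ⟨h1, h2, h3, h4, h5, h6⟩
        refine ⟨h1, ?_, ?_, h4, h5, ?_⟩
        · simp [h2, execAll, Instr.exec, hl1, hl2, Op.eval]
        · intro g hg
          simp [h3 g hg, execAll, Instr.exec, hg]
        · intro a ha ha' ha''
          simp [h6 a ha ha' ha'', execAll, Instr.exec, ha, ha', ha'']

/-! ### Searching a key -/

/-- Find the key in register `19` in the increasing array `9` by binary search between the
registers `3` and `4`; register `17` becomes `1` if it occurs, and `0` otherwise. -/
def lookup : Prog :=
  .seq (.loop (lt 3 4) (.seq (blk [.op .add 5 3 4, .opi .div 5 5 2, .ld 6 9 5])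
    (.cond (lt 6 19) (blk [.opi .add 3 5 1]) (blk [.opi .add 4 5 0]))))
    (.seq (blk [.ld 6 9 3]) (.cond (eq 6 19) (blk [.set 17 1]) (blk [.set 17 0])))

lemma lookup_spec {c : Cfg} {m : ℕ} (hmono : ∀ i j, i < j → j < m → c.A 9 i < c.A 9 j)
    (h0 : ∀ i, m ≤ i → c.A 9 i = 0) (hpos : 0 < c.r 19) (h3 : c.r 3 = 0) (h4 : c.r 4 = m)
    (hmN : m < N) (hNW : 2 * N < W) (hF : 9 < F) :
    Ex W F N lookup c (20 * Nat.log 2 (2 * N) + 20) fun c' =>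
      c'.out = c.out ∧ c'.A = c.A ∧ c'.B = c.B ∧ c'.w = c.w ∧
      (∀ a, a ≠ 3 → a ≠ 4 → a ≠ 5 → a ≠ 6 → a ≠ 17 → c'.r a = c.r a) ∧
      ((∃ i < m, c.A 9 i = c.r 19 ∧ c'.r 3 = i ∧ c'.r 17 = 1) ∨
        ((∀ i < m, c.A 9 i ≠ c.r 19) ∧ c'.r 17 = 0)) := by
  have key : ∀ (d lo hi : ℕ) (c' : Cfg), hi - lo ≤ d → lo ≤ hi → hi ≤ m → c'.r 3 = lo →
      c'.r 4 = hi → c'.A = c.A → c'.r 19 = c.r 19 → (∀ i < lo, c.A 9 i < c.r 19) →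
      (∀ i, hi ≤ i → i < m → c.r 19 ≤ c.A 9 i) →
      Ex W F N (.loop (lt 3 4) (.seq (blk [.op .add 5 3 4, .opi .div 5 5 2, .ld 6 9 5])
        (.cond (lt 6 19) (blk [.opi .add 3 5 1]) (blk [.opi .add 4 5 0])))) c'
        (20 * Nat.log 2 (2 * d) + 1) fun c'' =>
          c''.out = c'.out ∧ c''.A = c'.A ∧ c''.B = c'.B ∧ c''.w = c'.w ∧
          (∀ a, a ≠ 3 → a ≠ 4 → a ≠ 5 → a ≠ 6 → c''.r a = c'.r a) ∧ c''.r 3 ≤ m ∧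
          (∀ i < c''.r 3, c.A 9 i < c.r 19) ∧
          ∀ i, c''.r 3 ≤ i → i < m → c.r 19 ≤ c.A 9 i := by
    intro d
    induction d using Nat.strong_induction_on with
    | _ d ih =>
      intro lo hi c' hd hlh hhm e3 e4 eA e19 hlo hhi
      by_cases hlt : lo < hi
      · have hlog : Nat.log 2 (2 * (d / 2)) + 1 ≤ Nat.log 2 (2 * d) := by
          rw [mul_comm 2 d, Nat.log_mul_base (by norm_num) (by omega)]
          exact Nat.succ_le_succ (Nat.log_mono_right (by omega))
        have h5 : (lo + hi) / 2 < m := by omega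
        refine Ex.mono (t₁ := (13 + (5 + 1)) + (20 * Nat.log 2 (2 * (d / 2)) + 1) + 1)
          (Ex.loop_step (by simp) (by simp [e3, e4, hlt]) (Ex.seq (Ex.blk _ ?_
            (Ex.cond (by simp) (fun ht => Ex.blk _ ?_ ?_) (fun ht => Ex.blk _ ?_ ?_)))))
          (by omega) (fun c' h => h)
        · simp [OkAll, Instr.Ok, Instr.exec, Op.eval, e3, e4]
          omega
        · simp [OkAll, Instr.Ok, execAll, Instr.exec, Op.eval, e3, e4]
          omega
        · simp [execAll, Instr.exec, Op.eval, e3, e4, eA, e19] at ht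
          refine Ex.mono (ih (d / 2) (by omega) ((lo + hi) / 2 + 1) hi _ (by omega) (by omega) hhm
            ?_ ?_ ?_ ?_ ?_ hhi) le_rfl ?_
          · simp [execAll, Instr.exec, Op.eval, e3, e4]
          · simp [execAll, Instr.exec, e4]
          · simp [execAll, Instr.exec, eA]
          · simp [execAll, Instr.exec, e19]
          · intro i hi'
            rcases (Nat.lt_succ_iff.1 hi').lt_or_eq with h | rfl
            · exact (hmono _ _ h h5).trans ht
            · exact ht
          · rintro c'' ⟨h1, h2, h3, h4, h5, h6⟩
            refine ⟨h1, h2, h3, h4, fun a a3 a4 a5 a6 => ?_, h6⟩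
            simp [h5 a a3 a4 a5 a6, execAll, Instr.exec, *]
        · simp [OkAll, Instr.Ok, execAll, Instr.exec, Op.eval, e3, e4]
          omega
        · simp [execAll, Instr.exec, Op.eval, e3, e4, eA, e19] at ht
          refine Ex.mono (ih (d / 2) (by omega) lo ((lo + hi) / 2) _ (by omega) (by omega) h5.le
            ?_ ?_ ?_ ?_ hlo ?_) le_rfl ?_
          · simp [execAll, Instr.exec, e3]
          · simp [execAll, Instr.exec, Op.eval, e3, e4]
          · simp [execAll, Instr.exec, eA]
          · simp [execAll, Instr.exec, e19]
          · intro i hi' him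
            rcases hi'.lt_or_eq with h | rfl
            · exact ht.trans (hmono _ _ h him).le
            · exact ht
          · rintro c'' ⟨h1, h2, h3, h4, h5, h6⟩
            refine ⟨h1, h2, h3, h4, fun a a3 a4 a5 a6 => ?_, h6⟩
            simp [h5 a a3 a4 a5 a6, execAll, Instr.exec, *]
      · have : lo = hi := by omega
        subst this
        refine Ex.mono (Ex.loop_stop (by simp) (by simp [e3, e4]) ?_) (by omega : 1 ≤ _)
          (fun c' h => h)
        simp only [e3]
        exact ⟨trivial, trivial, trivial, trivial, fun _ _ _ _ _ => trivial, hhm, hlo, hhi⟩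
  refine Ex.mono (t₁ := (20 * Nat.log 2 (2 * m) + 1) + (5 + (5 + 1))) (Ex.seq
    (Ex.mono (key m 0 m c (by omega) (by omega) le_rfl h3 h4 rfl rfl (by simp) (by omega)) le_rfl
      (R' := fun c' => Ex W F N _ c' (5 + (5 + 1)) _) ?_)) ?_ (fun c' h => h)
  · rintro c' ⟨h1, h2, h3, h4, h5, h6, h7, h8⟩
    refine Ex.seq (Ex.blk _ ?_ (Ex.cond (by simp) (fun ht => Ex.blk _ ?_ ?_)
      (fun ht => Ex.blk _ ?_ ?_)))
    · simp [OkAll, Instr.Ok]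
      omega
    · simp [OkAll, Instr.Ok]
      omega
    · simp [execAll, Instr.exec, h2, h5] at ht
      have hm : c'.r 3 < m := by
        by_contra h
        have := h0 _ (not_lt.1 h)
        omega
      refine ⟨h1, h2, h3, h4, fun a a3 a4 a5 a6 a17 => ?_, .inl ⟨c'.r 3, hm, ht, ?_, ?_⟩⟩
      · simp [execAll, Instr.exec, *]
      · simp [execAll, Instr.exec]
      · simp [execAll, Instr.exec]
    · simp [OkAll, Instr.Ok]
      omega
    · simp [execAll, Instr.exec, h2, h5] at ht
      refine ⟨h1, h2, h3, h4, fun a a3 a4 a5 a6 a17 => ?_, .inr ⟨fun i hi he => ?_, ?_⟩⟩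
      · simp [execAll, Instr.exec, *]
      · rcases lt_trichotomy i (c'.r 3) with h | h | h
        · exact (h7 i h).ne he
        · exact ht (h ▸ he)
        · have := h8 _ le_rfl (h.trans hi)
          have := hmono _ _ h hi
          omega
      · simp [execAll, Instr.exec]
  · have := Nat.log_mono_right (b := 2) (show 2 * m ≤ 2 * N by omega)
    omega

/-! ### Reporting a stored path -/

/-- The path `p` is encoded by a list `lst` (of at most `N` entries), read from position `i` on,
and by the numbers `sum x`: at a vertex `x` with predecessor `y`, the next vertex is `a - y` if `a
= sum x` is not `0`, and the next entry of the list otherwise. For the first vertex, `a` and `y`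
are given. -/
def Traced (N : ℕ) (sum lst : ℕ → ℕ) : (a y i : ℕ) → {u v : Fin n} → H.Walk u v → Prop
  | _, _, _, _, _, .nil => True
  | a, y, i, u, _, .cons (v := w) _ p =>
    if a = 0 then i < N ∧ lst i = w ∧ Traced N sum lst (sum w) u (i + 1) p
    else a - y = w ∧ Traced N sum lst (sum w) u i p

/-- Output the path between registers `0` and `1` that is stored under the index in register `3`,
and add its length to the weight register `0`; the array `f` contains the numbers for the vertices.
-/
def reportPath (f : ℕ) : Prog :=
  .seq (blk [.wld 1 9 3, .wa 0 0 1, .ld 4 10 3, .ld 5 11 3, .set 6 0])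
    (.seq (.loop (pos 5) (.seq (blk [.emit 0])
      (.seq (.cond (pos 6) (blk [.op .sub 7 6 2]) (blk [.ld 7 12 4, .opi .add 4 4 1]))
        (blk [.opi .add 2 0 0, .opi .add 0 7 0, .ld 6 f 0, .opi .sub 5 5 1]))))
      (blk [.emit 0]))

lemma reportPath_spec {u v : Fin n} (p : H.Walk u v) {f i : ℕ} {c : Cfg}
    (hp : Traced N (c.A f) (c.A 12) 0 (c.r 2) (c.A 10 i) p) (hl : c.A 11 i = p.length)
    (hu : c.r 0 = u) (h3 : c.r 3 = i) (hiN : i < N) (hf : f < F) (hF : 12 < F) (hn : n ≤ N)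
    (hNW : N < W) (hsW : ∀ x, c.A f x < W) (hlW : p.length < W) :
    Ex W F N (reportPath f) c (40 * p.length + 40) fun c' =>
      c'.out = c.out ++ verts p ∧ c'.A = c.A ∧ c'.B = c.B ∧ c'.w 0 = c.w 0 + c.B 9 i ∧
        ∀ a, a ≠ 0 → a ≠ 2 → a ≠ 4 → a ≠ 5 → a ≠ 6 → a ≠ 7 → c'.r a = c.r a := by
  have key : ∀ (c : Cfg) (a y k : ℕ), Traced N (c.A f) (c.A 12) a y k p → (∀ x, c.A f x < W) →
      c.r 0 = u → c.r 2 = y → c.r 6 = a → a < W → c.r 5 = p.length → c.r 4 = k →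
      Ex W F N (.loop (pos 5) (.seq (blk [.emit 0])
        (.seq (.cond (pos 6) (blk [.op .sub 7 6 2]) (blk [.ld 7 12 4, .opi .add 4 4 1]))
          (blk [.opi .add 2 0 0, .opi .add 0 7 0, .ld 6 f 0, .opi .sub 5 5 1])))) c
        (40 * p.length + 1) fun c' =>
      c'.r 0 = v ∧ c'.out = c.out ++ inits p ∧ c'.A = c.A ∧ c'.B = c.B ∧ c'.w = c.w ∧
        ∀ a, a ≠ 0 → a ≠ 2 → a ≠ 4 → a ≠ 5 → a ≠ 6 → a ≠ 7 → c'.r a = c.r a := by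
    clear hp hl hu h3 hsW c
    induction p with
    | nil =>
      intro c a y k hp hs h0 h2 h6 ha h5 h4
      refine Ex.loop_stop (by simp) ?_ ?_
      · simp [h5]
      · simp [h0, inits]
    | @cons u w v h p ih =>
      intro c a y k hp hs h0 h2 h6 ha h5 h4
      rw [SimpleGraph.Walk.length_cons] at h5
      have hu := u.2
      have hw := w.2
      rw [SimpleGraph.Walk.length_cons] at hlW
      replace ih := ih (by omega)
      refine Ex.mono (t₁ := (5 + ((9 + 1) + 17)) + (40 * p.length + 1) + 1)
        (Ex.loop_step (by simp) (by simp [h5]) (Ex.seq (Ex.blk _ ?_ (Ex.seq (Ex.cond (by simp)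
          (fun ht => Ex.mono (Ex.blk _ ?_ (Ex.blk _ ?_ ?_)) (by simp) (fun c' h => h))
          (fun ht => Ex.blk _ ?_ (Ex.blk _ ?_ ?_)))))))
        (by simp; omega) (fun c' h => h)
      · simp [OkAll, Instr.Ok]
      · simp [OkAll, Instr.Ok, execAll, Instr.exec, Op.eval, h6, h2]
        omega
      · simp [execAll, Instr.exec, h6] at ht
        have hp1 : a - y = w := by
          have : a - y = w ∧ Traced N (c.A f) (c.A 12) (c.A f w) u k p := by
            simpa [Traced, ht.ne'] using hp
          exact this.1
        simp [OkAll, Instr.Ok, execAll, Instr.exec, Op.eval, h6, h2, h0, hp1, h5]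
        omega
      · simp [execAll, Instr.exec, h6] at ht
        have hp' : a - y = w ∧ Traced N (c.A f) (c.A 12) (c.A f w) u k p := by
          simpa [Traced, ht.ne'] using hp
        refine Ex.mono (ih _ (c.A f w) u k ?_ ?_ ?_ ?_ ?_ ?_ ?_ ?_) le_rfl ?_
        · exact hp'.2
        · exact hs
        · simp [execAll, Instr.exec, Op.eval, h6, h2, hp'.1]
        · simp [execAll, Instr.exec, Op.eval, h0]
        · simp [execAll, Instr.exec, Op.eval, h6, h2, hp'.1]
        · exact hs _
        · simp [execAll, Instr.exec, Op.eval, h5]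
        · simp [execAll, Instr.exec, h4]
        · rintro c' ⟨h1, h2, h3, h4, h5, h6⟩
          refine ⟨h1, ?_, h3, h4, h5, ?_⟩
          · simp [h2, execAll, Instr.exec, inits, h0]
          · intro a _ _ _ _ _ _
            simp [execAll, Instr.exec, *]
      · simp [execAll, Instr.exec, h6] at ht
        subst ht
        have hk := (show k < N ∧ c.A 12 k = w ∧ _ by simpa [Traced] using hp).1
        simp [OkAll, Instr.Ok, execAll, Instr.exec, Op.eval, h4]
        omega
      · simp [execAll, Instr.exec, h6] at ht
        subst ht
        have hk := (show k < N ∧ c.A 12 k = w ∧ _ by simpa [Traced] using hp).2.1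
        simp [OkAll, Instr.Ok, execAll, Instr.exec, Op.eval, h4, h0, h5, hk]
        omega
      · simp [execAll, Instr.exec, h6] at ht
        subst ht
        have hp' : k < N ∧ c.A 12 k = w ∧ Traced N (c.A f) (c.A 12) (c.A f w) u (k + 1) p := by
          simpa [Traced] using hp
        refine Ex.mono (ih _ (c.A f w) u (k + 1) ?_ ?_ ?_ ?_ ?_ ?_ ?_ ?_) le_rfl ?_
        · exact hp'.2.2
        · exact hs
        · simp [execAll, Instr.exec, Op.eval, h4, hp'.2.1]
        · simp [execAll, Instr.exec, Op.eval, h0]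
        · simp [execAll, Instr.exec, Op.eval, h4, hp'.2.1]
        · exact hs _
        · simp [execAll, Instr.exec, Op.eval, h5]
        · simp [execAll, Instr.exec, Op.eval, h4]
        · rintro c' ⟨h1, h2, h3, h4, h5, h6⟩
          refine ⟨h1, ?_, h3, h4, h5, ?_⟩
          · simp [h2, execAll, Instr.exec, inits, h0]
          · intro a _ _ _ _ _ _
            simp [execAll, Instr.exec, *]
  have hu' := u.2
  refine Ex.mono (t₁ := 21 + ((40 * p.length + 1) + 5)) (Ex.seq (Ex.blk _ ?_ (Ex.seq (Ex.mono
    (key _ 0 (c.r 2) (c.A 10 i) ?_ ?_ ?_ ?_ ?_ ?_ ?_ ?_) le_rfl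
    (R' := fun c' => Ex W F N _ c' 5 _) ?_)))) (by omega) (fun c' h => h)
  · simp [OkAll, Instr.Ok, Instr.exec, h3]
    omega
  · exact hp
  · exact hsW
  · simp [execAll, Instr.exec, hu]
  · simp [execAll, Instr.exec]
  · simp [execAll, Instr.exec]
  · omega
  · simp [execAll, Instr.exec, h3, hl]
  · simp [execAll, Instr.exec, h3]
  · rintro c' ⟨h1, h2, h3', h4, h5, h6⟩
    refine Ex.blk _ (by simp [OkAll, Instr.Ok]) ⟨?_, h3', h4, ?_, ?_⟩
    · simp [execAll, Instr.exec, h2, h1, verts_eq]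
    · simp [execAll, Instr.exec, h5, h3]
    · intro a _ _ _ _ _ _
      simp [execAll, Instr.exec, *]

end Pointers

/-! ### A priority queue: the winner tree -/

section Queue

/-- The better one of two entries of the winner tree: an entry is `0` (nobody) or `v + 1`, for a
vertex `v` with the key `key v`. -/
noncomputable def pick (key : ℕ → ℝ≥0) (a b : ℕ) : ℕ :=
  if a = 0 then b else if b = 0 then a else if key (b - 1) < key (a - 1) then b else a

/-- A winner tree for the vertices `v < n` with `st v = 1`: the leaf of `v` is the node `n + v`, the
children of a node `k < n` are `2 * k` and `2 * k + 1`, and `T k` is the better one of the entries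
of the children. The root is the node `1`, and `n` need not be a power of two. -/
structure WinnerTree (n : ℕ) (T st : ℕ → ℕ) (key : ℕ → ℝ≥0) : Prop where
  leaf : ∀ v < n, T (n + v) = if st v = 1 then v + 1 else 0
  node : ∀ k, 1 ≤ k → k < n → T k = pick key (T (2 * k)) (T (2 * k + 1))
  zero : T 0 = 0
  rest : ∀ k, 2 * n ≤ k → T k = 0

variable {n : ℕ} {T st : ℕ → ℕ} {key : ℕ → ℝ≥0}

lemma pick_eq_or (a b : ℕ) : pick key a b = a ∨ pick key a b = b := by
  unfold pick
  split_ifs <;> simp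

/-- The entry of a node comes from a leaf below it; `(n + v) / 2 ^ s` are the ancestors of the leaf
of `v`. -/
lemma WinnerTree.exists_leaf (h : WinnerTree n T st key) (k : ℕ) (hk : T k ≠ 0) :
    ∃ s v, T k = v + 1 ∧ v < n ∧ st v = 1 ∧ (n + v) / 2 ^ s = k := by
  induction hd : 2 * n - k using Nat.strong_induction_on generalizing k with
  | _ d ih =>
    have h2n : k < 2 * n := by
      by_contra h'
      exact hk (h.rest k (not_lt.1 h'))
    have hk0 : k ≠ 0 := fun h' => hk (h' ▸ h.zero)
    by_cases hkn : k < n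
    · have hnode := h.node k (by omega) hkn
      have : ∃ i, (i = 2 * k ∨ i = 2 * k + 1) ∧ T k = T i := by
        rcases pick_eq_or (key := key) (T (2 * k)) (T (2 * k + 1)) with e | e
        · exact ⟨_, .inl rfl, hnode.trans e⟩
        · exact ⟨_, .inr rfl, hnode.trans e⟩
      obtain ⟨i, hi, e⟩ := this
      obtain ⟨s, v, h1, h2, h3, h4⟩ := ih (2 * n - i) (by omega) i (e ▸ hk) rfl
      refine ⟨s + 1, v, e ▸ h1, h2, h3, ?_⟩
      rw [pow_succ, ← Nat.div_div_eq_div_mul, h4]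
      omega
    · have hl := h.leaf (k - n) (by omega)
      rw [show n + (k - n) = k by omega] at hl
      split_ifs at hl with hst
      · exact ⟨0, k - n, hl, by omega, hst, by simp; omega⟩
      · exact absurd hl hk

/-- The entry of a node is at least as good as those of the leaves below it. -/
lemma WinnerTree.le_key (h : WinnerTree n T st key) {v : ℕ} (hv : v < n) (hst : st v = 1) (s : ℕ)
    (hs : 1 ≤ (n + v) / 2 ^ s) :
    T ((n + v) / 2 ^ s) ≠ 0 ∧ key (T ((n + v) / 2 ^ s) - 1) ≤ key v := by
  induction s with
  | zero => simp [h.leaf v hv, hst]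
  | succ s ih =>
    have hd : (n + v) / 2 ^ (s + 1) = (n + v) / 2 ^ s / 2 := by
      rw [pow_succ, Nat.div_div_eq_div_mul]
    rw [hd] at hs ⊢
    have hle : (n + v) / 2 ^ s ≤ n + v := Nat.div_le_self _ _
    obtain ⟨h1, h2⟩ := ih (by omega)
    set i := (n + v) / 2 ^ s with hi
    rw [h.node (i / 2) hs (by omega)]
    have hi2 : i = 2 * (i / 2) ∨ i = 2 * (i / 2) + 1 := by omega
    rcases hi2 with e | e <;> rw [e] at h1 h2 <;> generalize i / 2 = k at * <;> unfold pick <;>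
      split_ifs with h3 h4 <;> simp_all
    all_goals first | exact le_trans (le_of_lt ‹_›) h2 | exact le_trans ‹_› h2

lemma WinnerTree.eq_zero (h : WinnerTree n T st key) (hst : ∀ v < n, st v ≠ 1) :
    T = fun _ => 0 := by
  funext k
  by_contra hk
  obtain ⟨s, v, -, h2, h3, -⟩ := h.exists_leaf k hk
  exact hst v h2 h3

/-- The root holds a queued vertex with the smallest key. -/
lemma WinnerTree.root (h : WinnerTree n T st key) (hn : 0 < n) (hT : T 1 ≠ 0) :
    ∃ v < n, T 1 = v + 1 ∧ st v = 1 ∧ ∀ w < n, st w = 1 → key v ≤ key w := by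
  obtain ⟨s, v, h1, h2, h3, -⟩ := h.exists_leaf 1 hT
  refine ⟨v, h2, h1, h3, fun w hw hst => ?_⟩
  have hlog : (n + w) / 2 ^ Nat.log 2 (n + w) = 1 := by
    have a := Nat.pow_log_le_self 2 (x := n + w) (by omega)
    have b := Nat.lt_pow_succ_log_self (b := 2) (by norm_num) (n + w)
    apply Nat.div_eq_of_lt_le
    · omega
    · rw [pow_succ] at b; omega
  have := (h.le_key hw hst (Nat.log 2 (n + w)) hlog.ge).2
  rwa [hlog, h1, Nat.add_sub_cancel] at this

lemma WinnerTree.root_eq_zero (h : WinnerTree n T st key) (hT : T 1 = 0) :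
    ∀ w < n, st w ≠ 1 := by
  intro w hw hst
  have hlog : (n + w) / 2 ^ Nat.log 2 (n + w) = 1 := by
    have a := Nat.pow_log_le_self 2 (x := n + w) (by omega)
    have b := Nat.lt_pow_succ_log_self (b := 2) (by norm_num) (n + w)
    apply Nat.div_eq_of_lt_le
    · omega
    · rw [pow_succ] at b; omega
  have := (h.le_key hw hst (Nat.log 2 (n + w)) hlog.ge).1
  rw [hlog] at this
  exact this hT

/-- Recompute the entries of the proper ancestors of the node in register `10`; register `11`
contains `1`, the array `4` contains the tree and the weight array `6` the keys. -/
def fixTree : Prog :=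
  .loop (lt 11 10) (.seq (blk [.opi .div 10 10 2, .opi .mul 12 10 2, .ld 13 4 12, .opi .add 12 12 1,
    .ld 14 4 12]) (.seq (.cond (pos 13) (.cond (pos 14) (.seq (blk [.opi .sub 12 14 1, .wld 5 6 12,
      .opi .sub 12 13 1, .wld 6 6 12]) (.cond (.wlt 5 6) (blk [.opi .add 13 14 0]) .skip)) .skip)
      (blk [.opi .add 13 14 0])) (blk [.st 4 10 13])))

variable {W F N : ℕ}

/-- If the tree condition may fail only at the proper ancestors of the node `i`, then it is
restored. -/
lemma fixTree_loop (hF : 6 < F) (hN : 2 * n ≤ N) (hNW : 2 * N < W) (i : ℕ) (c : Cfg)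
    (hi : c.r 10 = i)
    (h1 : 1 ≤ i) (h2 : i < 2 * n) (h11 : c.r 11 = 1) (hT : ∀ k, c.A 4 k ≤ n)
    (hnode : ∀ k, 1 ≤ k → k < n → (∀ s, 1 ≤ s → i / 2 ^ s ≠ k) →
      c.A 4 k = pick (c.B 6) (c.A 4 (2 * k)) (c.A 4 (2 * k + 1))) :
    Ex W F N fixTree c (70 * Nat.log 2 i + 1) fun c' =>
      (∀ k, 1 ≤ k → k < n → c'.A 4 k = pick (c.B 6) (c'.A 4 (2 * k)) (c'.A 4 (2 * k + 1))) ∧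
      (∀ k, k = 0 ∨ n ≤ k → c'.A 4 k = c.A 4 k) ∧ (∀ g, g ≠ 4 → c'.A g = c.A g) ∧ c'.B = c.B ∧
      c'.out = c.out ∧ (∀ a, a ≠ 10 → a ≠ 12 → a ≠ 13 → a ≠ 14 → c'.r a = c.r a) ∧
      ∀ a, a ≠ 5 → a ≠ 6 → c'.w a = c.w a := by
  induction i using Nat.strong_induction_on generalizing c with
  | _ i ih =>
    by_cases hi1 : i = 1
    · subst hi1
      refine Ex.mono (Ex.loop_stop (by simp) (by simp [hi, h11]) ?_) (by omega) (fun c' h => h)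
      refine ⟨fun k hk hkn => hnode k hk hkn fun s hs => ?_, by simp, by simp, rfl, rfl, by simp,
        by simp⟩
      have : 1 / 2 ^ s = 0 := Nat.div_eq_of_lt (Nat.one_lt_two_pow (by omega))
      omega
    · set k := i / 2 with hk
      have hlog : Nat.log 2 i = Nat.log 2 k + 1 := by
        rw [hk, Nat.log_div_base, Nat.sub_add_cancel]
        exact Nat.log_pos (by norm_num) (by omega)
      have hb : c.A 4 (2 * k) ≤ n := hT _
      have hb' : c.A 4 (2 * k + 1) ≤ n := hT _
      have hi2 : k * 2 = 2 * k := by ring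
      -- the effect of one iteration
      have main : ∀ c', (c'.A = Function.update c.A 4 (Function.update (c.A 4) k
          (pick (c.B 6) (c.A 4 (2 * k)) (c.A 4 (2 * k + 1)))) ∧ c'.B = c.B ∧ c'.out = c.out ∧
          c'.r 10 = k ∧ (∀ a, a ≠ 10 → a ≠ 12 → a ≠ 13 → a ≠ 14 → c'.r a = c.r a) ∧
          ∀ a, a ≠ 5 → a ≠ 6 → c'.w a = c.w a) →
          Ex W F N fixTree c' (70 * Nat.log 2 k + 1) fun c' =>
            (∀ k, 1 ≤ k → k < n → c'.A 4 k = pick (c.B 6) (c'.A 4 (2 * k)) (c'.A 4 (2 * k + 1))) ∧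
            (∀ k, k = 0 ∨ n ≤ k → c'.A 4 k = c.A 4 k) ∧ (∀ g, g ≠ 4 → c'.A g = c.A g) ∧
            c'.B = c.B ∧ c'.out = c.out ∧
            (∀ a, a ≠ 10 → a ≠ 12 → a ≠ 13 → a ≠ 14 → c'.r a = c.r a) ∧
            ∀ a, a ≠ 5 → a ≠ 6 → c'.w a = c.w a := by
        rintro ⟨r, w, A, B, out⟩ ⟨rfl, rfl, rfl, hr, hr', hw'⟩
        refine Ex.mono (ih k (by omega) _ hr (by omega) (by omega) ?_ ?_ ?_) le_rfl ?_
        · exact (hr' 11 (by simp) (by simp) (by simp) (by simp)).trans h11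
        · intro x
          simp only [Function.update_self]
          rcases eq_or_ne x k with rfl | hx
          · rw [Function.update_self]
            rcases pick_eq_or (key := c.B 6) (c.A 4 (2 * k)) (c.A 4 (2 * k + 1)) with e | e <;>
              rw [e] <;> assumption
          · rw [Function.update_of_ne hx]
            exact hT x
        · intro x hx1 hxn hx
          simp only [Function.update_self]
          have hc1 : 2 * x ≠ k := fun e => hx 1 le_rfl (by omega)
          have hc2 : 2 * x + 1 ≠ k := fun e => hx 1 le_rfl (by omega)
          rw [Function.update_of_ne hc1, Function.update_of_ne hc2]
          rcases eq_or_ne x k with rfl | hxk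
          · rw [Function.update_self]
          · rw [Function.update_of_ne hxk]
            refine hnode x hx1 hxn fun s hs => ?_
            obtain ⟨s, rfl⟩ := Nat.exists_eq_add_of_le' hs
            rw [pow_succ', ← Nat.div_div_eq_div_mul, ← hk]
            rcases s with _ | s
            · simpa using hxk.symm
            · exact hx _ (by omega)
        · rintro c' ⟨a1, a2, a3, a4, a5, a6, a7⟩
          refine ⟨a1, fun x hx => ?_, fun g hg => ?_, a4, a5, fun a _ _ _ _ => ?_, fun a _ _ => ?_⟩
          · rw [a2 x hx]
            simp only [Function.update_self]
            rw [Function.update_of_ne (by omega)]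
          · rw [a3 g hg]
            simp [hg]
          · rw [a6 a ‹_› ‹_› ‹_› ‹_›]
            exact hr' a ‹_› ‹_› ‹_› ‹_›
          · rw [a7 a ‹_› ‹_›]
            exact hw' a ‹_› ‹_›
      refine Ex.mono (t₁ := (21 + ((17 + (5 + 1) + 1 + 1) + 5)) + (70 * Nat.log 2 k + 1) + 1)
        (Ex.loop_step (by simp) (by simp [hi, h11]; omega) (Ex.seq (Ex.blk _ ?_ (Ex.seq
          (Ex.cond (by simp)
            (fun ht => Ex.cond (by simp)
              (fun ht' => Ex.seq (Ex.blk _ ?_ (Ex.cond (by simp)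
                (fun ht'' => Ex.blk _ ?_ (Ex.blk _ ?_ (main _ ?_)))
                (fun ht'' => Ex.mono (Ex.skip (Ex.blk _ ?_ (main _ ?_))) (by omega)
                  (fun _ h => h)))))
              (fun ht' => Ex.mono (Ex.skip (Ex.blk _ ?_ (main _ ?_))) (by omega) (fun _ h => h)))
            (fun ht => Ex.mono (Ex.blk _ ?_ (Ex.blk _ ?_ (main _ ?_))) (by simp)
              (fun _ h => h)))))))
        (by rw [hlog]; omega) (fun c' h => h)
      · simp [OkAll, Instr.Ok, Instr.exec, Op.eval, hi, ← hk, hi2]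
        omega
      · simp [execAll, Instr.exec, Op.eval, hi, ← hk, hi2] at ht ht'
        simp [OkAll, Instr.Ok, execAll, Instr.exec, Op.eval, hi, ← hk, hi2]
        omega
      · simp [execAll, Instr.exec, Op.eval, hi, ← hk, hi2] at ht ht' ht''
        simp [OkAll, Instr.Ok, execAll, Instr.exec, Op.eval, hi, ← hk, hi2]
        omega
      · simp [OkAll, Instr.Ok, execAll, Instr.exec, Op.eval, hi, ← hk, hi2]
        omega
      · simp [execAll, Instr.exec, Op.eval, hi, ← hk, hi2] at ht ht' ht''
        refine ⟨?_, ?_, ?_, ?_, ?_, ?_⟩ <;>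
          simp +contextual [execAll, Instr.exec, Op.eval, hi, ← hk, hi2, pick, ht.ne', ht'.ne',
            ht'']
      · simp [OkAll, Instr.Ok, execAll, Instr.exec, Op.eval, hi, ← hk, hi2]
        omega
      · simp [execAll, Instr.exec, Op.eval, hi, ← hk, hi2] at ht ht' ht''
        refine ⟨?_, ?_, ?_, ?_, ?_, ?_⟩ <;>
          simp +contextual [execAll, Instr.exec, Op.eval, hi, ← hk, hi2, pick, ht.ne', ht'.ne',
            ht''.not_gt]
      · simp [OkAll, Instr.Ok, execAll, Instr.exec, Op.eval, hi, ← hk, hi2]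
        omega
      · simp [execAll, Instr.exec, Op.eval, hi, ← hk, hi2] at ht ht'
        refine ⟨?_, ?_, ?_, ?_, ?_, ?_⟩ <;>
          simp +contextual [execAll, Instr.exec, Op.eval, hi, ← hk, hi2, pick, ht.ne', ht']
      · simp [OkAll, Instr.Ok, execAll, Instr.exec, Op.eval, hi, ← hk, hi2]
        omega
      · simp [OkAll, Instr.Ok, execAll, Instr.exec, Op.eval, hi, ← hk, hi2]
        omega
      · simp [execAll, Instr.exec, Op.eval, hi, ← hk, hi2] at ht
        refine ⟨?_, ?_, ?_, ?_, ?_, ?_⟩ <;>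
          simp +contextual [execAll, Instr.exec, Op.eval, hi, ← hk, hi2, pick, ht]

/-- The tree is repaired after a change of the state or of the key of the vertex `v`. -/
lemma fixTree_spec {T₀ st₀ : ℕ → ℕ} {key₀ : ℕ → ℝ≥0} (h : WinnerTree n T₀ st₀ key₀) {v : ℕ}
    {c : Cfg} (hv : v < n) (hF : 6 < F) (hN : 2 * n ≤ N) (hNW : 2 * N < W)
    (hT : c.A 4 = Function.update T₀ (n + v) (if c.A 5 v = 1 then v + 1 else 0))
    (hst : ∀ x, x ≠ v → c.A 5 x = st₀ x) (hkey : ∀ x, x ≠ v → c.B 6 x = key₀ x)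
    (h10 : c.r 10 = n + v) (h11 : c.r 11 = 1) :
    Ex W F N fixTree c (70 * Nat.log 2 (2 * n) + 1) fun c' =>
      WinnerTree n (c'.A 4) (c.A 5) (c.B 6) ∧ (∀ g, g ≠ 4 → c'.A g = c.A g) ∧ c'.B = c.B ∧
      c'.out = c.out ∧ (∀ a, a ≠ 10 → a ≠ 12 → a ≠ 13 → a ≠ 14 → c'.r a = c.r a) ∧
      ∀ a, a ≠ 5 → a ≠ 6 → c'.w a = c.w a := by
  have hle : ∀ k, c.A 4 k ≤ n := by
    intro k
    rw [hT]
    rcases eq_or_ne k (n + v) with rfl | hk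
    · rw [Function.update_self]
      split_ifs <;> omega
    · rw [Function.update_of_ne hk]
      by_cases h0 : T₀ k = 0
      · omega
      · obtain ⟨s, w, h1, h2, -, -⟩ := h.exists_leaf k h0
        omega
  have hlog : Nat.log 2 (n + v) ≤ Nat.log 2 (2 * n) := Nat.log_mono_right (by omega)
  refine Ex.mono (fixTree_loop (n := n) hF hN hNW (n + v) c h10 (by omega) (by omega) h11 hle ?_)
    (by omega) ?_
  · intro k hk1 hkn hk
    have e1 : ∀ s, (n + v) / 2 ^ s ≠ 2 * k := by
      intro s e
      apply hk (s + 1) (by omega)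
      rw [pow_succ, ← Nat.div_div_eq_div_mul, e]
      omega
    have e2 : ∀ s, (n + v) / 2 ^ s ≠ 2 * k + 1 := by
      intro s e
      apply hk (s + 1) (by omega)
      rw [pow_succ, ← Nat.div_div_eq_div_mul, e]
      omega
    have key_eq : ∀ i, (∀ s, (n + v) / 2 ^ s ≠ i) → T₀ i ≠ 0 →
        c.B 6 (T₀ i - 1) = key₀ (T₀ i - 1) := by
      intro i hi h0
      obtain ⟨s, w, h1, h2, -, h4⟩ := h.exists_leaf i h0
      rw [h1, Nat.add_sub_cancel]
      apply hkey
      rintro rfl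
      exact hi s h4
    rw [hT, Function.update_of_ne (by omega), Function.update_of_ne (by simpa using (e1 0).symm),
      Function.update_of_ne (by simpa using (e2 0).symm), h.node k hk1 hkn]
    unfold pick
    split_ifs with a1 a2 a3 a4 a4
    · rfl
    · rfl
    · rfl
    · rw [key_eq _ e1 a1, key_eq _ e2 a2] at a4
      exact absurd a3 a4
    · rw [key_eq _ e1 a1, key_eq _ e2 a2] at a4
      exact absurd a4 a3
    · rfl
  · rintro c' ⟨a1, a2, a3, a4, a5, a6, a7⟩
    refine ⟨⟨fun x hx => ?_, a1, ?_, fun k hk => ?_⟩, a3, a4, a5, a6, a7⟩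
    · rw [a2 _ (by omega), hT]
      rcases eq_or_ne x v with rfl | hxv
      · simp
      · rw [Function.update_of_ne (by omega), h.leaf x hx, hst x hxv]
    · rw [a2 _ (by omega), hT, Function.update_of_ne (by omega), h.zero]
    · rw [a2 _ (by omega), hT, Function.update_of_ne (by omega), h.rest k hk]

end Queue

/-! ### Local shortest paths: the invariant of the search -/

section Search

variable {n : ℕ} {H : SimpleGraph (Fin n)} {wt : Sym2 (Fin n) → ℝ≥0}

@[simp] lemma len_nil {u : Fin n} : len wt (.nil : H.Walk u u) = 0 := by simp [len]

@[simp] lemma len_cons {u v w : Fin n} (h : H.Adj u v) (p : H.Walk v w) :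
    len wt (.cons h p) = wt s(u, v) + len wt p := by simp [len]

@[simp] lemma len_append {u v w : Fin n} (p : H.Walk u v) (q : H.Walk v w) :
    len wt (p.append q) = len wt p + len wt q := by simp [len, SimpleGraph.Walk.edges_append]

@[simp] lemma len_reverse {u v : Fin n} (p : H.Walk u v) : len wt p.reverse = len wt p := by
  simp [len, SimpleGraph.Walk.edges_reverse, List.sum_reverse]

lemma dist_le_len {u v : Fin n} (p : H.Walk u v) : dist wt H u v ≤ len wt p := iInf_le _ p

lemma dist_lt_iff {u v : Fin n} {r : ℝ≥0∞} :
    dist wt H u v < r ↔ ∃ p : H.Walk u v, (len wt p : ℝ≥0∞) < r := iInf_lt_iff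

lemma follows_congr {f g : ℕ → ℕ} {u v : Fin n} (p : H.Walk u v)
    (hfg : ∀ x ∈ p.support, f x = g x) (hp : Follows f p) : Follows g p := by
  induction p with
  | nil => exact (hfg _ (by simp)).symm.trans hp
  | cons h p ih =>
    refine ⟨?_, ih (fun x hx => hfg x (by simp [hx])) hp.2⟩
    rw [← hfg _ (by simp)]
    exact hp.1

/-- The invariant of Dijkstra's algorithm from `s`, restricted to the vertices at distance less
than `r`. The vertices of the list `ord` are settled (`st v = 2`), and those with `st v = 1` are
queued; `d` are the tentative distances and `par` the pointers to the predecessors. The edges from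
the settled vertices have been relaxed, except those from `x` to the vertices in `rem`. -/
structure Search (wt : Sym2 (Fin n) → ℝ≥0) (H : SimpleGraph (Fin n)) (s : Fin n) (r : ℝ≥0∞)
    (ord : List (Fin n)) (x : Fin n) (rem : List (Fin n)) (par st : ℕ → ℕ) (d : ℕ → ℝ≥0) :
    Prop where
  settled : ∀ v : Fin n, st v = 2 ↔ v ∈ ord
  nodup : ord.Nodup
  vals : ∀ v, st v ≤ 2
  zero : ∀ v, st v = 0 → par v = 0 ∧ d v = 0
  range : ∀ v, n ≤ v → st v = 0
  path : ∀ v ∈ ord, ∃ p : H.Walk v s, Follows par p ∧ p.IsPath ∧ len wt p = d v ∧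
    ∀ y ∈ p.support, y ∈ ord
  queued : ∀ v : Fin n, st v = 1 → (v = s ∧ d v = 0 ∧ par v = 0) ∨
    ∃ y ∈ ord, H.Adj v y ∧ par v = y + 1 ∧ d v = wt s(v, y) + d y
  rad : ∀ v : Fin n, st v ≠ 0 → (d v : ℝ≥0∞) < r
  src : st s ≠ 0
  mono : ∀ v w : Fin n, st v = 2 → st w = 1 → d v ≤ d w
  relaxed : ∀ z ∈ ord, ∀ y, H.Adj z y → (z = x ∧ y ∈ rem) ∨
    (((d z + wt s(z, y) : ℝ≥0) : ℝ≥0∞) < r → st y ≠ 0 ∧ d y ≤ d z + wt s(z, y))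

variable {s x y : Fin n} {r : ℝ≥0∞} {ord rem : List (Fin n)} {par st : ℕ → ℕ} {d : ℕ → ℝ≥0}

lemma Search.init (hr : 0 < r) : Search wt H s r [] x rem (fun _ => 0)
    (Function.update (fun _ => 0) (s : ℕ) 1) (fun _ => 0) where
  settled v := by
    rcases eq_or_ne (v : ℕ) s with h | h <;> simp [h]
  nodup := by simp
  vals v := by rw [Function.update_apply]; split_ifs <;> simp
  zero := by simp
  range v hv := by
    rw [Function.update_of_ne (by have := s.2; omega)]
  path := by simp
  queued v hv := by
    by_contra h
    have : (v : ℕ) ≠ s := fun h' => h (.inl ⟨Fin.ext h', rfl, rfl⟩)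
    simp [this] at hv
  rad _ _ := by simpa using hr
  src := by simp
  mono v w hv := by
    rcases eq_or_ne (v : ℕ) s with h | h <;> simp [h] at hv
  relaxed := by simp

/-- A queued vertex with the smallest tentative distance becomes settled. Settled distances
increase, so it is at least as far as all settled vertices. -/
lemma Search.pop (h : Search wt H s r ord y [] par st d) (hx : st x = 1)
    (hmin : ∀ w : Fin n, st w = 1 → d x ≤ d w) (hrem : ∀ z, H.Adj x z → z ∈ rem) :
    Search wt H s r (ord ++ [x]) x rem par (Function.update st x 2) d ∧
      ∀ z ∈ ord ++ [x], d z ≤ d x := by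
  have hxo : x ∉ ord := fun hxo => by
    have := (h.settled x).2 hxo
    omega
  have hval : ∀ v : Fin n, v ≠ x → Function.update st (x : ℕ) 2 v = st v := fun v hv => by
    rw [Function.update_of_ne (fun e => hv (Fin.ext e))]
  refine ⟨⟨?_, ?_, ?_, ?_, ?_, ?_, ?_, ?_, ?_, ?_, ?_⟩, ?_⟩
  · intro v
    rcases eq_or_ne v x with rfl | hv
    · simp
    · simp [hval v hv, h.settled, hv]
  · simp [List.nodup_append, h.nodup]
    rintro a ha rfl
    exact hxo ha
  · intro v
    rw [Function.update_apply]
    split_ifs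
    · rfl
    · exact h.vals v
  · intro v hv
    rcases eq_or_ne v x with rfl | hvx
    · simp at hv
    · rw [Function.update_of_ne hvx] at hv
      exact h.zero v hv
  · intro v hv
    rw [Function.update_of_ne (by have := x.2; omega)]
    exact h.range v hv
  · intro v hv
    rw [List.mem_append, List.mem_singleton] at hv
    rcases hv with hv | rfl
    · obtain ⟨p, h1, h2, h3, h4⟩ := h.path v hv
      exact ⟨p, h1, h2, h3, fun z hz => List.mem_append_left _ (h4 z hz)⟩
    · rcases h.queued v hx with ⟨rfl, h1, h2⟩ | ⟨z, hz, hadj, h1, h2⟩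
      · exact ⟨.nil, h2, by simp, by simp [h1], by simp⟩
      · obtain ⟨p, h1', h2', h3', h4'⟩ := h.path z hz
        refine ⟨.cons hadj p, ⟨h1, h1'⟩, ?_, ?_, ?_⟩
        · exact h2'.cons fun hv => hxo (h4' _ hv)
        · simp [h3', h2]
        · intro y hy
          rw [SimpleGraph.Walk.support_cons, List.mem_cons] at hy
          rcases hy with rfl | hy
          · simp
          · simp [h4' y hy]
  · intro v hv
    rcases eq_or_ne v x with rfl | hvx
    · simp at hv
    · rw [hval v hvx] at hv
      rcases h.queued v hv with h' | ⟨z, hz, h'⟩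
      · exact .inl h'
      · exact .inr ⟨z, List.mem_append_left _ hz, h'⟩
  · intro v hv
    rcases eq_or_ne v x with rfl | hvx
    · exact h.rad v (by omega)
    · exact h.rad v (by rwa [hval v hvx] at hv)
  · rcases eq_or_ne s x with rfl | hvx
    · simp
    · rw [hval s hvx]
      exact h.src
  · intro v w hv hw
    rcases eq_or_ne w x with rfl | hwx
    · simp at hw
    · rw [hval w hwx] at hw
      rcases eq_or_ne v x with rfl | hvx
      · exact hmin w hw
      · rw [hval v hvx] at hv
        exact h.mono v w hv hw
  · intro z hz y' hadj
    rw [List.mem_append, List.mem_singleton] at hz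
    rcases hz with hz | rfl
    · right
      intro hlt
      rcases h.relaxed z hz y' hadj with ⟨-, h'⟩ | h'
      · simp at h'
      · refine ⟨?_, (h' hlt).2⟩
        rcases eq_or_ne y' x with rfl | hyx
        · simp
        · rw [hval y' hyx]
          exact (h' hlt).1
    · exact .inl ⟨rfl, hrem y' hadj⟩
  · intro z hz
    rw [List.mem_append, List.mem_singleton] at hz
    rcases hz with hz | rfl
    · exact h.mono z x ((h.settled z).2 hz) hx
    · rfl

/-- An edge that does not improve the tentative distance. -/
lemma Search.skip (h : Search wt H s r ord x (y :: rem) par st d)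
    (hs : ((d x + wt s(x, y) : ℝ≥0) : ℝ≥0∞) < r → st y ≠ 0 ∧ d y ≤ d x + wt s(x, y)) :
    Search wt H s r ord x rem par st d :=
  { h with
    relaxed := fun z hz y' hadj => by
      rcases h.relaxed z hz y' hadj with ⟨rfl, h'⟩ | h'
      · rcases List.mem_cons.1 h' with rfl | h'
        · exact .inr hs
        · exact .inl ⟨rfl, h'⟩
      · exact .inr h' }

/-- An edge that improves the tentative distance. -/
lemma Search.update (h : Search wt H s r ord x (y :: rem) par st d) (hxo : x ∈ ord)
    (hmax : ∀ z ∈ ord, d z ≤ d x) (hadj : H.Adj x y)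
    (hr : ((d x + wt s(x, y) : ℝ≥0) : ℝ≥0∞) < r) (hy : st y = 0 ∨ d x + wt s(x, y) < d y) :
    y ∉ ord ∧ Search wt H s r ord x rem (Function.update par y (x + 1)) (Function.update st y 1)
      (Function.update d y (d x + wt s(x, y))) := by
  have hyo : y ∉ ord := by
    intro hyo
    have h2 := (h.settled y).2 hyo
    rcases hy with hy | hy
    · omega
    · exact absurd (hmax y hyo) (not_le.2 (lt_of_le_of_lt le_self_add hy))
  have ho : ∀ v ∈ ord, (v : ℕ) ≠ y := fun v hv e => hyo (Fin.ext e ▸ hv)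
  have hne : ∀ v : Fin n, v ≠ y → (v : ℕ) ≠ y := fun v hv e => hv (Fin.ext e)
  refine ⟨hyo, ⟨?_, h.nodup, ?_, ?_, ?_, ?_, ?_, ?_, ?_, ?_, ?_⟩⟩
  · intro v
    rcases eq_or_ne v y with rfl | hv
    · simp [hyo]
    · rw [Function.update_of_ne (hne v hv), h.settled]
  · intro v
    rw [Function.update_apply]
    split_ifs
    · omega
    · exact h.vals v
  · intro v hv
    rcases eq_or_ne v y with rfl | hvy
    · simp at hv
    · rw [Function.update_of_ne hvy] at hv ⊢
      rw [Function.update_of_ne hvy]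
      exact h.zero v hv
  · intro v hv
    rw [Function.update_of_ne (by have := y.2; omega)]
    exact h.range v hv
  · intro v hv
    obtain ⟨p, h1, h2, h3, h4⟩ := h.path v hv
    refine ⟨p, follows_congr p (fun z hz => ?_) h1, h2, ?_, h4⟩
    · rw [Function.update_of_ne (ho z (h4 z hz))]
    · rw [h3, Function.update_of_ne (ho v hv)]
  · intro v hv
    rcases eq_or_ne v y with rfl | hvy
    · refine .inr ⟨x, hxo, hadj.symm, by simp, ?_⟩
      rw [Function.update_self, Function.update_of_ne (ho x hxo), Sym2.eq_swap, add_comm]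
    · rw [Function.update_of_ne (hne v hvy)] at hv ⊢
      rw [Function.update_of_ne (hne v hvy)]
      rcases h.queued v hv with h' | ⟨z, hz, h1, h2, h3⟩
      · exact .inl h'
      · exact .inr ⟨z, hz, h1, h2, by rw [Function.update_of_ne (ho z hz), h3]⟩
  · intro v hv
    rcases eq_or_ne v y with rfl | hvy
    · simpa using hr
    · rw [Function.update_of_ne (hne v hvy)] at hv ⊢
      exact h.rad v hv
  · rcases eq_or_ne s y with rfl | hvy
    · simp
    · rw [Function.update_of_ne (hne s hvy)]
      exact h.src
  · intro v w hv hw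
    rcases eq_or_ne v y with rfl | hvy
    · simp at hv
    · rw [Function.update_of_ne (hne v hvy)] at hv ⊢
      rcases eq_or_ne w y with rfl | hwy
      · rw [Function.update_self]
        exact (hmax v ((h.settled v).1 hv)).trans le_self_add
      · rw [Function.update_of_ne (hne w hwy)] at hw ⊢
        exact h.mono v w hv hw
  · intro z hz y' hadj'
    rw [Function.update_of_ne (ho z hz)]
    rcases eq_or_ne y' y with rfl | hyy
    · simp only [Function.update_self]
      rcases h.relaxed z hz y' hadj' with ⟨rfl, h'⟩ | h'
      · exact .inr fun _ => ⟨by simp, le_rfl⟩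
      · refine .inr fun hlt => ⟨by simp, ?_⟩
        rcases hy with hy | hy
        · exact absurd hy (h' hlt).1
        · exact hy.le.trans (h' hlt).2
    · rw [Function.update_of_ne (hne y' hyy), Function.update_of_ne (hne y' hyy)]
      rcases h.relaxed z hz y' hadj' with ⟨rfl, h'⟩ | h'
      · rcases List.mem_cons.1 h' with rfl | h'
        · exact absurd rfl hyy
        · exact .inl ⟨rfl, h'⟩
      · exact .inr h'

/-- When the queue is empty, all short enough walks have been taken into account. -/
lemma Search.complete (h : Search wt H s r ord x [] par st d) (hq : ∀ v : Fin n, st v ≠ 1)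
    {u v : Fin n} (p : H.Walk u v) (hu : u ∈ ord) (hp : ((d u + len wt p : ℝ≥0) : ℝ≥0∞) < r) :
    v ∈ ord ∧ d v ≤ d u + len wt p := by
  induction p with
  | nil => simpa using hu
  | @cons u w v hadj p ih =>
    rw [len_cons, ← add_assoc] at hp ⊢
    rcases h.relaxed u hu w hadj with ⟨-, h'⟩ | h'
    · simp at h'
    · obtain ⟨h1, h2⟩ := h' (lt_of_le_of_lt (by
        rw [ENNReal.coe_le_coe]
        exact le_self_add) hp)
      have hw : w ∈ ord := by
        have a := hq w
        have b := h.vals w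
        exact (h.settled w).1 (by omega)
      have hle : d w + len wt p ≤ d u + wt s(u, w) + len wt p := by gcongr
      obtain ⟨h3, h4⟩ := ih hw (lt_of_le_of_lt (ENNReal.coe_le_coe.2 hle) hp)
      exact ⟨h3, h4.trans hle⟩

/-- At the end of the search, the settled vertices are those at distance less than `r`, and the
pointers lead to `s` along shortest paths. -/
lemma Search.dist_eq (h : Search wt H s r ord x [] par st d) (hq : ∀ v : Fin n, st v ≠ 1) :
    (∀ v, v ∈ ord ↔ dist wt H v s < r) ∧ ∀ v ∈ ord, ∃ p : H.Walk v s, Follows par p ∧ p.IsPath ∧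
      len wt p = d v ∧ IsShortest wt p ∧ ∀ y ∈ p.support, y ∈ ord := by
  have hs : s ∈ ord := by
    have a := hq s
    have b := h.vals s
    have c := h.src
    exact (h.settled s).1 (by omega)
  have hds : d s = 0 := by
    obtain ⟨p, -, h2, h3, -⟩ := h.path s hs
    rw [(SimpleGraph.Walk.isPath_iff_nil.1 h2).eq_nil] at h3
    simpa using h3.symm
  have key : ∀ {v : Fin n} (q : H.Walk v s), (len wt q : ℝ≥0∞) < r → v ∈ ord ∧ d v ≤ len wt q := by
    intro v q hq'
    have := h.complete hq q.reverse hs (by simpa [hds] using hq')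
    simpa [hds] using this
  have rad : ∀ v ∈ ord, (d v : ℝ≥0∞) < r := fun v hv => h.rad v (by
    have := (h.settled v).2 hv
    omega)
  refine ⟨fun v => ⟨fun hv => ?_, fun hv => ?_⟩, fun v hv => ?_⟩
  · obtain ⟨p, h1, h2, h3, h4⟩ := h.path v hv
    exact (dist_le_len p).trans_lt (h3 ▸ rad v hv)
  · obtain ⟨q, hq'⟩ := dist_lt_iff.1 hv
    exact (key q hq').1
  · obtain ⟨p, h1, h2, h3, h4⟩ := h.path v hv
    refine ⟨p, h1, h2, h3, fun q => ?_, h4⟩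
    rw [h3]
    by_cases hq' : (len wt q : ℝ≥0∞) < r
    · exact (key q hq').2
    · exact ENNReal.coe_le_coe.1 ((rad v hv).le.trans (not_lt.1 hq'))

lemma Search.dist_lt (h : Search wt H s r ord x rem par st d) (v : Fin n) (hv : st v ≠ 0) :
    dist wt H v s < r := by
  have h2 := h.vals v
  have rad := h.rad v hv
  by_cases hv2 : st v = 2
  · obtain ⟨p, -, -, h3, -⟩ := h.path v ((h.settled v).1 hv2)
    exact (dist_le_len p).trans_lt (h3 ▸ rad)
  · rcases h.queued v (by omega) with ⟨rfl, h', -⟩ | ⟨z, hz, hadj, -, h'⟩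
    · refine (dist_le_len .nil).trans_lt ?_
      simpa [h'] using rad
    · obtain ⟨p, -, -, h3, -⟩ := h.path z hz
      refine (dist_le_len (.cons hadj p)).trans_lt ?_
      rwa [len_cons, h3, ← h']

end Search

/-! ### Local shortest paths: the program -/

section SearchProgram

/-- Give vertex `5` the tentative distance in weight register `3` and the predecessor `2`, and put
it into the queue. -/
def enqueue : Prog :=
  .seq (blk [.wst 6 5 3, .opi .add 13 2 1, .st 6 5 13, .set 14 1, .st 5 5 14, .op .add 10 5 16,
    .opi .add 13 5 1, .st 4 10 13]) fixTree

/-- Remove the root of the queue, whose entry is in register `2`, append it to the list of the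
settled vertices and prepare the search of its neighbours. -/
def settle : Prog :=
  .seq (.seq (blk [.opi .sub 2 2 1, .set 14 2, .st 5 2 14, .op .add 10 2 16, .set 13 0, .st 4 10 13,
    .st 7 9 2, .opi .add 9 9 1]) fixTree) (blk [.wld 1 6 2, .ld 3 2 2, .opi .add 12 2 1, .ld 4 2
      12])

/-- Relax the edge from vertex `2` with index `3`; the radius of the search is in weight register
`4` if register `15` is `0`, and infinite otherwise. -/
def relax : Prog :=
  .seq (blk [.ld 5 3 3, .wld 2 3 3, .wa 3 1 2, .ld 6 5 5, .wld 5 6 5])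
    (.cond (pos 15) (.cond (pos 6) (.cond (.wlt 3 5) enqueue .skip) enqueue)
      (.cond (.wlt 3 4) (.cond (pos 6) (.cond (.wlt 3 5) enqueue .skip) enqueue) .skip))

/-- Relax the edges from vertex `2` with the indices from register `3` to register `4`. -/
def relaxAll : Prog := .loop (lt 3 4) (.seq relax (blk [.opi .add 3 3 1]))

/-- Process the queue, whose root is in register `2`. -/
def searchLoop : Prog :=
  .loop (pos 2) (.seq settle (.seq relaxAll (blk [.set 12 1, .ld 2 4 12])))

/-- Dijkstra's algorithm from vertex `7`. -/
def search : Prog :=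
  .seq (.seq (blk [.set 11 1, .set 9 0, .set 14 1, .st 5 7 14, .op .add 10 7 16, .opi .add 13 7 1,
    .st 4 10 13]) fixTree) (.seq (blk [.set 12 1, .ld 2 4 12]) searchLoop)

/-- Erase the data of the search. -/
def eraseSearch : Prog :=
  .loop (pos 9) (blk [.opi .sub 9 9 1, .ld 2 7 9, .set 13 0, .wz 3, .st 5 2 13, .st 6 2 13,
    .wst 6 2 3, .st 7 9 13])

variable {n : ℕ} {H : SimpleGraph (Fin n)} {wt : Sym2 (Fin n) → ℝ≥0} {W F N : ℕ}

/-- What the search leaves unchanged. -/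
structure Keeps (c c' : Cfg) : Prop where
  arr : ∀ g, g ≠ 4 → g ≠ 5 → g ≠ 6 → g ≠ 7 → c'.A g = c.A g
  warr : ∀ g, g ≠ 6 → c'.B g = c.B g
  out : c'.out = c.out
  reg : ∀ a, (a = 0 ∨ a = 1 ∨ a = 7 ∨ a = 8 ∨ a = 11 ∨ 15 ≤ a) → c'.r a = c.r a
  wreg : ∀ a, (a = 0 ∨ a = 4) → c'.w a = c.w a

lemma Keeps.trans {c c' c'' : Cfg} (h : Keeps c c') (h' : Keeps c' c'') : Keeps c c'' where
  arr g a b d e := (h'.arr g a b d e).trans (h.arr g a b d e)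
  warr g a := (h'.warr g a).trans (h.warr g a)
  out := h'.out.trans h.out
  reg a ha := (h'.reg a ha).trans (h.reg a ha)
  wreg a ha := (h'.wreg a ha).trans (h.wreg a ha)

lemma Keeps.refl (c : Cfg) : Keeps c c := ⟨by simp, by simp, rfl, by simp, by simp⟩

/-- The assumptions on the dimensions of the machine. -/
structure Dims (n W F N : ℕ) : Prop where
  hn : 2 ≤ n
  hN : 2 * n + 2 ≤ N
  hW : 2 * N < W
  hF : 22 ≤ F

lemma enqueue_spec (hd : Dims n W F N) {c : Cfg} {x y : Fin n} (h5 : c.r 5 = y) (h2 : c.r 2 = x)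
    (h11 : c.r 11 = 1) (h16 : c.r 16 = n) (ht : WinnerTree n (c.A 4) (c.A 5) (c.B 6)) :
    Ex W F N enqueue c (70 * Nat.log 2 (2 * n) + 34) fun c' =>
      WinnerTree n (c'.A 4) (c'.A 5) (c'.B 6) ∧ c'.A 5 = Function.update (c.A 5) y 1 ∧
      c'.A 6 = Function.update (c.A 6) y (x + 1) ∧ c'.B 6 = Function.update (c.B 6) y (c.w 3) ∧
      c'.A 7 = c.A 7 ∧ Keeps c c' ∧
      (∀ a, a ≠ 10 → a ≠ 12 → a ≠ 13 → a ≠ 14 → c'.r a = c.r a) ∧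
      ∀ a, a ≠ 5 → a ≠ 6 → c'.w a = c.w a := by
  obtain ⟨hn, hN, hW, hF⟩ := hd
  have hx := x.2
  have hy := y.2
  refine Ex.mono (t₁ := 33 + (70 * Nat.log 2 (2 * n) + 1)) (Ex.seq (Ex.blk _ ?_
    (Ex.mono (fixTree_spec ht hy (by omega) (by omega) hW ?_ ?_ ?_ ?_ ?_) le_rfl ?_)))
    (by omega) (fun c' h => h)
  · simp [OkAll, Instr.Ok, Instr.exec, Op.eval, h5, h2, h16]
    omega
  · simp [execAll, Instr.exec, Op.eval, h5, h16, add_comm]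
  · intro x hx
    simp [execAll, Instr.exec, h5, hx]
  · intro x hx
    simp [execAll, Instr.exec, h5, hx]
  · simp [execAll, Instr.exec, Op.eval, h5, h16, add_comm]
  · simp [execAll, Instr.exec, h11]
  · rintro c' ⟨a1, a2, a3, a4, a5, a6⟩
    refine ⟨?_, ?_, ?_, ?_, ?_, ⟨?_, ?_, ?_, ?_, ?_⟩, ?_, ?_⟩
    · rw [a2 5 (by simp), a3]
      exact a1
    · simp [a2, execAll, Instr.exec, h5]
    · simp [a2, execAll, Instr.exec, Op.eval, h5, h2]
    · simp [a3, execAll, Instr.exec, h5]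
    · simp [a2, execAll, Instr.exec]
    · intro g _ _ _ _
      simp [execAll, Instr.exec, *]
    · intro g _
      simp [execAll, Instr.exec, *]
    · simp [a4, execAll, Instr.exec]
    · intro a ha
      rw [a5 a (by omega) (by omega) (by omega) (by omega)]
      simp [execAll, Instr.exec, show a ≠ 10 by omega, show a ≠ 13 by omega, show a ≠ 14 by omega]
    · intro a ha
      rw [a6 a (by omega) (by omega)]
      simp [execAll, Instr.exec]
    · intro a _ _ _ _
      simp [execAll, Instr.exec, *]
    · intro a _ _
      simp [execAll, Instr.exec, *]

/-- The state of the machine during the search. -/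
structure Searching (wt : Sym2 (Fin n) → ℝ≥0) (H : SimpleGraph (Fin n)) (s : Fin n) (r : ℝ≥0∞)
    (ord : List (Fin n)) (x : Fin n) (rem : List (Fin n)) (c : Cfg) : Prop where
  tree : WinnerTree n (c.A 4) (c.A 5) (c.B 6)
  search : Search wt H s r ord x rem (c.A 6) (c.A 5) (c.B 6)
  r9 : c.r 9 = ord.length
  list : c.A 7 = fun i => (ord.map Fin.val).getD i 0
  r11 : c.r 11 = 1
  r16 : c.r 16 = n
  radius : if c.r 15 = 0 then (c.w 4 : ℝ≥0∞) = r else r = ⊤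

lemma relax_spec (hd : Dims n W F N) {c : Cfg} {s x y : Fin n} {r : ℝ≥0∞} {ord rem : List (Fin n)}
    (h : Searching wt H s r ord x (y :: rem) c) (hxo : x ∈ ord)
    (hmax : ∀ z ∈ ord, c.B 6 z ≤ c.B 6 x) (hadj : H.Adj x y) (h2 : c.r 2 = x) (h3 : c.r 3 < N)
    (hy : c.A 3 (c.r 3) = y) (hw : c.B 3 (c.r 3) = wt s(x, y)) (hw1 : c.w 1 = c.B 6 x) :
    Ex W F N relax c (70 * Nat.log 2 (2 * n) + 60) fun c' =>
      Searching wt H s r ord x rem c' ∧ Keeps c c' ∧ c'.r 2 = x ∧ c'.r 3 = c.r 3 ∧ c'.r 4 = c.r 4 ∧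
      c'.w 1 = c.w 1 ∧ ∀ z ∈ ord, c'.B 6 z = c.B 6 z := by
  obtain ⟨hn, hN, hW, hF⟩ := id hd
  have hx' := x.2
  have hy' := y.2
  set c₁ := execAll [.ld 5 3 3, .wld 2 3 3, .wa 3 1 2, .ld 6 5 5, .wld 5 6 5] c with hc₁
  have k5 : c₁.r 5 = y := by simp [hc₁, execAll, Instr.exec, hy]
  have k6 : c₁.r 6 = c.A 5 y := by simp [hc₁, execAll, Instr.exec, hy]
  have w3 : c₁.w 3 = c.B 6 x + wt s(x, y) := by simp [hc₁, execAll, Instr.exec, hw, hw1]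
  have w5 : c₁.w 5 = c.B 6 y := by simp [hc₁, execAll, Instr.exec, hy]
  have kA : c₁.A = c.A := rfl
  have kB : c₁.B = c.B := rfl
  have ko : c₁.out = c.out := rfl
  have kr : ∀ a, a ≠ 5 → a ≠ 6 → c₁.r a = c.r a := by
    intro a _ _
    simp [execAll, Instr.exec, *]
  have kw : ∀ a, a ≠ 2 → a ≠ 3 → a ≠ 5 → c₁.w a = c.w a := by
    intro a _ _ _
    simp [execAll, Instr.exec, *]
  have keep1 : Keeps c c₁ := ⟨fun _ _ _ _ _ => rfl, fun _ _ => rfl, rfl,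
    fun a ha => kr a (by omega) (by omega), fun a ha => kw a (by omega) (by omega) (by omega)⟩
  clear_value c₁
  have skip : (((c.B 6 x + wt s(x, y) : ℝ≥0) : ℝ≥0∞) < r → c.A 5 y ≠ 0 ∧
      c.B 6 y ≤ c.B 6 x + wt s(x, y)) → Searching wt H s r ord x rem c₁ ∧ Keeps c c₁ ∧
      c₁.r 2 = x ∧ c₁.r 3 = c.r 3 ∧ c₁.r 4 = c.r 4 ∧ c₁.w 1 = c.w 1 ∧
      ∀ z ∈ ord, c₁.B 6 z = c.B 6 z := by
    intro hs
    refine ⟨⟨?_, ?_, ?_, ?_, ?_, ?_, ?_⟩, keep1, ?_, ?_, ?_, ?_, fun z hz => by rw [kB]⟩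
    · rw [kA, kB]; exact h.tree
    · rw [kA, kB]; exact h.search.skip hs
    · rw [kr 9 (by simp) (by simp)]; exact h.r9
    · rw [kA]; exact h.list
    · rw [kr 11 (by simp) (by simp)]; exact h.r11
    · rw [kr 16 (by simp) (by simp)]; exact h.r16
    · rw [kr 15 (by simp) (by simp), kw 4 (by simp) (by simp) (by simp)]; exact h.radius
    · rw [kr 2 (by simp) (by simp), h2]
    · rw [kr 3 (by simp) (by simp)]
    · rw [kr 4 (by simp) (by simp)]
    · rw [kw 1 (by simp) (by simp) (by simp)]
  have enq : ((c.B 6 x + wt s(x, y) : ℝ≥0) : ℝ≥0∞) < r →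
      (c.A 5 y = 0 ∨ c.B 6 x + wt s(x, y) < c.B 6 y) →
      Ex W F N enqueue c₁ (70 * Nat.log 2 (2 * n) + 34) fun c' =>
        Searching wt H s r ord x rem c' ∧ Keeps c c' ∧ c'.r 2 = x ∧ c'.r 3 = c.r 3 ∧
        c'.r 4 = c.r 4 ∧ c'.w 1 = c.w 1 ∧ ∀ z ∈ ord, c'.B 6 z = c.B 6 z := by
    intro hr hlt
    obtain ⟨hyo, hs⟩ := h.search.update hxo hmax hadj hr hlt
    refine Ex.mono (enqueue_spec hd k5 ((kr 2 (by simp) (by simp)).trans h2)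
      ((kr 11 (by simp) (by simp)).trans h.r11) ((kr 16 (by simp) (by simp)).trans h.r16)
      (by rw [kA, kB]; exact h.tree)) le_rfl ?_
    rintro c' ⟨a1, a2, a3, a4, a5, a6, a7, a8⟩
    refine ⟨⟨a1, ?_, ?_, ?_, ?_, ?_, ?_⟩, keep1.trans a6, ?_, ?_, ?_, ?_, fun z hz => ?_⟩
    · rw [a2, a3, a4, kA, kB, w3]
      exact hs
    · rw [a7 9 (by simp) (by simp) (by simp) (by simp), kr 9 (by simp) (by simp), h.r9]
    · rw [a5, kA, h.list]
    · rw [a6.reg 11 (by simp), kr 11 (by simp) (by simp), h.r11]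
    · rw [a6.reg 16 (by simp), kr 16 (by simp) (by simp), h.r16]
    · rw [a6.reg 15 (by simp), kr 15 (by simp) (by simp), a6.wreg 4 (by simp),
        kw 4 (by simp) (by simp) (by simp)]
      exact h.radius
    · rw [a7 2 (by simp) (by simp) (by simp) (by simp), kr 2 (by simp) (by simp), h2]
    · rw [a7 3 (by simp) (by simp) (by simp) (by simp), kr 3 (by simp) (by simp)]
    · rw [a7 4 (by simp) (by simp) (by simp) (by simp), kr 4 (by simp) (by simp)]
    · rw [a8 1 (by simp) (by simp), kw 1 (by simp) (by simp) (by simp)]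
    · rw [a4, kB, Function.update_of_ne]
      intro e
      exact hyo (Fin.ext e ▸ hz)
  have rel2 : ((c.B 6 x + wt s(x, y) : ℝ≥0) : ℝ≥0∞) < r →
      Ex W F N (.cond (pos 6) (.cond (.wlt 3 5) enqueue .skip) enqueue) c₁
        (70 * Nat.log 2 (2 * n) + 36) fun c' =>
        Searching wt H s r ord x rem c' ∧ Keeps c c' ∧ c'.r 2 = x ∧ c'.r 3 = c.r 3 ∧
        c'.r 4 = c.r 4 ∧ c'.w 1 = c.w 1 ∧ ∀ z ∈ ord, c'.B 6 z = c.B 6 z := by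
    intro hr
    refine Ex.cond (by simp) (fun ht => Ex.cond (by simp) (fun ht' => enq hr (.inr ?_))
      (fun ht' => Ex.mono (Ex.skip (skip fun _ => ?_)) (by omega) (fun _ h => h)))
      (fun ht => Ex.mono (enq hr (.inl ?_)) (by omega) (fun _ h => h))
    · rwa [on_wlt, w3, w5] at ht'
    · rw [on_wlt, w3, w5, not_lt] at ht'
      rw [on_pos, k6] at ht
      exact ⟨ht.ne', ht'⟩
    · rw [on_pos, k6] at ht
      omega
  refine Ex.mono (t₁ := 21 + (70 * Nat.log 2 (2 * n) + 37 + 1)) (Ex.seq (Ex.blk (R := fun c' =>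
    Ex W F N _ c' (70 * Nat.log 2 (2 * n) + 37 + 1) _) _ ?_ ?_)) (by omega) (fun c' h => h)
  · simp [OkAll, Instr.Ok, Instr.exec, hy]
    omega
  rw [← hc₁]
  have hrad := h.radius
  refine Ex.cond (by simp) (fun ht => Ex.mono (rel2 ?_) (by omega) (fun _ h => h))
    (fun ht => ?_)
  · rw [on_pos, kr 15 (by simp) (by simp)] at ht
    rw [if_neg ht.ne'] at hrad
    rw [hrad]
    exact ENNReal.coe_lt_top
  · rw [on_pos, kr 15 (by simp) (by simp), not_lt, Nat.le_zero] at ht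
    rw [if_pos ht] at hrad
    refine Ex.cond (by simp) (fun ht' => rel2 ?_)
      (fun ht' => Ex.mono (Ex.skip (skip fun hlt => ?_)) (by omega) (fun _ h => h))
    · rw [on_wlt, w3, kw 4 (by simp) (by simp) (by simp)] at ht'
      rw [← hrad]
      exact ENNReal.coe_lt_coe.2 ht'
    · rw [on_wlt, w3, kw 4 (by simp) (by simp) (by simp)] at ht'
      rw [← hrad] at hlt
      exact absurd (ENNReal.coe_lt_coe.1 hlt) ht'

lemma relaxAll_spec (hd : Dims n W F N) {s x : Fin n} {r : ℝ≥0∞} {ord rem : List (Fin n)} {c : Cfg}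
    (h : Searching wt H s r ord x rem c) (hxo : x ∈ ord)
    (hmax : ∀ z ∈ ord, c.B 6 z ≤ c.B 6 x) (hadj : ∀ y ∈ rem, H.Adj x y) (h2 : c.r 2 = x)
    (h4 : c.r 4 = c.r 3 + rem.length) (h4N : c.r 4 ≤ N)
    (hy : ∀ (i : ℕ) (y : Fin n), rem[i]? = some y → c.A 3 (c.r 3 + i) = y ∧
      c.B 3 (c.r 3 + i) = wt s(x, y))
    (hw1 : c.w 1 = c.B 6 x) :
    Ex W F N relaxAll c ((70 * Nat.log 2 (2 * n) + 66) * rem.length + 1) fun c' =>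
      Searching wt H s r ord x [] c' ∧ Keeps c c' := by
  induction rem generalizing c with
  | nil =>
    exact Ex.mono (Ex.loop_stop (by simp) (by simp [h4]) ⟨h, Keeps.refl c⟩) (by omega)
      (fun _ h => h)
  | cons y rem ih =>
    rw [List.length_cons] at h4
    obtain ⟨hn, hN, hW, hF⟩ := id hd
    have hy0 := hy 0 y (by simp)
    rw [add_zero] at hy0
    refine Ex.mono (t₁ := ((70 * Nat.log 2 (2 * n) + 60) + 5) +
      ((70 * Nat.log 2 (2 * n) + 66) * rem.length + 1) + 1) (Ex.loop_step (by simp)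
      (by simp [h4]) (Ex.seq (Ex.mono (relax_spec hd h hxo hmax (hadj y (by simp)) h2 (by omega)
        hy0.1
        hy0.2 hw1) le_rfl (R' := fun c' => Ex W F N _ c' 5 _) ?_)))
      (by rw [List.length_cons, mul_add]; omega) (fun c' h => h)
    rintro c' ⟨a1, a2, a3, a4, a5, a6, a7⟩
    refine Ex.blk _ ?_ (Ex.mono (ih ?_ ?_ ?_ ?_ ?_ ?_ ?_ ?_) le_rfl ?_)
    · simp [OkAll, Instr.Ok, Op.eval, a4]
      omega
    · exact ⟨a1.tree, a1.search, a1.r9, a1.list, a1.r11, a1.r16, a1.radius⟩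
    · intro z hz
      simp only [execAll, Instr.exec]
      rw [a7 z hz, a7 x hxo]
      exact hmax z hz
    · exact fun y hy => hadj y (by simp [hy])
    · simpa [execAll, Instr.exec] using a3
    · simp [execAll, Instr.exec, Op.eval, a4, a5, h4]
      omega
    · simpa [execAll, Instr.exec, a5] using h4N
    · intro i y' hi
      have := hy (i + 1) y' (by simpa using hi)
      simp only [execAll, Instr.exec, Op.eval, Function.update_self, a4]
      rw [a2.arr 3 (by simp) (by simp) (by simp) (by simp), a2.warr 3 (by simp)]
      rw [show c.r 3 + 1 + i = c.r 3 + (i + 1) by ring]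
      exact this
    · simp only [execAll, Instr.exec]
      rw [a6, a7 x hxo, hw1]
    · rintro c'' ⟨b1, b2⟩
      refine ⟨b1, a2.trans (Keeps.trans (c' := execAll [.opi .add 3 3 1] c')
        ⟨by simp [execAll, Instr.exec], by simp [execAll, Instr.exec],
        rfl, fun a ha => ?_, by simp [execAll, Instr.exec]⟩ b2)⟩
      simp [execAll, Instr.exec, show a ≠ 3 by omega]

lemma settle_spec (hd : Dims n W F N) {s x y : Fin n} {r : ℝ≥0∞} {ord rem : List (Fin n)} {c : Cfg}
    (h : Searching wt H s r ord y [] c) (hx : c.A 5 x = 1)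
    (hmin : ∀ w : Fin n, c.A 5 w = 1 → c.B 6 x ≤ c.B 6 w) (hrem : ∀ z, H.Adj x z → z ∈ rem)
    (h2 : c.r 2 = x + 1) :
    Ex W F N settle c (70 * Nat.log 2 (2 * n) + 51) fun c' =>
      Searching wt H s r (ord ++ [x]) x rem c' ∧ (∀ z ∈ ord ++ [x], c'.B 6 z ≤ c'.B 6 x) ∧
      Keeps c c' ∧ c'.r 2 = x ∧ c'.r 3 = c.A 2 x ∧ c'.r 4 = c.A 2 (x + 1) ∧ c'.w 1 = c'.B 6 x := by
  obtain ⟨hn, hN, hW, hF⟩ := id hd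
  have hx' := x.2
  have h16 := h.r16
  have h9 := h.r9
  obtain ⟨hs, hmax⟩ := h.search.pop hx hmin hrem
  have hlen : ord.length < n := by
    have := hs.nodup.length_le_card
    simp at this
    omega
  refine Ex.mono (t₁ := (33 + (70 * Nat.log 2 (2 * n) + 1)) + 17) (Ex.seq (Ex.seq (Ex.blk _ ?_
    (Ex.mono (fixTree_spec h.tree hx' (by omega) (by omega) hW ?_ ?_ ?_ ?_ ?_) le_rfl ?_))))
    (by omega) (fun c' h => h)
  · simp [OkAll, Instr.Ok, Instr.exec, Op.eval, h2, h16, h9]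
    omega
  · simp [execAll, Instr.exec, Op.eval, h2, h16, add_comm]
  · intro z hz
    simp [execAll, Instr.exec, Op.eval, h2, hz]
  · intro z hz
    simp [execAll, Instr.exec]
  · simp [execAll, Instr.exec, Op.eval, h2, h16, add_comm]
  · simp [execAll, Instr.exec, h.r11]
  · rintro c' ⟨a1, a2, a3, a4, a5, a6⟩
    have e5 : c'.A 5 = Function.update (c.A 5) x 2 := by
      simp [a2, execAll, Instr.exec, Op.eval, h2]
    have e6 : c'.A 6 = c.A 6 := by simp [a2, execAll, Instr.exec]
    have e7 : c'.A 7 = Function.update (c.A 7) ord.length x := by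
      simp [a2, execAll, Instr.exec, Op.eval, h2, h9]
    have eB : c'.B = c.B := by simp [a3, execAll, Instr.exec]
    have e2 : c'.r 2 = x := by simp [a5, execAll, Instr.exec, Op.eval, h2]
    have e9 : c'.r 9 = ord.length + 1 := by simp [a5, execAll, Instr.exec, Op.eval, h9]
    have eA : ∀ g, g ≠ 4 → g ≠ 5 → g ≠ 7 → c'.A g = c.A g := by
      intro g h4 h5 h7
      rw [a2 g h4]
      simp [execAll, Instr.exec, h4, h5, h7]
    have er : ∀ a, (a = 0 ∨ a = 1 ∨ a = 7 ∨ a = 8 ∨ a = 11 ∨ 15 ≤ a) → c'.r a = c.r a := by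
      intro a ha
      rw [a5 a (by omega) (by omega) (by omega) (by omega)]
      simp [execAll, Instr.exec, show a ≠ 9 by omega, show a ≠ 13 by omega, show a ≠ 10 by omega,
        show a ≠ 14 by omega, show a ≠ 2 by omega]
    have ew : ∀ a, a ≠ 5 → a ≠ 6 → c'.w a = c.w a := by
      intro a h5 h6
      rw [a6 a h5 h6]
      simp [execAll, Instr.exec]
    have eo : c'.out = c.out := by simp [a4, execAll, Instr.exec]
    have ht : WinnerTree n (c'.A 4) (c'.A 5) (c'.B 6) := by
      rw [a2 5 (by simp), a3]
      exact a1
    refine Ex.blk _ ?_ ⟨⟨ht, ?_, ?_, ?_, ?_, ?_, ?_⟩, ?_, ⟨?_, ?_, eo, ?_, ?_⟩, ?_, ?_, ?_, ?_⟩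
    · simp [OkAll, Instr.Ok, Instr.exec, Op.eval, e2]
      omega
    · simp only [execAll, Instr.exec]
      rw [e5, e6, eB]
      exact hs
    · simp [execAll, Instr.exec, e9]
    · simp only [execAll, Instr.exec]
      rw [e7, h.list]
      have := getD_append_singleton (ord.map Fin.val) x
      simpa using this
    · simp [execAll, Instr.exec, er 11, h.r11]
    · simp [execAll, Instr.exec, er 16, h16]
    · simpa [execAll, Instr.exec, er 15, ew 4] using h.radius
    · simpa only [execAll, Instr.exec, eB] using hmax
    · intro g h4 h5 h6 h7
      exact eA g h4 h5 h7
    · intro g _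
      simp [execAll, Instr.exec, eB]
    · intro a ha
      rw [← er a ha]
      simp [execAll, Instr.exec, show a ≠ 3 by omega, show a ≠ 12 by omega, show a ≠ 4 by omega]
    · intro a ha
      rw [← ew a (by omega) (by omega)]
      simp [execAll, Instr.exec, show a ≠ 1 by omega]
    · simp [execAll, Instr.exec, e2]
    · simp [execAll, Instr.exec, e2, eA 2]
    · simp [execAll, Instr.exec, Op.eval, e2, eA 2]
    · simp [execAll, Instr.exec, e2]

/-- The arrays `off`, `adj` and `wgt` contain the adjacency lists `nb`: the neighbours of `x` and
the weights of the edges to them are in the cells with indices from `off x` to `off (x + 1) - 1`.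
-/
structure Adjacency (wt : Sym2 (Fin n) → ℝ≥0) (H : SimpleGraph (Fin n)) (N : ℕ) (off adj : ℕ → ℕ)
    (wgt : ℕ → ℝ≥0) (nb : Fin n → List (Fin n)) : Prop where
  mem : ∀ x y, y ∈ nb x ↔ H.Adj x y
  succ : ∀ x : Fin n, off (x + 1) = off x + (nb x).length
  le : ∀ x : Fin n, off (x + 1) ≤ N
  get : ∀ (x : Fin n) (i : ℕ) (y : Fin n), (nb x)[i]? = some y →
    adj (off x + i) = y ∧ wgt (off x + i) = wt s(x, y)

open Classical in
/-- The vertices at distance less than `r` from `s`. -/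
noncomputable def ball (wt : Sym2 (Fin n) → ℝ≥0) (H : SimpleGraph (Fin n)) (s : Fin n) (r : ℝ≥0∞) :
    Finset (Fin n) := {z | dist wt H z s < r}

/-- A bound on the running time of the search, if `S` is the set of the vertices it settles: each
edge at a settled vertex causes at most one update of the priority queue. -/
def searchTime (n : ℕ) (nb : Fin n → List (Fin n)) (S : Finset (Fin n)) : ℕ :=
  ∑ z ∈ S, (70 * Nat.log 2 (2 * n) + 66) * ((nb z).length + 1)

/-- Only vertices of the ball that are not settled yet are charged. This makes the induction work.
-/
lemma searchLoop_spec (hd : Dims n W F N) {nb : Fin n → List (Fin n)} {s y : Fin n} {r : ℝ≥0∞}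
    {ord : List (Fin n)} {c : Cfg} (h : Searching wt H s r ord y [] c)
    (ha : Adjacency wt H N (c.A 2) (c.A 3) (c.B 3) nb) (h2 : c.r 2 = c.A 4 1) :
    Ex W F N searchLoop c (searchTime n nb (ball wt H s r \ ord.toFinset) + 1) fun c' =>
      ∃ ord y, Searching wt H s r ord y [] c' ∧ (∀ v : Fin n, c'.A 5 v ≠ 1) ∧ Keeps c c' := by
  induction hk : (ball wt H s r \ ord.toFinset).card using Nat.strong_induction_on
    generalizing c ord y with
  | _ k ih =>
    obtain ⟨hn, hN, hW, hF⟩ := id hd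
    by_cases hT : c.A 4 1 = 0
    · refine Ex.mono (Ex.loop_stop (by simp) (by simp [h2, hT]) ⟨ord, y, h, fun v => ?_,
        Keeps.refl c⟩) (by omega) (fun _ h => h)
      exact h.tree.root_eq_zero hT v v.2
    · obtain ⟨x', hx'n, hx'T, hx'1, hx'min⟩ := h.tree.root (by omega) hT
      set x : Fin n := ⟨x', hx'n⟩ with hxdef
      have hxo : x ∉ ord := fun hxo => by
        have := (h.search.settled x).2 hxo
        simp [hxdef, hx'1] at this
      have hxb : x ∈ ball wt H s r := by
        simp only [ball, Finset.mem_filter, Finset.mem_univ, true_and]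
        exact h.search.dist_lt x (by simp [hxdef, hx'1])
      have hsd : ball wt H s r \ (ord ++ [x]).toFinset =
          (ball wt H s r \ ord.toFinset).erase x := by
        ext z
        simp
        tauto
      have hxm : x ∈ ball wt H s r \ ord.toFinset := by simp [hxb, hxo]
      have htime : searchTime n nb (ball wt H s r \ ord.toFinset) =
          (70 * Nat.log 2 (2 * n) + 66) * ((nb x).length + 1) +
            searchTime n nb (ball wt H s r \ (ord ++ [x]).toFinset) := by
        rw [hsd]
        exact (Finset.add_sum_erase _ _ hxm).symm
      refine Ex.mono (t₁ := ((70 * Nat.log 2 (2 * n) + 51) +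
        (((70 * Nat.log 2 (2 * n) + 66) * (nb x).length + 1) + 9)) +
        (searchTime n nb (ball wt H s r \ (ord ++ [x]).toFinset) + 1) + 1)
        (Ex.loop_step (by simp) (by simp [h2]; omega) (Ex.seq (Ex.mono (settle_spec hd h (x := x)
          (rem := nb x) hx'1 (fun w hw => hx'min w w.2 hw) (fun z hz => (ha.mem x z).2 hz)
          (h2.trans hx'T)) le_rfl (R' := fun c' => Ex W F N _ c'
            (((70 * Nat.log 2 (2 * n) + 66) * (nb x).length + 1) + 9) _) ?_)))
        (by rw [htime, mul_add]; omega) (fun c' h => h)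
      rintro c₁ ⟨a1, a2, a3, a4, a5, a6, a7⟩
      have hsucc := ha.succ x
      have hle := ha.le x
      refine Ex.seq (Ex.mono (relaxAll_spec hd a1 (by simp) a2 (fun y hy => (ha.mem x y).1 hy) a4
        (by rw [a5, a6, hsucc]) (by rw [a6]; exact hle) ?_ a7) le_rfl
        (R' := fun c' => Ex W F N _ c' 9 _) ?_)
      · intro i y hi
        rw [a3.arr 3 (by simp) (by simp) (by simp) (by simp), a3.warr 3 (by simp), a5]
        exact ha.get x i y hi
      · rintro c₂ ⟨b1, b2⟩
        refine Ex.blk _ ?_ (Ex.mono (ih _ ?_ (y := x) (ord := ord ++ [x]) ?_ ?_ ?_ rfl) le_rfl ?_)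
        · simp [OkAll, Instr.Ok, Instr.exec]
          omega
        · rw [← hk, hsd]
          exact Finset.card_erase_lt_of_mem hxm
        · refine ⟨b1.tree, b1.search, ?_, b1.list, ?_, ?_, ?_⟩
          · simp [execAll, Instr.exec, b1.r9]
          · simp [execAll, Instr.exec, b1.r11]
          · simp [execAll, Instr.exec, b1.r16]
          · simpa [execAll, Instr.exec] using b1.radius
        · simp only [execAll, Instr.exec]
          rw [b2.arr 3 (by simp) (by simp) (by simp) (by simp), b2.warr 3 (by simp),
            b2.arr 2 (by simp) (by simp) (by simp) (by simp),
            a3.arr 3 (by simp) (by simp) (by simp) (by simp), a3.warr 3 (by simp),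
            a3.arr 2 (by simp) (by simp) (by simp) (by simp)]
          exact ha
        · simp [execAll, Instr.exec]
        · rintro c₃ ⟨ord', y', e1, e2, e3⟩
          refine ⟨ord', y', e1, e2, a3.trans (b2.trans
            (Keeps.trans (c' := execAll [.set 12 1, .ld 2 4 12] c₂) ⟨?_, ?_, rfl, ?_, ?_⟩ e3))⟩
          · simp [execAll, Instr.exec]
          · simp [execAll, Instr.exec]
          · intro a ha
            simp [execAll, Instr.exec, show a ≠ 2 by omega, show a ≠ 12 by omega]
          · simp [execAll, Instr.exec]

/-- The arrays used by the search are empty. -/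
structure Clean (c : Cfg) : Prop where
  a4 : c.A 4 = fun _ => 0
  a5 : c.A 5 = fun _ => 0
  a6 : c.A 6 = fun _ => 0
  a7 : c.A 7 = fun _ => 0
  b6 : c.B 6 = fun _ => 0

lemma search_spec (hd : Dims n W F N) {nb : Fin n → List (Fin n)} {s : Fin n} {r : ℝ≥0∞}
    (hr : 0 < r)
    {c : Cfg} (hc : Clean c) (h7 : c.r 7 = s) (h16 : c.r 16 = n)
    (hrad : if c.r 15 = 0 then (c.w 4 : ℝ≥0∞) = r else r = ⊤)
    (ha : Adjacency wt H N (c.A 2) (c.A 3) (c.B 3) nb) :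
    Ex W F N search c (searchTime n nb (ball wt H s r) + 70 * Nat.log 2 (2 * n) + 40) fun c' =>
      ∃ ord y, Searching wt H s r ord y [] c' ∧ (∀ v : Fin n, c'.A 5 v ≠ 1) ∧
        Keeps { c with r := Function.update c.r 11 1 } c' := by
  obtain ⟨hn, hN, hW, hF⟩ := id hd
  have hs := s.2
  have h0 : WinnerTree n (fun _ => 0) (fun _ => 0) (fun _ => 0) :=
    ⟨by simp, by simp [pick], rfl, by simp⟩
  refine Ex.mono (t₁ := (29 + (70 * Nat.log 2 (2 * n) + 1)) + (9 +
    (searchTime n nb (ball wt H s r) + 1))) (Ex.seq (Ex.seq (Ex.blk _ ?_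
    (Ex.mono (fixTree_spec h0 hs (by omega) (by omega) hW ?_ ?_ ?_ ?_ ?_) le_rfl ?_))))
    (by omega) (fun c' h => h)
  · simp [OkAll, Instr.Ok, Instr.exec, Op.eval, h7, h16]
    omega
  · simp [execAll, Instr.exec, Op.eval, h7, h16, hc.a4, add_comm]
  · intro z hz
    simp [execAll, Instr.exec, Op.eval, h7, hz, hc.a5]
  · intro z hz
    simp [execAll, Instr.exec, hc.b6]
  · simp [execAll, Instr.exec, Op.eval, h7, h16, add_comm]
  · simp [execAll, Instr.exec]
  · rintro c' ⟨a1, a2, a3, a4, a5, a6⟩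
    have e5 : c'.A 5 = Function.update (fun _ => 0) (s : ℕ) 1 := by
      simp [a2, execAll, Instr.exec, h7, hc.a5]
    have e6 : c'.A 6 = fun _ => 0 := by simp [a2, execAll, Instr.exec, hc.a6]
    have e7 : c'.A 7 = fun _ => 0 := by simp [a2, execAll, Instr.exec, hc.a7]
    have eB : c'.B = c.B := by simp [a3, execAll, Instr.exec]
    have e9 : c'.r 9 = 0 := by simp [a5, execAll, Instr.exec]
    have ht : WinnerTree n (c'.A 4) (c'.A 5) (c'.B 6) := by
      rw [a2 5 (by simp), a3]
      exact a1
    have keep : Keeps { c with r := Function.update c.r 11 1 } c' := by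
      refine ⟨fun g h4 h5 h6 h7 => ?_, fun g h6 => ?_, ?_, fun a ha => ?_, fun a ha => ?_⟩
      · rw [a2 g h4]
        simp [execAll, Instr.exec, h4, h5]
      · rw [eB]
      · simp [a4, execAll, Instr.exec]
      · rw [a5 a (by omega) (by omega) (by omega) (by omega)]
        rcases eq_or_ne a 11 with rfl | h11
        · simp [execAll, Instr.exec]
        simp [execAll, Instr.exec, show a ≠ 9 by omega, show a ≠ 13 by omega, show a ≠ 10 by omega,
          show a ≠ 14 by omega, h11]
      · rw [a6 a (by omega) (by omega)]
        simp [execAll, Instr.exec]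
    have keep2 : Keeps c' (execAll [.set 12 1, .ld 2 4 12] c') := by
      refine ⟨fun g h4 h5 h6 h7 => rfl, fun g h6 => rfl, rfl, fun a ha => ?_, fun a ha => rfl⟩
      simp [execAll, Instr.exec, show a ≠ 2 by omega, show a ≠ 12 by omega]
    refine Ex.seq (Ex.blk _ ?_ (Ex.mono (searchLoop_spec hd (y := s) (ord := []) (nb := nb) (r := r)
      (s := s) (wt := wt) (H := H) ⟨ht, ?_, ?_, ?_, ?_, ?_, ?_⟩ ?_ ?_) ?_ ?_))
    · simp [OkAll, Instr.Ok, Instr.exec]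
      omega
    · simp only [execAll, Instr.exec]
      rw [e5, e6, eB, hc.b6]
      exact Search.init hr
    · simp [execAll, Instr.exec, e9]
    · simp [execAll, Instr.exec, e7]
    · simp [execAll, Instr.exec, keep.reg 11]
    · simp [execAll, Instr.exec, keep.reg 16, h16]
    · simpa [execAll, Instr.exec, keep.reg 15, keep.wreg 4] using hrad
    · simp only [execAll, Instr.exec]
      rw [keep.arr 3 (by simp) (by simp) (by simp) (by simp), keep.warr 3 (by simp),
            keep.arr 2 (by simp) (by simp) (by simp) (by simp)]
      exact ha
    · simp [execAll, Instr.exec]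
    · simp
    · rintro c'' ⟨ord, y, b1, b2, b3⟩
      exact ⟨ord, y, b1, b2, keep.trans (keep2.trans b3)⟩

/-- The list of the settled vertices tells which cells have to be erased, so erasing takes no
longer than the search. -/
lemma eraseSearch_spec (hd : Dims n W F N) {c : Cfg} (l : List (Fin n)) (h9 : c.r 9 = l.length)
    (hl : c.A 7 = fun i => (l.map Fin.val).getD i 0) (hln : l.length ≤ n)
    (h5 : ∀ v, v ∉ l.map Fin.val → c.A 5 v = 0 ∧ c.A 6 v = 0 ∧ c.B 6 v = 0)
    (h4 : c.A 4 = fun _ => 0) :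
    Ex W F N eraseSearch c (34 * l.length + 1) fun c' => Clean c' ∧ Keeps c c' := by
  induction l using List.reverseRecOn generalizing c with
  | nil =>
    refine Ex.mono (Ex.loop_stop (by simp) (by simp [h9]) ⟨⟨h4, ?_, ?_, ?_, ?_⟩, Keeps.refl c⟩)
      (by omega) (fun _ h => h)
    · exact funext fun v => (h5 v (by simp)).1
    · exact funext fun v => (h5 v (by simp)).2.1
    · simpa using hl
    · exact funext fun v => (h5 v (by simp)).2.2
  | append_singleton l x ih =>
    obtain ⟨hn, hN, hW, hF⟩ := id hd
    have hx := x.2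
    simp only [List.length_append, List.length_singleton] at h9 hln
    have hlast : c.A 7 l.length = x := by
      simp [hl]
    refine Ex.mono (t₁ := 33 + (34 * l.length + 1) + 1)
      (Ex.loop_step (by simp) (by simp [h9]) (Ex.blk _ ?_ (Ex.mono (ih ?_ ?_ (by omega) ?_ ?_)
        le_rfl
      ?_))) (by simp; omega) (fun c' h => h)
    · simp [OkAll, Instr.Ok, Instr.exec, Op.eval, h9, hlast]
      omega
    · simp [execAll, Instr.exec, Op.eval, h9]
    · simp only [execAll, Instr.exec, Op.eval]
      simp only [Function.update_self, h9, Nat.add_sub_cancel, ne_eq, Nat.reduceEqDiff,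
        not_false_eq_true, Function.update_of_ne]
      rw [hl, List.map_append, List.map_singleton, ← getD_append_singleton, List.length_map,
        Function.update_idem]
      funext i
      by_cases hi : i = l.length
      · subst hi; simp
      · simp [hi]
    · intro v hv
      rcases eq_or_ne v x with rfl | hvx
      · simp [execAll, Instr.exec, Op.eval, h9, hlast]
      · have := h5 v (by simp [hvx]; simpa using hv)
        simpa [execAll, Instr.exec, Op.eval, h9, hlast, hvx] using this
    · simp [execAll, Instr.exec, h4]
    · rintro c' ⟨a1, a2⟩
      refine ⟨a1, Keeps.trans (c' := execAll [.opi .sub 9 9 1, .ld 2 7 9, .set 13 0, .wz 3,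
        .st 5 2 13, .st 6 2 13, .wst 6 2 3, .st 7 9 13] c) ⟨?_, ?_, rfl, ?_, ?_⟩ a2⟩
      · intro g _ _ _ _
        simp [execAll, Instr.exec, *]
      · intro g _
        simp [execAll, Instr.exec, *]
      · intro a ha
        simp [execAll, Instr.exec, show a ≠ 2 by omega, show a ≠ 9 by omega, show a ≠ 13 by omega]
      · intro a ha
        simp [execAll, Instr.exec, show a ≠ 3 by omega]

end SearchProgram

/-! ### Distances -/

section Levels

variable {n : ℕ} {H : SimpleGraph (Fin n)} {wt : Sym2 (Fin n) → ℝ≥0} {W F N : ℕ}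

lemma dist_comm (u v : Fin n) : dist wt H u v = dist wt H v u := by
  have h : ∀ u v : Fin n, dist wt H u v ≤ dist wt H v u := fun u v =>
    le_iInf fun p => by simpa using dist_le_len (wt := wt) p.reverse
  exact le_antisymm (h u v) (h v u)

lemma dist_triangle (u v w : Fin n) : dist wt H u w ≤ dist wt H u v + dist wt H v w := by
  simp only [dist, ENNReal.iInf_add, ENNReal.add_iInf]
  refine le_iInf fun p => le_iInf fun q => ?_
  rw [← ENNReal.coe_add, ← len_append]
  exact dist_le_len _

lemma dist_lt_top_iff {u v : Fin n} : dist wt H u v < ⊤ ↔ H.Reachable u v := by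
  rw [dist_lt_iff]
  exact ⟨fun ⟨p, _⟩ => ⟨p⟩, fun ⟨p⟩ => ⟨p, ENNReal.coe_lt_top⟩⟩

lemma IsShortest.len_eq {u v : Fin n} {p : H.Walk u v} (hp : IsShortest wt p) :
    (len wt p : ℝ≥0∞) = dist wt H u v :=
  le_antisymm (le_iInf fun q => ENNReal.coe_le_coe.2 (hp q)) (dist_le_len p)

lemma distTo_le {S : Finset (Fin n)} {v x : Fin n} (hx : x ∈ S) : distTo wt H S v ≤ dist wt H v x :=
  iInf₂_le x hx

lemma distTo_lt_iff {S : Finset (Fin n)} {v : Fin n} {r : ℝ≥0∞} :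
    distTo wt H S v < r ↔ ∃ x ∈ S, dist wt H v x < r := by
  simp [distTo, iInf_lt_iff]

lemma distTo_lt_top {S : Finset (Fin n)} {u v : Fin n} (h : H.Reachable u v)
    (hu : distTo wt H S u < ⊤) : distTo wt H S v < ⊤ := by
  rw [distTo_lt_iff] at hu ⊢
  obtain ⟨x, hx, hxu⟩ := hu
  exact ⟨x, hx, dist_lt_top_iff.2 (h.symm.trans (dist_lt_top_iff.1 hxu))⟩

/-! ### The data structure -/

/-- The contents of the integer arrays `A` and the weight arrays `B` of the oracle.
* `A 0` holds the number `N` of cells of each array, the order of the graph, and the number of keys.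
* `A 1` tells the connected components apart.
* `A 2`, `A 3` and `B 3` hold the adjacency lists.
* `A 4` to `A 8` and `B 6` are the workspace: winner tree, states, predecessors, settled vertices,
  stack, and tentative distances.
* `A 9` is the increasing list of the keys of the stored pairs of landmarks. For the pair with index
  `i`, the number of edges and the length of the path are `A 11 i` and `B 9 i`, and its list for
  `Traced` begins at the index `A 10 i` of `A 12`.
* `A 13` is positive at the vertices that do not reach a `1`-landmark.
* `A (20 + 2 * i)` holds the pointers towards the `i`-landmarks, and `B (20 + 2 * i)` the distances
  from them, which are replaced by `0` if they are infinite.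
* `A (21 + 2 * i)` holds the numbers used to trace the stored paths between `i`-landmarks. -/
structure Oracle (h : ℕ) (wt : Sym2 (Fin n) → ℝ≥0) (H : SimpleGraph (Fin n)) (L : Hierarchy h n)
    (ell : ℕ → Fin n → Fin n) (nb : Fin n → List (Fin n)) (W N : ℕ) (A : ℕ → ℕ → ℕ)
    (B : ℕ → ℕ → ℝ≥0) : Prop where
  nearest : IsNearest wt H L ell
  size : A 0 0 = N
  order : A 0 1 = n
  comp : ∀ u v : Fin n, A 1 u = A 1 v ↔ H.Reachable u v
  adj : Adjacency wt H N (A 2) (A 3) (B 3) nb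
  empty : ∀ g, 4 ≤ g → g ≤ 8 → A g = fun _ => 0
  wempty : B 6 = fun _ => 0
  radius : ∀ v : Fin n, (A 13 v = 0 ∧ (B 22 v : ℝ≥0∞) = distTo wt H (landmarks L 1) v) ∨
    (A 13 v ≠ 0 ∧ distTo wt H (landmarks L 1) v = ⊤ ∧ B 22 v = 0)
  keys : ∀ i j, i < j → j < A 0 2 → A 9 i < A 9 j
  keys_zero : ∀ i, A 0 2 ≤ i → A 9 i = 0
  keys_lt : A 0 2 < N
  climb : ∀ i ∈ Finset.Icc 1 h, ∀ v, distTo wt H (landmarks L i) v < ⊤ → ∃ p : H.Walk v (ell i v),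
    Follows (A (20 + 2 * i)) p ∧ p.IsPath ∧ IsShortest wt p ∧ B (20 + 2 * i) v = len wt p
  stored : ∀ j ∈ Finset.Icc 1 h, ∀ x ∈ landmarks L j, ∀ y ∈ landmarks L j, H.Reachable x y →
    Stops wt H L j x y → ∃ i < A 0 2, A 9 i = (j * n + x) * n + y ∧ ∃ p : H.Walk x y,
      IsShortest wt p ∧ p.IsPath ∧ A 11 i = p.length ∧ B 9 i = len wt p ∧
      ∀ z, Traced N (A (21 + 2 * j)) (A 12) 0 z (A 10 i) p
  not_stored : ∀ j ∈ Finset.Icc 1 h, ∀ x y : Fin n, ¬ Stops wt H L j x y →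
    ∀ i < A 0 2, A 9 i ≠ (j * n + x) * n + y
  word : ∀ f x, A f x < W

/-! ### The upper levels of a query -/

/-- The query at the levels `j, …, j + k - 1`: move from the vertices in registers `0` and `1` to
their nearest `j`-landmarks, and look for a stored path between them. The part of the answer on the
side of the first vertex is output at once, and the part on the other side is pushed. -/
def levels : ℕ → ℕ → Prog
  | 0, _ => .skip
  | k + 1, j =>
    .seq (blk [.wld 1 (20 + 2 * j) 0, .wa 0 0 1, .wld 1 (20 + 2 * j) 1, .wa 0 0 1])
      (.seq (followEmit (20 + 2 * j)) (.seq (followPush (20 + 2 * j))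
        (.seq (blk [.set 19 j, .op .mul 19 19 16, .op .add 19 19 0, .op .mul 19 19 16,
          .op .add 19 19 1, .set 3 0, .opi .add 4 21 0])
          (.seq lookup (.cond (pos 17) (reportPath (21 + 2 * j)) (levels k (j + 1)))))))

/-- At a level where the query does not stop, the landmarks of the next level are near. At level
`0` the factor is `1`, above it is `3`. -/
lemma distTo_of_not_stops {h : ℕ} {L : Hierarchy h n} {j : ℕ} (hj : j < h) {x y : Fin n}
    (hs : ¬ Stops wt H L j x y) :
    (distTo wt H (landmarks L (j + 1)) x ≤ 3 * dist wt H x y ∧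
      distTo wt H (landmarks L (j + 1)) y ≤ 3 * dist wt H x y) := by
  have h3 : ∀ a b : ℝ≥0∞, a / 3 ≤ b → a ≤ 3 * b := fun a b h => by
    rw [mul_comm]
    exact (ENNReal.div_le_iff_le_mul (by simp) (by simp)).1 h
  unfold Stops at hs
  by_cases hj0 : j = 0
  · subst hj0
    simp only [if_true, not_or, not_lt] at hs
    have : ∀ a : ℝ≥0∞, a ≤ 3 * a := fun a => le_mul_of_one_le_left (by simp) (by norm_num)
    exact ⟨hs.1.trans (this _), (hs.2.trans_eq (dist_comm _ _)).trans (this _)⟩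
  · rw [if_neg hj0, if_neg hj.ne] at hs
    simp only [not_or, not_lt] at hs
    exact ⟨h3 _ _ hs.1, h3 _ _ (hs.2.trans_eq (dist_comm _ _))⟩

/-- The states in which only the stack may differ from the data structure. -/
structure Intact (A : ℕ → ℕ → ℕ) (B : ℕ → ℕ → ℝ≥0) (c : Cfg) : Prop where
  arr : ∀ g, g ≠ 8 → c.A g = A g
  warr : c.B = B

/-- The query from level `j` on. In the conclusion, `l` and `l'` are the contents of the stack; the
output followed by the stack is what matters, as the stack is output last. -/
lemma levels_spec {h : ℕ} {L : Hierarchy h n} {ell : ℕ → Fin n → Fin n} {nb : Fin n → List (Fin n)}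
    {A : ℕ → ℕ → ℕ} {B : ℕ → ℕ → ℝ≥0} (hO : Oracle h wt H L ell nb W N A B) (hd : Dims n W F N)
    (hh : 1 ≤ h) (hF : 21 + 2 * h < F)
    (hW : (h + 1) * n * n < W) (k j : ℕ) (hjk : j + k = h + 1) (hj : 1 ≤ j)
    {x y : Fin n} (hxy : H.Reachable x y) (hs : ¬ Stops wt H L (j - 1) x y) :
    ∃ p : H.Walk x y, IsAnswer wt H L ell (j - 1) x y p ∧ ∀ (c : Cfg) (l : List ℕ),
      Intact A B c → Stack c l → l.length + k * n ≤ N → c.r 0 = x → c.r 1 = y → c.r 16 = n →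
      c.r 21 = A 0 2 →
      Ex W F N (levels k j) c ((120 + 20 * Nat.log 2 (2 * N)) * k + 1 + 40 * p.length) fun c' =>
        Intact A B c' ∧ c'.w 0 = c.w 0 + len wt p ∧ ∃ l', Stack c' l' ∧
          c'.out ++ l'.reverse = c.out ++ (verts p ++ l.reverse) ∧ l'.length ≤ l.length + k * n ∧
          l'.length ≤ l.length + p.length := by
  induction k generalizing j x y with
  | zero =>
    exfalso
    apply hs
    unfold Stops
    by_cases hh : j - 1 = 0
    · omega
    · rw [if_neg hh, if_pos (by omega)]
      trivial
  | succ k ih =>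
    obtain ⟨hn, hN, hW', hF'⟩ := id hd
    obtain ⟨j, rfl⟩ : ∃ i, j = i + 1 := ⟨j - 1, by omega⟩
    rw [Nat.add_sub_cancel] at hs ⊢
    have hjm : j + 1 ∈ Finset.Icc 1 h := by simp; omega
    have hxt : dist wt H x y < ⊤ := dist_lt_top_iff.2 hxy
    obtain ⟨hrx, hry⟩ := distTo_of_not_stops (by omega) hs
    have h3 : 3 * dist wt H x y < ⊤ := ENNReal.mul_lt_top (by simp) hxt
    replace hrx := hrx.trans_lt h3
    replace hry := hry.trans_lt h3
    have hxl := (hO.nearest _ hjm x hrx).1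
    have hyl := (hO.nearest _ hjm y hry).1
    obtain ⟨p₁, hp1, hp2, hp3, hp4⟩ := hO.climb _ hjm x hrx
    obtain ⟨q₁, hq1, hq2, hq3, hq4⟩ := hO.climb _ hjm y hry
    have hup : ∀ r, ¬ Stops wt H L j x y → IsAnswer wt H L ell (j + 1) _ _ r →
      IsAnswer wt H L ell j x y (p₁.append (r.append q₁.reverse)) := fun r hs hr =>
      .up _ _ _ _ _ _ hs hp3 hq3 hr
    generalize ell (j + 1) x = x' at *
    generalize ell (j + 1) y = y' at *
    have hxy' : H.Reachable x' y' := SimpleGraph.Reachable.trans ⟨p₁.reverse⟩ (hxy.trans ⟨q₁⟩)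
    have hpn : p₁.length < n := by simpa using hp2.length_lt
    have hqn : q₁.length < n := by simpa using hq2.length_lt
    have hx'n := x'.2
    have hy'n := y'.2
    have hxn := x.2
    have hyn := y.2
    -- the answer for the landmarks, and the part of the query after the search for the key
    have key : ∃ r : H.Walk x' y', IsAnswer wt H L ell (j + 1) x' y' r ∧
        ∀ (c : Cfg) (l : List ℕ), Intact A B c → Stack c l → l.length + k * n ≤ N →
          c.r 0 = x' → c.r 1 = y' → c.r 16 = n → c.r 21 = A 0 2 →
          ((∃ i < A 0 2, A 9 i = ((j + 1) * n + x') * n + y' ∧ c.r 3 = i ∧ c.r 17 = 1) ∨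
            ((∀ i < A 0 2, A 9 i ≠ ((j + 1) * n + x') * n + y') ∧ c.r 17 = 0)) →
          Ex W F N (.cond (pos 17) (reportPath (21 + 2 * (j + 1))) (levels k (j + 1 + 1))) c
            ((120 + 20 * Nat.log 2 (2 * N)) * k + 42 + 40 * r.length) fun c' =>
              Intact A B c' ∧ c'.w 0 = c.w 0 + len wt r ∧ ∃ l', Stack c' l' ∧
                c'.out ++ l'.reverse = c.out ++ (verts r ++ l.reverse) ∧
                l'.length ≤ l.length + k * n ∧ l'.length ≤ l.length + r.length := by
      by_cases hs' : Stops wt H L (j + 1) x' y'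
      · obtain ⟨i, hi, hik, r, hr1, hr2, hr3, hr4, hr5⟩ := hO.stored _ hjm x' hxl y' hyl hxy' hs'
        refine ⟨r, .here _ _ _ _ hs' hr1, fun c l hI hl hlN h0 h1 h16 h21 hc => ?_⟩
        obtain ⟨i', hi', hik', h3', h17⟩ : ∃ i < A 0 2, A 9 i = ((j + 1) * n + x') * n + y' ∧
            c.r 3 = i ∧ c.r 17 = 1 := hc.resolve_right fun hc => hc.1 i hi hik
        have : i' = i := by
          rcases lt_trichotomy i' i with hlt | rfl | hlt
          · have := hO.keys _ _ hlt hi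
            omega
          · rfl
          · have := hO.keys _ _ hlt hi'
            omega
        subst this
        have hkl := hO.keys_lt
        refine Ex.mono (Ex.cond (by simp) (fun _ => reportPath_spec (i := i') r ?_ ?_ h0 h3' ?_ ?_
          ?_
          ?_ ?_ ?_ ?_) (fun ht => ?_)) (t₁ := 40 * r.length + 40 + 1) (by omega) ?_
        · rw [hI.arr _ (by omega), hI.arr 12 (by simp), hI.arr 10 (by simp)]
          exact hr5 _
        · rw [hI.arr 11 (by simp), hr3]
        · omega
        · omega
        · omega
        · omega
        · omega
        · rw [hI.arr _ (by omega)]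
          exact hO.word _
        · have : r.length < n := by simpa using hr2.length_lt
          omega
        · simp [h17] at ht
        · rintro c' ⟨a1, a2, a3, a4, a5⟩
          refine ⟨⟨fun g hg => ?_, ?_⟩, ?_, l, ⟨?_, ?_⟩, ?_, by omega, by omega⟩
          · rw [a2, hI.arr g hg]
          · rw [a3, hI.warr]
          · rw [a4, hI.warr, hr4]
          · rw [a5 18 (by simp) (by simp) (by simp) (by simp) (by simp) (by simp)]
            exact hl.1
          · rw [a2]
            exact hl.2
          · rw [a1, List.append_assoc]
      · obtain ⟨r, hr, hr'⟩ := ih (j + 1 + 1) (by omega) (by omega) hxy' hs'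
        refine ⟨r, hr, fun c l hI hl hlN h0 h1 h16 h21 hc => ?_⟩
        have h17 : c.r 17 = 0 := by
          rcases hc with ⟨i, hi, hik, -⟩ | ⟨-, h17⟩
          · exact absurd hik (hO.not_stored _ hjm x' y' hs' i hi)
          · exact h17
        refine Ex.mono (Ex.cond (t := (120 + 20 * Nat.log 2 (2 * N)) * k + 1 + 40 * r.length)
          (by simp) (fun ht => ?_) (fun _ => hr' c l hI hl hlN h0 h1 h16 h21))
          (by omega) (fun _ h => h)
        simp [h17] at ht
    obtain ⟨r, hr, hrun⟩ := key
    refine ⟨p₁.append (r.append q₁.reverse), hup r hs hr,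
      fun c l hI hl hlN h0 h1 h16 h21 => ?_⟩
    have hmul : (k + 1) * n = k * n + n := by ring
    have hfF : 20 + 2 * (j + 1) < F := by omega
    refine Ex.mono (t₁ := 17 + ((14 * p₁.length + 6) + ((18 * q₁.length + 6) + (29 +
      ((20 * Nat.log 2 (2 * N) + 20) + ((120 + 20 * Nat.log 2 (2 * N)) * k + 42 + 40 *
        r.length))))))
      (Ex.seq (Ex.blk _ ?_ (Ex.seq (Ex.mono (followEmit_spec p₁ ?_ ?_ hfF (by omega) (by omega))
        le_rfl
        (R' := fun c' => Ex W F N _ c' _ _) ?_)))) ?_ (fun _ h => h)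
    · simp [OkAll, Instr.Ok, Instr.exec, h0, h1]
      omega
    · simp only [execAll, Instr.exec]
      rw [hI.arr _ (by omega)]
      exact hp1
    · simpa [execAll, Instr.exec] using h0
    swap
    · simp only [SimpleGraph.Walk.length_append, SimpleGraph.Walk.length_reverse]
      rw [mul_add, mul_one]
      omega
    rintro c₁ ⟨a1, a2, a3, a4, a5, a6⟩
    have b1 : c₁.A = c.A := by rw [a3]; rfl
    have b2 : c₁.B = B := by rw [a4]; exact hI.warr
    have b3 : c₁.out = c.out ++ inits p₁ := by rw [a2]; rfl
    have b4 : c₁.w 0 = c.w 0 + len wt p₁ + len wt q₁ := by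
      rw [a5]
      simp [execAll, Instr.exec, h0, h1, hI.warr, hp4, hq4]
    have b5 : ∀ a, a ≠ 0 → a ≠ 2 → c₁.r a = c.r a := fun a h h' => by
      rw [a6 a h h']
      rfl
    clear a2 a3 a4 a5 a6
    refine Ex.seq (Ex.mono (followPush_spec (l := l) q₁ ?_ (by omega) ⟨?_, ?_⟩ (by omega) ?_ hfF
      (by omega) (by omega) (by omega)) le_rfl (R' := fun c' => Ex W F N _ c' _ _) ?_)
    · rw [b1, hI.arr _ (by omega)]
      exact hq1
    · rw [b5 18 (by simp) (by simp)]
      exact hl.1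
    · rw [b1]
      exact hl.2
    · rw [b5 1 (by simp) (by simp), h1]
    rintro c₂ ⟨d1, d2, d3, d4, d5, d6, d7⟩
    have e0 : c₂.r 0 = x' := by rw [d7 0 (by simp) (by simp) (by simp), a1]
    have e16 : c₂.r 16 = n := by
      rw [d7 16 (by simp) (by simp) (by simp), b5 16 (by simp) (by simp), h16]
    have e21 : c₂.r 21 = A 0 2 := by
      rw [d7 21 (by simp) (by simp) (by simp), b5 21 (by simp) (by simp), h21]
    have eI : Intact A B c₂ := ⟨fun g hg => by rw [d4 g hg, b1, hI.arr g hg], by rw [d5, b2]⟩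
    have hkl := hO.keys_lt
    have m2 : ((j + 1) * n + x' + 1) * n ≤ (h + 1) * n * n := by
      apply Nat.mul_le_mul_right
      have : (j + 1 + 1) * n ≤ (h + 1) * n := Nat.mul_le_mul_right _ (by omega)
      rw [Nat.succ_mul] at this
      omega
    have m3 : ((j + 1) * n + x') * n + n ≤ (h + 1) * n * n := by rw [← Nat.succ_mul]; exact m2
    have m4 : (j + 1) * n + x' ≤ ((j + 1) * n + x') * n := Nat.le_mul_of_pos_right _ (by omega)
    have m5 : j + 1 ≤ (j + 1) * n := Nat.le_mul_of_pos_right _ (by omega)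
    refine Ex.seq (Ex.blk _ ?_ (Ex.seq (Ex.mono (lookup_spec (m := A 0 2) ?_ ?_ ?_ ?_ ?_ (by omega)
      hW'
      (by omega)) le_rfl (R' := fun c' => Ex W F N _ c' _ _) ?_)))
    · simp [OkAll, Instr.Ok, Instr.exec, Op.eval, e0, d1, e16, e21]
      omega
    · simp only [execAll, Instr.exec]
      rw [eI.arr 9 (by simp)]
      exact hO.keys
    · simp only [execAll, Instr.exec]
      rw [eI.arr 9 (by simp)]
      exact hO.keys_zero
    · simp [execAll, Instr.exec, Op.eval, e0, d1, e16]
      left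
      omega
    · simp [execAll, Instr.exec]
    · simp [execAll, Instr.exec, Op.eval, e21]
    rintro c₃ ⟨f1, f2, f3, f4, f5, f6⟩
    have g : ∀ a, a ≠ 3 → a ≠ 4 → a ≠ 5 → a ≠ 6 → a ≠ 17 → a ≠ 19 → c₃.r a = c₂.r a := by
      intro a _ _ _ _ _ _
      rw [f5 a ‹_› ‹_› ‹_› ‹_› ‹_›]
      simp [execAll, Instr.exec, *]
    refine Ex.mono (hrun c₃ (l ++ inits q₁) ⟨fun g hg => ?_, ?_⟩ ⟨?_, ?_⟩ ?_ ?_ ?_ ?_ ?_ ?_) le_rfl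
      ?_
    · rw [f2]
      exact eI.arr g hg
    · rw [f3]
      exact eI.warr
    · rw [g 18 (by simp) (by simp) (by simp) (by simp) (by simp) (by simp)]
      exact d2.1
    · rw [f2]
      exact d2.2
    · rw [List.length_append, length_inits]
      omega
    · rw [g 0 (by simp) (by simp) (by simp) (by simp) (by simp) (by simp), e0]
    · rw [g 1 (by simp) (by simp) (by simp) (by simp) (by simp) (by simp), d1]
    · rw [g 16 (by simp) (by simp) (by simp) (by simp) (by simp) (by simp), e16]
    · rw [g 21 (by simp) (by simp) (by simp) (by simp) (by simp) (by simp), e21]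
    · simp only [execAll, Instr.exec, Op.eval] at f6
      rw [eI.arr 9 (by simp)] at f6
      simpa [e0, d1, e16] using f6
    · rintro c₄ ⟨i1, i2, l', i3, i4, i5, i6⟩
      refine ⟨i1, ?_, l', i3, ?_, ?_, ?_⟩
      · rw [i2, f4]
        simp only [execAll, Instr.exec]
        rw [d6, b4]
        simp
        ring
      · rw [i4, f1, verts_detour]
        simp only [execAll, Instr.exec]
        rw [d3, b3]
        simp
      · rw [List.length_append, length_inits] at i5
        omega
      · rw [List.length_append, length_inits] at i6
        simp
        omega

end Levels

/-! ### The query program -/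

section Query

variable {n : ℕ} {H : SimpleGraph (Fin n)} {wt : Sym2 (Fin n) → ℝ≥0} {W F N : ℕ}

/-- Choose the vertex, among registers `0` and `1`, with the larger distance from the `1`-landmarks
as the source `7` of the search, and the other one as the target `8`; the flag `20` tells which
one. -/
def orient : Prog :=
  .seq (blk [.opi .add 7 0 0, .opi .add 8 1 0, .ld 15 13 0, .wld 4 22 0, .wld 5 22 1, .set 20 0])
    (.cond (.wlt 4 5) (blk [.opi .add 7 1 0, .opi .add 8 0 0, .wa 4 5 7, .set 20 1]) .skip)

/-- Search the ball of the source; register `17` becomes `1` if the target has been found, and `0`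
otherwise. -/
def findTarget : Prog :=
  .seq (.cond (pos 15) search (.cond (.wlt 7 4) search (blk [.set 9 0])))
    (blk [.ld 17 5 8, .opi .sub 17 17 1])

/-- Report the path that the search has found, in the direction given by the flag `20`. -/
def reportFound : Prog :=
  .seq (blk [.wld 0 6 8]) (.cond (pos 20) (.seq (followEmit 6) (blk [.emit 0]))
    (.seq (followPush 6) (blk [.emit 1])))

/-- The query for two vertices in the same component. The data of the search are erased before the
stack is output, and the flag in register `17` tells whether the upper levels are needed. -/
def queryBody (h : ℕ) : Prog :=
  .seq orient (.seq findTarget (.seq (.cond (pos 17) reportFound .skip)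
    (.seq eraseSearch (.seq (.cond (pos 17) .skip (levels h 1)) popAll))))

/-- The query for the vertices in registers `0` and `1`; register `16` becomes the order of the
graph, and register `21` the number of keys. -/
def query (h : ℕ) : Prog :=
  .seq (blk [.set 14 1, .ld 16 0 14, .set 14 2, .ld 21 0 14, .ld 2 1 0, .ld 3 1 1])
    (.cond (eq 2 3) (queryBody h) .skip)

/-- The condition for stopping at level `0` is tested by a search from the vertex with the larger
distance from the landmarks. -/
lemma stops_zero_iff {h : ℕ} {L : Hierarchy h n} {u v s t : Fin n}
    (hst : (s = u ∧ t = v ∧ distTo wt H (landmarks L 1) v ≤ distTo wt H (landmarks L 1) u) ∨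
      (s = v ∧ t = u ∧ distTo wt H (landmarks L 1) u ≤ distTo wt H (landmarks L 1) v)) :
    Stops wt H L 0 u v ↔ dist wt H t s < distTo wt H (landmarks L 1) s := by
  simp only [Stops, if_true]
  rcases hst with ⟨rfl, rfl, h⟩ | ⟨rfl, rfl, h⟩
  · rw [dist_comm t s]
    exact ⟨fun h' => h'.elim id fun h' => h'.trans_le h, .inl⟩
  · rw [dist_comm s t]
    exact ⟨fun h' => h'.elim (fun h' => h'.trans_le h) id, .inr⟩

/-- The state between the parts of a query: what remains of the data structure, and the constants.
-/
structure Ready (A : ℕ → ℕ → ℕ) (B : ℕ → ℕ → ℝ≥0) (n : ℕ) (u v : Fin n) (c : Cfg) : Prop where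
  arr : c.A = A
  warr : c.B = B
  out : c.out = []
  r0 : c.r 0 = u
  r1 : c.r 1 = v
  r16 : c.r 16 = n
  r18 : c.r 18 = 0
  r21 : c.r 21 = A 0 2
  w0 : c.w 0 = 0
  w7 : c.w 7 = 0

section

variable {h : ℕ} {L : Hierarchy h n} {ell : ℕ → Fin n → Fin n} {nb : Fin n → List (Fin n)}
  {A : ℕ → ℕ → ℕ} {B : ℕ → ℕ → ℝ≥0} {u v : Fin n} {c : Cfg}

lemma orient_spec (hO : Oracle h wt H L ell nb W N A B) (hd : Dims n W F N) (hF : 22 < F)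
    (huv : H.Reachable u v) (hc : Ready A B n u v c) :
    Ex W F N orient c 50 fun c' => Ready A B n u v c' ∧ ∃ s t : Fin n, c'.r 7 = s ∧ c'.r 8 = t ∧
      (if c'.r 15 = 0 then (c'.w 4 : ℝ≥0∞) = distTo wt H (landmarks L 1) s
        else distTo wt H (landmarks L 1) s = ⊤) ∧
      ((s = u ∧ t = v ∧ c'.r 20 = 0 ∧
        distTo wt H (landmarks L 1) v ≤ distTo wt H (landmarks L 1) u) ∨
      (s = v ∧ t = u ∧ c'.r 20 = 1 ∧
        distTo wt H (landmarks L 1) u ≤ distTo wt H (landmarks L 1) v)) := by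
  obtain ⟨hn, hN, hW, hF'⟩ := id hd
  obtain ⟨e1, e2, e3, e4, e5, e6, e7, e8, e9, e10⟩ := hc
  have hu := u.2
  have hv := v.2
  have hfin : distTo wt H (landmarks L 1) u < ⊤ ↔ distTo wt H (landmarks L 1) v < ⊤ :=
    ⟨distTo_lt_top huv, distTo_lt_top huv.symm⟩
  have hru := hO.radius u
  have hrv := hO.radius v
  refine Ex.mono (t₁ := 25 + (17 + 1)) (Ex.seq (Ex.blk _ ?_ (Ex.cond (by simp)
    (fun ht => Ex.blk _ ?_ ?_)
    (fun ht => Ex.mono (Ex.skip ?_) (by omega) (fun _ h => h))))) (by omega) (fun _ h => h)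
  · simp [OkAll, Instr.Ok, Instr.exec, Op.eval, e4, e5]
    omega
  · simp [OkAll, Instr.Ok, execAll, Instr.exec, Op.eval, e4, e5]
    omega
  · simp [execAll, Instr.exec, e4, e5, e2] at ht
    refine ⟨⟨?_, ?_, ?_, ?_, ?_, ?_, ?_, ?_, ?_, ?_⟩, v, u, ?_, ?_, ?_, .inr ⟨rfl, rfl, ?_, ?_⟩⟩
    all_goals try simp [execAll, Instr.exec, Op.eval, *]
    · rcases hru with ⟨h1, h2⟩ | ⟨h1, h2, h3⟩
      · rcases hrv with ⟨h1', h2'⟩ | ⟨h1', h2', h3'⟩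
        · simp [h1, h2']
        · simp [h3'] at ht
      · simp only [h1, if_false]
        by_contra h4
        exact (hfin.2 (lt_top_iff_ne_top.2 h4)).ne h2
    · rcases hru with ⟨h1, h2⟩ | ⟨h1, h2, h3⟩
      · rcases hrv with ⟨h1', h2'⟩ | ⟨h1', h2', h3'⟩
        · rw [← h2, ← h2']
          exact ENNReal.coe_le_coe.2 ht.le
        · rw [h2']
          exact le_top
      · have : ¬ distTo wt H (landmarks L 1) v < ⊤ := fun h4 => (hfin.2 h4).ne h2
        rw [not_lt.1 this |>.antisymm' le_top]
        exact le_top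
  · simp [execAll, Instr.exec, e4, e5, e2] at ht
    refine ⟨⟨?_, ?_, ?_, ?_, ?_, ?_, ?_, ?_, ?_, ?_⟩, u, v, ?_, ?_, ?_, .inl ⟨rfl, rfl, ?_, ?_⟩⟩
    all_goals try simp [execAll, Instr.exec, Op.eval, *]
    · rcases hru with ⟨h1, h2⟩ | ⟨h1, h2, h3⟩
      · simp [h1, h2]
      · simp [h1, h2]
    · rcases hru with ⟨h1, h2⟩ | ⟨h1, h2, h3⟩
      · rcases hrv with ⟨h1', h2'⟩ | ⟨h1', h2', h3'⟩
        · rw [← h2, ← h2']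
          exact ENNReal.coe_le_coe.2 ht
        · have : distTo wt H (landmarks L 1) u < ⊤ := by
            rw [← h2]
            exact ENNReal.coe_lt_top
          exact absurd h2' (hfin.1 this).ne
      · rw [h2]
        exact le_top

/-- The state after a search that settled the vertices `ord`: the data structure is intact outside
the workspace, and the traces of the search are confined to the vertices `ord`. -/
structure Searched (wt : Sym2 (Fin n) → ℝ≥0) (H : SimpleGraph (Fin n)) (A : ℕ → ℕ → ℕ)
    (B : ℕ → ℕ → ℝ≥0) (ord : List (Fin n)) (c : Cfg) : Prop where
  arr : ∀ g, g ≠ 4 → g ≠ 5 → g ≠ 6 → g ≠ 7 → g ≠ 8 → c.A g = A g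
  warr : ∀ g, g ≠ 6 → c.B g = B g
  r9 : c.r 9 = ord.length
  list : c.A 7 = fun i => (ord.map Fin.val).getD i 0
  zero : ∀ x, x ∉ ord.map Fin.val → c.A 5 x = 0 ∧ c.A 6 x = 0 ∧ c.B 6 x = 0
  tree : c.A 4 = fun _ => 0

/-- A radius `0` is treated separately, as the search settles its source in any case. -/
lemma findTarget_spec (hO : Oracle h wt H L ell nb W N A B) (hd : Dims n W F N)
    (hc : Ready A B n u v c) {s t : Fin n} (h7 : c.r 7 = s) (h8 : c.r 8 = t) {r : ℝ≥0∞}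
    (hr : if c.r 15 = 0 then (c.w 4 : ℝ≥0∞) = r else r = ⊤) :
    Ex W F N findTarget c (searchTime n nb (ball wt H s r) + 70 * Nat.log 2 (2 * n) + 60) fun c' =>
      ∃ ord : List (Fin n), Searched wt H A B ord c' ∧
        66 * ord.length ≤ searchTime n nb (ball wt H s r) ∧ ord.length ≤ n ∧
        c'.A 8 = A 8 ∧ c'.r 17 = (if dist wt H t s < r then 1 else 0) ∧
        (dist wt H t s < r → ∃ p : H.Walk t s, Follows (c'.A 6) p ∧ p.length ≤ ord.length ∧
          c'.B 6 t = len wt p ∧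
          IsShortest wt p) ∧
        c'.out = [] ∧ c'.w 0 = 0 ∧
        ∀ a, (a = 0 ∨ a = 1 ∨ a = 7 ∨ a = 8 ∨ (15 ≤ a ∧ a ≠ 17)) → c'.r a = c.r a := by
  obtain ⟨hn, hN, hW, hF⟩ := id hd
  have hclean : Clean c := by
    constructor <;> simp only [hc.arr, hc.warr]
    · exact hO.empty 4 (by simp) (by simp)
    · exact hO.empty 5 (by simp) (by simp)
    · exact hO.empty 6 (by simp) (by simp)
    · exact hO.empty 7 (by simp) (by simp)
    · exact hO.wempty
  have ht := t.2
  -- the effect of the search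
  have main : 0 < r → Ex W F N search c
      (searchTime n nb (ball wt H s r) + 70 * Nat.log 2 (2 * n) + 40)
      fun c' => Ex W F N (blk [.ld 17 5 8, .opi .sub 17 17 1]) c' 9 fun c' =>
      ∃ ord : List (Fin n), Searched wt H A B ord c' ∧
        66 * ord.length ≤ searchTime n nb (ball wt H s r) ∧ ord.length ≤ n ∧
        c'.A 8 = A 8 ∧ c'.r 17 = (if dist wt H t s < r then 1 else 0) ∧
        (dist wt H t s < r → ∃ p : H.Walk t s, Follows (c'.A 6) p ∧ p.length ≤ ord.length ∧
          c'.B 6 t = len wt p ∧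
          IsShortest wt p) ∧
        c'.out = [] ∧ c'.w 0 = 0 ∧
        ∀ a, (a = 0 ∨ a = 1 ∨ a = 7 ∨ a = 8 ∨ (15 ≤ a ∧ a ≠ 17)) → c'.r a = c.r a := by
    intro hr0
    refine Ex.mono (search_spec hd hr0 hclean h7 hc.r16 hr ?_) le_rfl ?_
    · rw [hc.arr, hc.warr]
      exact hO.adj
    rintro c' ⟨ord, y, h1, h2, h3⟩
    obtain ⟨h4, h5⟩ := h1.search.dist_eq h2
    have k8 : c'.r 8 = t := by rw [h3.reg 8 (by simp)]; simpa using h8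
    have kreg : ∀ a, (a = 0 ∨ a = 1 ∨ a = 7 ∨ a = 8 ∨ (15 ≤ a ∧ a ≠ 17)) → c'.r a = c.r a := by
      intro a ha
      rw [h3.reg a (by omega)]
      simp [show a ≠ 11 by omega]
    have hval := h1.search.vals t
    have hset := h1.search.settled t
    have h2t := h2 t
    refine Ex.blk _ ?_ ⟨ord, ⟨?_, ?_, ?_, ?_, ?_, ?_⟩, ?_, ?_, ?_, ?_, ?_, ?_, ?_, ?_⟩
    · simp [OkAll, Instr.Ok, Instr.exec, Op.eval, k8]
      omega
    · intro g g4 g5 g6 g7 g8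
      simpa [execAll, Instr.exec, hc.arr] using h3.arr g g4 g5 g6 g7
    · intro g g6
      simpa [execAll, Instr.exec, hc.warr] using h3.warr g g6
    · simpa [execAll, Instr.exec] using h1.r9
    · simpa [execAll, Instr.exec] using h1.list
    · intro x hx
      have h0 : c'.A 5 x = 0 := by
        by_cases hxn : x < n
        · have a := h1.search.vals x
          have b := h1.search.settled ⟨x, hxn⟩
          have d := h2 ⟨x, hxn⟩
          have : (⟨x, hxn⟩ : Fin n) ∉ ord := fun hm => hx (List.mem_map.2 ⟨_, hm, rfl⟩)
          simp only [this, iff_false] at b d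
          omega
        · exact h1.search.range x (not_lt.1 hxn)
      exact ⟨h0, h1.search.zero x h0⟩
    · exact h1.tree.eq_zero fun x hx => h2 ⟨x, hx⟩
    · calc 66 * ord.length = ∑ _z ∈ ord.toFinset, 66 := by
            rw [Finset.sum_const, List.toFinset_card_of_nodup h1.search.nodup, smul_eq_mul,
              mul_comm]
        _ ≤ ∑ z ∈ ord.toFinset, (70 * Nat.log 2 (2 * n) + 66) * ((nb z).length + 1) := by
            refine Finset.sum_le_sum fun z _ => ?_
            calc 66 = 66 * 1 := rfl
              _ ≤ _ := Nat.mul_le_mul (by omega) (by omega)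
        _ ≤ _ := by
            refine Finset.sum_le_sum_of_subset fun z hz => ?_
            simpa [ball] using (h4 z).1 (by simpa using hz)
    · have := h1.search.nodup.length_le_card
      simpa using this
    · simpa [execAll, Instr.exec, hc.arr] using h3.arr 8 (by simp) (by simp) (by simp) (by simp)
    · simp only [execAll, Instr.exec, Op.eval, Function.update_self, k8]
      have h4t := h4 t
      split_ifs with hh
      · rw [hset.2 (h4t.2 hh)]
      · have : c'.A 5 t ≠ 2 := fun h => hh (h4t.1 (hset.1 h))
        omega
    · intro hlt
      obtain ⟨p, p1, p2, p3, p4, p5⟩ := h5 t ((h4 t).2 hlt)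
      refine ⟨p, by simpa [execAll, Instr.exec] using p1, ?_, p3.symm, p4⟩
      have : p.support.length ≤ ord.length :=
        (p2.support_nodup.subperm fun y hy => p5 y hy).length_le
      rw [SimpleGraph.Walk.length_support] at this
      omega
    · simpa [execAll, Instr.exec, hc.out] using h3.out
    · simpa [execAll, Instr.exec, hc.w0] using h3.wreg 0 (by simp)
    · intro a ha
      rw [← kreg a ha]
      simp [execAll, Instr.exec, show a ≠ 17 by omega]
  refine Ex.mono (t₁ := (searchTime n nb (ball wt H s r) + 70 * Nat.log 2 (2 * n) + 40 + 1 + 1) + 9)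
    (Ex.seq (Ex.cond (by simp) (fun hh => Ex.mono (main ?_) (by omega) (fun _ h => h))
      (fun hh => Ex.cond (by simp) (fun hh' => main ?_) (fun hh' => Ex.mono
        (Ex.blk _ ?_ (Ex.blk _ ?_
        ⟨[], ⟨?_, ?_, ?_, ?_, ?_, ?_⟩, ?_, ?_, ?_, ?_, ?_, ?_, ?_, ?_⟩)) (by simp)
        (fun _ h => h))))) (by omega) (fun _ h => h)
  · rw [on_pos] at hh
    rw [if_neg hh.ne'] at hr
    simp [hr]
  · rw [on_pos, not_lt, Nat.le_zero] at hh
    rw [if_pos hh] at hr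
    rw [on_wlt, hc.w7] at hh'
    rw [← hr]
    exact ENNReal.coe_pos.2 hh'
  all_goals
    rw [on_pos, not_lt, Nat.le_zero] at hh
    rw [if_pos hh] at hr
    rw [on_wlt, hc.w7] at hh'
    have hr0 : r = 0 := by
      rw [← hr]
      simpa using hh'
    subst hr0
  · simp [OkAll, Instr.Ok]
    omega
  · simp [OkAll, Instr.Ok, execAll, Instr.exec, Op.eval, h8, hclean.a5]
    omega
  · intro g _ _ _ _ _
    simp [execAll, Instr.exec, hc.arr]
  · intro g _
    simp [execAll, Instr.exec, hc.warr]
  · simp [execAll, Instr.exec]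
  · simp [execAll, Instr.exec, hclean.a7]
  · simp [execAll, Instr.exec, hclean.a5, hclean.a6, hclean.b6]
  · simp [execAll, Instr.exec, hclean.a4]
  · simp
  · simp
  · simp [execAll, Instr.exec, hc.arr]
  · simp [execAll, Instr.exec, Op.eval, hclean.a5]
  · simp
  · simp [execAll, Instr.exec, hc.out]
  · simp [execAll, Instr.exec, hc.w0]
  · intro a ha
    simp [execAll, Instr.exec, show a ≠ 17 by omega, show a ≠ 9 by omega]

/-- The search tree leads from the target to the source, so that the path is pushed if the source
is the first vertex of the query. -/
lemma reportFound_spec (hd : Dims n W F N) {ord : List (Fin n)} (hs : Searched wt H A B ord c)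
    (hord : ord.length ≤ n) (h8 : Stack c []) (h0 : c.r 0 = u) (h1 : c.r 1 = v) (ho : c.out = [])
    {s t : Fin n} (ht : c.r 8 = t)
    (hst : (s = u ∧ t = v ∧ c.r 20 = 0) ∨ (s = v ∧ t = u ∧ c.r 20 = 1)) (p : H.Walk t s)
    (hp : Follows (c.A 6) p) (hpl : p.length ≤ ord.length) (hpd : c.B 6 t = len wt p)
    (hps : IsShortest wt p) :
    Ex W F N reportFound c (18 * ord.length + 20) fun c' => ∃ q : H.Walk u v, IsShortest wt q ∧
      Searched wt H A B ord c' ∧ c'.w 0 = len wt q ∧ c'.r 17 = c.r 17 ∧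
      ∃ l, Stack c' l ∧ c'.out ++ l.reverse = verts q ∧ l.length ≤ ord.length := by
  obtain ⟨hn, hN, hW, hF⟩ := id hd
  have ht' := t.2
  have frame : ∀ c' : Cfg, (∀ g, g ≠ 8 → c'.A g = c.A g) → c'.B = c.B → c'.r 9 = c.r 9 →
      Searched wt H A B ord c' := by
    intro c' h1 h2 h3
    refine ⟨fun g g4 g5 g6 g7 g8 => ?_, fun g g6 => ?_, ?_, ?_, ?_, ?_⟩
    · rw [h1 g g8]; exact hs.arr g g4 g5 g6 g7 g8
    · rw [h2]; exact hs.warr g g6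
    · rw [h3]; exact hs.r9
    · rw [h1 7 (by simp)]; exact hs.list
    · rw [h1 5 (by simp), h1 6 (by simp), h2]; exact hs.zero
    · rw [h1 4 (by simp)]; exact hs.tree
  refine Ex.mono (t₁ := 5 + ((18 * ord.length + 6 + 5) + 1)) (Ex.seq (Ex.blk _ ?_ (Ex.cond (by simp)
    (fun hh => ?_) (fun hh => ?_)))) (by omega) (fun _ h => h)
  · simp [OkAll, Instr.Ok, ht]
    omega
  · rw [on_pos] at hh
    simp only [execAll, Instr.exec] at hh
    obtain ⟨rfl, rfl, h20⟩ : s = v ∧ t = u ∧ c.r 20 = 1 := hst.resolve_left fun h => by omega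
    refine Ex.mono (t₁ := (14 * p.length + 6) + 5) (Ex.seq (Ex.mono
      (followEmit_spec p hp h0 (by omega)
      (by omega) (by omega)) le_rfl (R' := fun c' => Ex W F N _ c' 5 _) ?_)) (by omega)
        (fun _ h => h)
    rintro c' ⟨a1, a2, a3, a4, a5, a6⟩
    refine Ex.blk _ (by simp [OkAll, Instr.Ok]) ⟨p, hps, frame _ (fun g _ => ?_) ?_ ?_, ?_, ?_, [],
      ⟨?_, ?_⟩, ?_, ?_⟩
    · simp only [execAll, Instr.exec]
      rw [a3]
      rfl
    · simp only [execAll, Instr.exec]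
      rw [a4]
      rfl
    · simp [execAll, Instr.exec, a6]
    · simp [execAll, Instr.exec, a5, ht, hpd]
    · simp [execAll, Instr.exec, a6]
    · simpa [execAll, Instr.exec, a6] using h8.1
    · simpa [execAll, Instr.exec, a3] using h8.2
    · simp [execAll, Instr.exec, a2, ho, a1, verts_eq p]
    · simp
  · rw [on_pos] at hh
    simp only [execAll, Instr.exec] at hh
    obtain ⟨rfl, rfl, h20⟩ : s = u ∧ t = v ∧ c.r 20 = 0 := hst.resolve_right fun h => by omega
    refine Ex.mono (t₁ := (18 * p.length + 6) + 5) (Ex.seq (Ex.mono (followPush_spec (l := []) p hp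
      (by simp) h8 (by simp; omega) h1 (by omega) (by omega) (by omega) (by omega)) le_rfl
      (R' := fun c' => Ex W F N _ c' 5 _) ?_)) (by omega) (fun _ h => h)
    rintro c' ⟨a1, a2, a3, a4, a5, a6, a7⟩
    refine Ex.blk _ (by simp [OkAll, Instr.Ok]) ⟨p.reverse, ?_, frame _ (fun g g8 => ?_) ?_ ?_, ?_,
      ?_, inits p, ?_, ?_, ?_⟩
    · intro q
      have := hps q.reverse
      rwa [len_reverse] at this ⊢
    · simp only [execAll, Instr.exec]
      rw [a4 g g8]
      rfl
    · simp only [execAll, Instr.exec]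
      rw [a5]
      rfl
    · simp [execAll, Instr.exec, a7]
    · simp [execAll, Instr.exec, a6, ht, hpd]
    · simp [execAll, Instr.exec, a7]
    · simpa [execAll, Instr.exec, Stack] using a2
    · simp [execAll, Instr.exec, a3, ho, a1, verts_reverse]
    · rw [length_inits]
      exact hpl

lemma queryBody_spec (hO : Oracle h wt H L ell nb W N A B) (hd : Dims n W F N) (hh : 1 ≤ h)
    (hF : 21 + 2 * h < F) (hW : (h + 1) * n * n < W) (hN : (h + 1) * n ≤ N) (huv : H.Reachable u v)
    (hc : Ready A B n u v c) {X : ℕ}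
    (hX : ∀ s, searchTime n nb (ball wt H s (distTo wt H (landmarks L 1) s)) ≤ X) :
    ∃ τ, Ex W F N (queryBody h) c τ fun c' => ∃ p : H.Walk u v, IsAnswer wt H L ell 0 u v p ∧
      τ ≤ 3 * X + 70 * Nat.log 2 (2 * n) + (120 + 20 * Nat.log 2 (2 * N)) * h + 200 +
        62 * p.length ∧ c'.A = A ∧ c'.B = B ∧ c'.out = verts p ∧ c'.w 0 = len wt p := by
  obtain ⟨hn, hN', hW', hF'⟩ := id hd
  -- the end of the query, after the search data have been used
  have erase : ∀ (c : Cfg) (ord : List (Fin n)) (R : Cfg → Prop) (τ : ℕ), Searched wt H A B ord c →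
      ord.length ≤ n → (∀ c', Intact A B c' → Keeps c c' → Ex W F N
        (.seq (.cond (pos 17) .skip (levels h 1)) popAll) c' τ R) →
      Ex W F N (.seq eraseSearch (.seq (.cond (pos 17) .skip (levels h 1)) popAll)) c
        (34 * ord.length + 1 + τ) R := by
    intro c ord R τ hs hord hR
    refine Ex.seq (Ex.mono (eraseSearch_spec hd ord hs.r9 hs.list hord hs.zero hs.tree) le_rfl ?_)
    rintro c' ⟨h1, h2⟩
    refine hR c' ⟨fun g g8 => ?_, ?_⟩ h2
    · rcases eq_or_ne g 4 with rfl | g4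
      · rw [h1.a4, hO.empty 4 (by simp) (by simp)]
      rcases eq_or_ne g 5 with rfl | g5
      · rw [h1.a5, hO.empty 5 (by simp) (by simp)]
      rcases eq_or_ne g 6 with rfl | g6
      · rw [h1.a6, hO.empty 6 (by simp) (by simp)]
      rcases eq_or_ne g 7 with rfl | g7
      · rw [h1.a7, hO.empty 7 (by simp) (by simp)]
      rw [h2.arr g g4 g5 g6 g7]
      exact hs.arr g g4 g5 g6 g7 g8
    · funext g
      rcases eq_or_ne g 6 with rfl | g6
      · rw [h1.b6, hO.wempty]
      · rw [h2.warr g g6, hs.warr g g6]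
  have final : ∀ (c : Cfg) (l : List ℕ), Intact A B c → Stack c l → l.length ≤ N →
      Ex W F N popAll c (22 * l.length + 1) fun c' => c'.A = A ∧ c'.B = B ∧
        c'.out = c.out ++ l.reverse ∧ c'.w 0 = c.w 0 := by
    intro c l hI hl hlN
    refine Ex.mono (popAll_spec hl hlN (by omega) (by omega)) le_rfl ?_
    rintro c' ⟨h1, h2, h3, h4, h5, h6⟩
    refine ⟨funext fun g => ?_, h4.trans hI.warr, h2, by rw [h5]⟩
    rcases eq_or_ne g 8 with rfl | g8
    · rw [h1.2, hO.empty 8 (by simp) (by simp)]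
      simp
    · rw [h3 g g8, hI.arr g g8]
  have hA8 : A 8 = fun i => ([] : List ℕ).getD i 0 := by
    rw [hO.empty 8 (by simp) (by simp)]
    simp
  by_cases hs : Stops wt H L 0 u v
  · refine ⟨50 + ((X + 70 * Nat.log 2 (2 * n) + 60) + ((X + 20 + 1) + (X + 4))), ?_⟩
    refine Ex.seq (Ex.mono (orient_spec hO hd (by omega) huv hc) le_rfl ?_)
    rintro c₁ ⟨hc₁, s, t, h7, h8, hr, hst⟩
    have hlt := (stops_zero_iff (s := s) (t := t) (by tauto)).1 hs
    refine Ex.seq (Ex.mono (findTarget_spec hO hd hc₁ h7 h8 hr) (by have := hX s; omega) ?_)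
    rintro c₂ ⟨ord, a1, a2, a3, a4, a5, a6, a7, a8, a9⟩
    rw [if_pos hlt] at a5
    obtain ⟨p, p1, p2, p3, p4⟩ := a6 hlt
    have hXs := hX s
    have e20 : c₂.r 20 = c₁.r 20 := a9 20 (by simp)
    refine Ex.seq (Ex.cond (by simp) (fun _ => Ex.mono (reportFound_spec (u := u) (v := v) (s := s)
      (t := t) hd a1 a3
      ⟨?_, ?_⟩ ?_ ?_ a7 ?_ (by rw [e20]; tauto) p p1 p2 p3 p4) (by omega) ?_) (fun hh => ?_))
    · rw [a9 18 (by simp), hc₁.r18]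
      rfl
    · rw [a4, hA8]
    · rw [a9 0 (by simp), hc₁.r0]
    · rw [a9 1 (by simp), hc₁.r1]
    · rw [a9 8 (by simp), h8]
    · rintro c₃ ⟨q, q1, q2, q3, q4, l, l1, l2, l3⟩
      refine Ex.mono (erase c₃ ord _ (2 + (22 * l.length + 1)) q2 a3 fun c₄ hI hk => ?_) (by omega)
        (fun _ h => h)
      have h17 : c₄.r 17 = 1 := by rw [hk.reg 17 (by simp), q4, a5]
      refine Ex.seq (Ex.cond (by simp) (fun _ => Ex.skip (Ex.mono
        (final c₄ l hI ⟨?_, ?_⟩ (by omega))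
        le_rfl ?_)) (fun hh => ?_))
      · rw [hk.reg 18 (by simp), l1.1]
      · rw [hk.arr 8 (by simp) (by simp) (by simp) (by simp), l1.2]
      · rintro c₅ ⟨f1, f2, f3, f4⟩
        refine ⟨q, .here _ _ _ _ hs q1, by omega, f1, f2, ?_, ?_⟩
        · rw [f3, hk.out, l2]
        · rw [f4, hk.wreg 0 (by simp), q3]
      · simp [h17] at hh
    · simp [a5] at hh
  · obtain ⟨p, hp, hrun⟩ := levels_spec hO hd hh hF hW h 1 (by omega) le_rfl huv hs
    refine ⟨50 + ((X + 70 * Nat.log 2 (2 * n) + 60) + ((1 + 1) + (X + 1 +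
      (((120 + 20 * Nat.log 2 (2 * N)) * h + 1 + 40 * p.length + 1) + (22 * p.length + 1))))), ?_⟩
    refine Ex.seq (Ex.mono (orient_spec hO hd (by omega) huv hc) le_rfl ?_)
    rintro c₁ ⟨hc₁, s, t, h7, h8, hr, hst⟩
    have hlt := (stops_zero_iff (s := s) (t := t) (by tauto)).not.1 hs
    refine Ex.seq (Ex.mono (findTarget_spec hO hd hc₁ h7 h8 hr) (by have := hX s; omega) ?_)
    rintro c₂ ⟨ord, a1, a2, a3, a4, a5, a6, a7, a8, a9⟩
    rw [if_neg hlt] at a5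
    have hXs := hX s
    refine Ex.seq (Ex.cond (by simp) (fun hh => ?_) (fun _ => Ex.skip ?_))
    · simp [a5] at hh
    refine Ex.mono (erase c₂ ord _ (((120 + 20 * Nat.log 2 (2 * N)) * h + 1 + 40 * p.length + 1) +
      (22 * p.length + 1)) a1 a3 fun c₃ hI hk => ?_) (by omega) (fun _ h => h)
    have hreg : ∀ a, (a = 0 ∨ a = 1 ∨ 18 ≤ a ∨ a = 16) → c₃.r a = c₁.r a := by
      intro a ha
      rw [hk.reg a (by omega), a9 a (by omega)]
    refine Ex.seq (Ex.cond (by simp) (fun hh => ?_) (fun _ => Ex.mono (hrun c₃ [] hI ⟨?_, ?_⟩ ?_ ?_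
      ?_ ?_ ?_) le_rfl ?_))
    · rw [on_pos, hk.reg 17 (by simp), a5] at hh
      omega
    · rw [hreg 18 (by simp), hc₁.r18]
      rfl
    · rw [hk.arr 8 (by simp) (by simp) (by simp) (by simp), a4, hA8]
    · have : (h + 1) * n = h * n + n := by ring
      simp
      omega
    · rw [hreg 0 (by simp), hc₁.r0]
    · rw [hreg 1 (by simp), hc₁.r1]
    · rw [hreg 16 (by simp), hc₁.r16]
    · rw [hreg 21 (by simp), hc₁.r21]
    · rintro c₄ ⟨i1, i2, l, l1, l2, l3, l4⟩
      have : (h + 1) * n = h * n + n := by ring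
      simp only [List.length_nil, zero_add] at l3 l4
      refine Ex.mono (final c₄ l i1 l1 (by omega)) (by omega) ?_
      rintro c₅ ⟨f1, f2, f3, f4⟩
      refine ⟨p, hp, by omega, f1, f2, ?_, ?_⟩
      · rw [f3, l2, hk.out, a7]
        simp
      · rw [f4, i2, hk.wreg 0 (by simp), a8]
        simp

end

/-- The complete query, on the machine. -/
lemma query_spec {h : ℕ} {L : Hierarchy h n} {ell : ℕ → Fin n → Fin n} {nb : Fin n → List (Fin n)}
    {A : ℕ → ℕ → ℕ} {B : ℕ → ℕ → ℝ≥0} (hO : Oracle h wt H L ell nb W N A B) (hd : Dims n W F N)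
    (hh : 1 ≤ h) (hF : 21 + 2 * h < F) (hW : (h + 1) * n * n < W) (hN : (h + 1) * n ≤ N)
    (hFW : F * N ≤ W) {X : ℕ}
    (hX : ∀ s, searchTime n nb (ball wt H s (distTo wt H (landmarks L 1) s)) ≤ X) (u v : Fin n)
    {D : Store} (hD : D = ⟨F * N, fun a => A (a / N) (a % N), fun a => B (a / N) (a % N)⟩)
    {Q : Prog} (hQ : Q = .seq (.seq (.iload 2 4) (.seq (.iop .add 6 1 4) (.iop .add 5 0 4)))
      (query h)) :
    (H.Reachable u v → ∃ (p : H.Walk u v) (τ : ℕ), IsAnswer wt H L ell 0 u v p ∧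
      D.Query W Q u v (verts p) (len wt p) τ ∧ τ ≤ 3 * X + 70 * Nat.log 2 (2 * n) +
        (120 + 20 * Nat.log 2 (2 * N)) * h + 300 + 62 * p.length) ∧
    (¬ H.Reachable u v → ∃ τ, D.Query W Q u v [] 0 τ ∧ τ ≤ 300) := by
  obtain ⟨hn, hN', hW', hF'⟩ := id hd
  have hN0 : 0 < N := by omega
  have hu := u.2
  have hv := v.2
  have hNF : N ≤ F * N := Nat.le_mul_of_pos_left N (by omega)
  subst hD hQ
  -- the first instructions load the length of the arrays and move the two vertices
  let c₀ : Cfg := ⟨fun a => if a = 0 then u else if a = 1 then v else 0, fun _ => 0, A, B, []⟩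
  obtain ⟨s₀, hs₀, hrep⟩ : ∃ s₀, Run W (F * N) (.seq (.iload 2 4) (.seq (.iop .add 6 1 4)
      (.iop .add 5 0 4))) (Store.start ⟨F * N, fun a => A (a / N) (a % N),
        fun a => B (a / N) (a % N)⟩ u v) s₀ 3 ∧ Rep N c₀ s₀ := by
    refine ⟨_, .seq _ _ _ _ _ 1 2 (.iload _ _ _ ?_) (.seq _ _ _ _ _ 1 1 (.iop _ _ _ _ _)
      (.iop _ _ _ _ _)), ⟨?_, ?_, ?_, ?_, ?_, ?_, ?_⟩⟩
    · simp [Store.start]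
      omega
    · simp [Store.start, hO.size]
    · simp [Store.start]
    · intro a
      rcases a with _ | _ | a
      · simp [Store.start, Op.eval, c₀]
        exact Nat.mod_eq_of_lt (by omega)
      · simp [Store.start, Op.eval, c₀]
        exact Nat.mod_eq_of_lt (by omega)
      · simp [Store.start, c₀]
    · simp [Store.start, c₀]
    · simp [Store.start, c₀]
    · simp [Store.start, c₀]
    · simp [Store.start, c₀]
  -- the result of the rest
  have finish : ∀ (τ : ℕ) (R : Cfg → Prop), Ex W F N (query h) c₀ τ R →
      (∀ c', R c' → c'.A = A ∧ c'.B = B) →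
      ∃ (τ' : ℕ) (c' : Cfg), R c' ∧ τ' ≤ 3 + τ ∧ Store.Query ⟨F * N, fun a => A (a / N) (a % N),
        fun a => B (a / N) (a % N)⟩ W (.seq (.seq (.iload 2 4) (.seq (.iop .add 6 1 4)
        (.iop .add 5 0 4))) (query h)) u v c'.out (c'.w 0) τ' := by
    intro τ R hE hR
    obtain ⟨s', τ', c', h1, h2, h3, h4⟩ := hE hN0 hFW s₀ hrep
    obtain ⟨e1, e2⟩ := hR c' h4
    refine ⟨3 + τ', c', h4, by omega, s', .seq _ _ _ _ _ _ _ hs₀ h1, ?_, ?_, ?_, ?_⟩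
    · rw [h3.out]
    · rw [h3.wreg]
    · rw [h3.imem, e1]
    · rw [h3.wmem, e2]
  have hok : OkAll W F N [.set 14 1, .ld 16 0 14, .set 14 2, .ld 21 0 14, .ld 2 1 0, .ld 3 1 1]
      c₀ := by
    simp [OkAll, Instr.Ok, Instr.exec, c₀]
    omega
  have hcomp := hO.comp u v
  constructor
  · intro huv
    have hready : Ready A B n u v (execAll [.set 14 1, .ld 16 0 14, .set 14 2, .ld 21 0 14,
        .ld 2 1 0, .ld 3 1 1] c₀) := by
      constructor <;> simp [execAll, Instr.exec, c₀, hO.order]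
    obtain ⟨τ, hE⟩ := queryBody_spec hO hd hh hF hW hN huv hready hX
    have hQ := Ex.seq (P := blk [.set 14 1, .ld 16 0 14, .set 14 2, .ld 21 0 14, .ld 2 1 0,
      .ld 3 1 1]) (t₁ := 4 * 6 + 1) (Ex.blk _ hok (Ex.cond (T := eq 2 3) (Q := .skip) (by simp)
      (fun _ => hE) (fun hh => by
        simp only [on_eq, execAll, Instr.exec, c₀] at hh
        simp at hh
        exact absurd (hcomp.2 huv) hh)))
    obtain ⟨τ', c', ⟨p, h1, h2, h3, h3', h4, h5⟩, h6, h7⟩ :=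
      finish _ _ hQ fun c' ⟨p, h1, h2, h3, h4, _⟩ => ⟨h3, h4⟩
    refine ⟨p, τ', h1, ?_, by omega⟩
    rwa [h4, h5] at h7
  · intro huv
    have hQ : Ex W F N (query h) c₀ (4 * 6 + 1 + (1 + 1)) (fun c' => c'.A = A ∧ c'.B = B ∧
        c'.out = [] ∧ c'.w 0 = 0) := by
      refine Ex.seq (Ex.blk _ hok (Ex.cond (by simp) (fun hh => ?_) (fun hh => Ex.skip ?_)))
      · simp only [on_eq, execAll, Instr.exec, c₀] at hh
        simp at hh
        exact absurd (hcomp.1 hh) huv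
      · simp [execAll, Instr.exec, c₀]
    obtain ⟨τ', c', ⟨h1, h2, h3, h4⟩, h5, h6⟩ := finish _ _ hQ fun _ h => ⟨h.1, h.2.1⟩
    rw [h3, h4] at h6
    exact ⟨τ', h6, by omega⟩

end Query

/-! ### Sparse spanners -/

section Spanner

variable {n : ℕ} {G H : SimpleGraph (Fin n)} {wt : Sym2 (Fin n) → ℝ≥0}

/-- The ends of an edge of a trail are joined by the rest of the trail. -/
lemma exists_split_of_mem_edges {V : Type*} {H : SimpleGraph V} {u v x y : V} (p : H.Walk u v)
    (hp : p.IsTrail) (he : s(x, y) ∈ p.edges) :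
    (∃ (q : H.Walk u x) (r : H.Walk y v), q.length + r.length + 1 = p.length ∧
        ∀ e ∈ q.edges ++ r.edges, e ∈ p.edges ∧ e ≠ s(x, y)) ∨
      ∃ (q : H.Walk u y) (r : H.Walk x v), q.length + r.length + 1 = p.length ∧
        ∀ e ∈ q.edges ++ r.edges, e ∈ p.edges ∧ e ≠ s(x, y) := by
  induction p with
  | nil => simp at he
  | @cons u w v h p ih =>
    rw [SimpleGraph.Walk.isTrail_cons] at hp
    by_cases heq : s(x, y) = s(u, w)
    · have hmem : ∀ e ∈ p.edges, e ∈ (SimpleGraph.Walk.cons h p).edges ∧ e ≠ s(x, y) :=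
        fun e he => ⟨by simp [he], fun h' => hp.2 (by rwa [← heq, ← h'])⟩
      rcases Sym2.eq_iff.1 heq with ⟨rfl, rfl⟩ | ⟨rfl, rfl⟩
      · exact .inl ⟨.nil, p, by simp, by simpa using hmem⟩
      · exact .inr ⟨.nil, p, by simp, by simpa using hmem⟩
    · have he' : s(x, y) ∈ p.edges := by
        rw [SimpleGraph.Walk.edges_cons, List.mem_cons] at he
        exact he.resolve_left heq
      rcases ih hp.1 he' with ⟨q, r, hl, hq⟩ | ⟨q, r, hl, hq⟩
      · refine .inl ⟨.cons h q, r, by simp; omega, fun e he => ?_⟩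
        simp only [SimpleGraph.Walk.edges_cons, List.cons_append, List.mem_cons] at he ⊢
        rcases he with rfl | he
        · exact ⟨.inl rfl, Ne.symm heq⟩
        · exact ⟨.inr (hq e he).1, (hq e he).2⟩
      · refine .inr ⟨.cons h q, r, by simp; omega, fun e he => ?_⟩
        simp only [SimpleGraph.Walk.edges_cons, List.cons_append, List.mem_cons] at he ⊢
        rcases he with rfl | he
        · exact ⟨.inl rfl, Ne.symm heq⟩
        · exact ⟨.inr (hq e he).1, (hq e he).2⟩

/-- The greedy spanner: the edges are processed by increasing weight, and an edge is kept if the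
edges kept so far contain no short walk between its ends. -/
lemma exists_greedy (wt : Sym2 (Fin n) → ℝ≥0) {K : ℕ} (hK : 1 ≤ K) (T : Finset (Sym2 (Fin n)))
    (hT : ∀ e ∈ T, ¬ e.IsDiag) :
    ∃ H : SimpleGraph (Fin n), H.edgeSet ⊆ T ∧ ((2 * K + 1 : ℕ) : ℕ∞) ≤ H.egirth ∧
      ∀ a b, s(a, b) ∈ T → ∃ p : H.Walk a b, p.length ≤ 2 * K - 1 ∧
        ∀ e ∈ p.edges, wt e ≤ wt s(a, b) := by
  induction T using Finset.induction_on_max_value wt with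
  | empty => exact ⟨⊥, by simp, by simp, by simp⟩
  | insert e T heT hmax ih =>
    obtain ⟨H, h1, h2, h3⟩ := ih fun e he => hT e (Finset.mem_insert_of_mem he)
    by_cases hw : ∃ a b, s(a, b) = e ∧ ∃ p : H.Walk a b, p.length ≤ 2 * K - 1
    · refine ⟨H, h1.trans (by simp), h2, fun a b hab => ?_⟩
      rcases Finset.mem_insert.1 hab with heq | hab
      · obtain ⟨x, y, hxy, p, hp⟩ := hw
        have hle : ∀ f ∈ p.edges, wt f ≤ wt s(a, b) := fun f hf => by
          rw [heq]
          exact hmax f (h1 (p.edges_subset_edgeSet hf))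
        rcases Sym2.eq_iff.1 (hxy.trans heq.symm) with ⟨rfl, rfl⟩ | ⟨rfl, rfl⟩
        · exact ⟨p, hp, hle⟩
        · exact ⟨p.reverse, by simpa using hp, by simpa using hle⟩
      · exact h3 a b hab
    · push Not at hw
      induction e with | _ x y
      have hxy : x ≠ y := by simpa using hT s(x, y) (by simp)
      have hle : H ≤ H ⊔ SimpleGraph.edge x y := le_sup_left
      have hadj : (H ⊔ SimpleGraph.edge x y).Adj x y := by simp [SimpleGraph.edge_adj, hxy]
      have hE : ∀ f ∈ (H ⊔ SimpleGraph.edge x y).edgeSet, f ≠ s(x, y) → f ∈ H.edgeSet := by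
        intro f hf hne
        rw [SimpleGraph.edgeSet_sup] at hf
        refine hf.resolve_right fun hf => hne ?_
        rw [SimpleGraph.edgeSet_edge_of_ne hxy] at hf
        exact hf
      refine ⟨H ⊔ SimpleGraph.edge x y, ?_, ?_, ?_⟩
      · intro f hf
        by_cases hne : f = s(x, y)
        · simp [hne]
        · simpa using Or.inr (h1 (hE f hf hne))
      · rw [SimpleGraph.le_egirth] at h2 ⊢
        intro a w hw'
        by_cases hmem : s(x, y) ∈ w.edges
        · by_contra hlt
          have hlt : w.length < 2 * K + 1 := by
            have := not_le.1 hlt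
            exact_mod_cast this
          have aux : ∀ {b c : Fin n} (q : (H ⊔ SimpleGraph.edge x y).Walk a b)
              (r : (H ⊔ SimpleGraph.edge x y).Walk c a), q.length + r.length + 1 = w.length →
              (∀ e ∈ q.edges ++ r.edges, e ∈ w.edges ∧ e ≠ s(x, y)) → s(c, b) = s(x, y) →
              False := by
            intro b c q r hl hq hcb
            have hmemH : ∀ e ∈ (r.append q).edges, e ∈ H.edgeSet := fun f hf => by
              refine hE f ((r.append q).edges_subset_edgeSet hf) (hq f ?_).2
              rw [SimpleGraph.Walk.edges_append, List.mem_append] at hf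
              exact List.mem_append.2 hf.symm
            have := hw c b hcb ((r.append q).transfer H hmemH)
            simp only [SimpleGraph.Walk.length_transfer, SimpleGraph.Walk.length_append] at this
            omega
          rcases exists_split_of_mem_edges w hw'.1.1 hmem with ⟨q, r, hl, hq⟩ | ⟨q, r, hl, hq⟩
          · exact aux q r hl hq Sym2.eq_swap
          · exact aux q r hl hq rfl
        · have hmemH : ∀ e ∈ w.edges, e ∈ H.edgeSet := fun f hf =>
            hE f (w.edges_subset_edgeSet hf) fun h => hmem (h ▸ hf)
          have := h2 a (w.transfer H hmemH) (hw'.transfer hmemH)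
          simpa using this
      · intro a b hab
        rcases Finset.mem_insert.1 hab with heq | hab
        · have hab' : (H ⊔ SimpleGraph.edge x y).Adj a b := by
            rw [← SimpleGraph.mem_edgeSet, heq, SimpleGraph.mem_edgeSet]
            exact hadj
          exact ⟨hab'.toWalk, by simp; omega, by simp⟩
        · obtain ⟨p, hp1, hp2⟩ := h3 a b hab
          exact ⟨p.mapLe hle, by simpa using hp1, by simpa using hp2⟩

/-- In a graph of large girth, a vertex has no two neighbours that are joined by a short walk
avoiding it. -/
lemma eq_of_adj_of_egirth {K : ℕ} (hH : ((2 * K + 1 : ℕ) : ℕ∞) ≤ H.egirth) {x y z : Fin n}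
    (hy : H.Adj x y) (hz : H.Adj x z) (p : H.Walk z y) (hx : x ∉ p.support)
    (hp : p.length + 2 ≤ 2 * K) : y = z := by
  classical
  by_contra hne
  have hcyc : (SimpleGraph.Walk.cons hy.symm (.cons hz p.bypass)).IsCycle := by
    have hx' : x ∉ p.bypass.support := fun h => hx (p.support_bypass_subset_support h)
    rw [SimpleGraph.Walk.cons_isCycle_iff, SimpleGraph.Walk.cons_isPath_iff]
    refine ⟨⟨p.bypass_isPath, hx'⟩, ?_⟩
    rw [SimpleGraph.Walk.edges_cons, List.mem_cons, not_or]
    refine ⟨fun h => hne ?_, fun h => hx' (p.bypass.snd_mem_support_of_mem_edges h)⟩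
    rcases Sym2.eq_iff.1 h with ⟨rfl, -⟩ | ⟨rfl, -⟩
    · exact absurd hy (by simp)
    · rfl
  have h1 := (SimpleGraph.le_egirth.1 hH) y _ hcyc
  have h2 := p.length_bypass_le_length
  simp only [SimpleGraph.Walk.length_cons] at h1
  have h3 : 2 * K + 1 ≤ p.bypass.length + 1 + 1 := by exact_mod_cast h1
  omega

open Classical in
/-- A graph of girth more than `2 * K` with few vertices has a vertex of small degree in every
nonempty set: otherwise the layers of a breadth first search grow by the factor `d`. -/
lemma exists_low_degree {K d : ℕ} (hK : 1 ≤ K) (hH : ((2 * K + 1 : ℕ) : ℕ∞) ≤ H.egirth)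
    (hd : n ≤ d ^ K) {S : Finset (Fin n)} (hS : S.Nonempty) :
    ∃ x ∈ S, (S.filter (H.Adj x)).card ≤ d := by
  by_contra! hdeg
  obtain ⟨r, hr⟩ := hS
  let V : ℕ → Finset (Fin n) := fun i =>
    Nat.rec (motive := fun _ => Finset (Fin n)) {r}
    (fun _ T => T ∪ S.filter fun y => ∃ x ∈ T, H.Adj x y) i
  have hV : ∀ i, V (i + 1) = V i ∪ S.filter fun y => ∃ x ∈ V i, H.Adj x y := fun i => rfl
  have hVS : ∀ i, V i ⊆ S := by
    intro i
    induction i with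
    | zero => simpa [V] using hr
    | succ i ih =>
      rw [hV]
      exact Finset.union_subset ih (Finset.filter_subset _ _)
  have hmono : ∀ i, V i ⊆ V (i + 1) := fun i => by
    rw [hV]
    exact Finset.subset_union_left
  have hr0 : ∀ i, r ∈ V i := by
    intro i
    induction i with
    | zero => simp [V]
    | succ i ih => exact hmono i ih
  have hwalk : ∀ i, ∀ y ∈ V (i + 1), ∃ p : H.Walk r y, p.length ≤ i + 1 ∧
      ∀ z ∈ p.support, z = y ∨ z ∈ V i := by
    intro i
    induction i with
    | zero =>
      intro y hy
      simp only [hV, Finset.mem_union, Finset.mem_filter] at hy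
      rcases hy with hy | ⟨-, x, hx, hxy⟩
      · obtain rfl : y = r := by simpa [V] using hy
        exact ⟨.nil, by simp, by simp⟩
      · obtain rfl : x = r := by simpa [V] using hx
        exact ⟨hxy.toWalk, by simp, by simp [V]⟩
    | succ i ih =>
      intro y hy
      rw [hV (i + 1), Finset.mem_union, Finset.mem_filter] at hy
      rcases hy with hy | ⟨-, x, hx, hxy⟩
      · obtain ⟨p, hp1, hp2⟩ := ih y hy
        exact ⟨p, by omega, fun z hz => (hp2 z hz).imp id fun h => hmono i h⟩
      · obtain ⟨p, hp1, hp2⟩ := ih x hx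
        refine ⟨p.concat hxy, by simp; omega, fun z hz => ?_⟩
        rw [SimpleGraph.Walk.support_concat, List.mem_append] at hz
        rcases hz with hz | hz
        · rcases hp2 z hz with rfl | hz
          · exact .inr hx
          · exact .inr (hmono i hz)
        · exact .inl (by simpa using hz)
  -- each vertex of a layer has at most one neighbour in the same or an earlier layer, and no two of
  -- them have a common neighbour in the next layer
  have hgrow : ∀ i, i < K → d ^ (i + 1) ≤ (V (i + 1) \ V i).card := by
    intro i
    induction i with
    | zero =>
      intro _
      refine (by simpa using (hdeg r hr).le : d ^ (0 + 1) ≤ _).trans (Finset.card_le_card ?_)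
      intro y hy
      rw [Finset.mem_filter] at hy
      rw [Finset.mem_sdiff, hV, Finset.mem_union, Finset.mem_filter]
      refine ⟨.inr ⟨hy.1, r, hr0 0, hy.2⟩, fun h => ?_⟩
      obtain rfl : y = r := by simpa [V] using h
      exact absurd hy.2 (by simp)
    | succ i ih =>
      intro hi
      have h1 : ∀ x ∈ V (i + 1) \ V i, d ≤ (S.filter (H.Adj x) \ V (i + 1)).card := by
        intro x hx
        rw [Finset.mem_sdiff] at hx
        have h2 : (S.filter (H.Adj x) ∩ V (i + 1)).card ≤ 1 := by
          rw [Finset.card_le_one]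
          intro y hy z hz
          simp only [Finset.mem_inter, Finset.mem_filter] at hy hz
          obtain ⟨p, hp1, hp2⟩ := hwalk i y hy.2
          obtain ⟨q, hq1, hq2⟩ := hwalk i z hz.2
          refine eq_of_adj_of_egirth hH hy.1.2 hz.1.2 (q.reverse.append p) (fun h => ?_) ?_
          · rw [SimpleGraph.Walk.mem_support_append_iff, SimpleGraph.Walk.support_reverse,
              List.mem_reverse] at h
            rcases h with h | h
            · exact (hq2 x h).elim hz.1.2.ne hx.2
            · exact (hp2 x h).elim hy.1.2.ne hx.2
          · simp only [SimpleGraph.Walk.length_append, SimpleGraph.Walk.length_reverse]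
            omega
        have h3 := hdeg x (hVS (i + 1) hx.1)
        have h4 := Finset.card_sdiff_add_card_inter (S.filter (H.Adj x)) (V (i + 1))
        omega
      have h2 : ((V (i + 1) \ V i) : Set (Fin n)).PairwiseDisjoint
          fun x => S.filter (H.Adj x) \ V (i + 1) := by
        intro x hx x' hx' hne
        rw [Function.onFun, Finset.disjoint_left]
        intro y hy hy'
        simp only [Finset.mem_sdiff, Finset.mem_filter] at hy hy'
        simp only [Set.mem_sdiff, Finset.mem_coe] at hx hx'
        obtain ⟨p, hp1, hp2⟩ := hwalk i x hx.1
        obtain ⟨q, hq1, hq2⟩ := hwalk i x' hx'.1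
        refine hne (eq_of_adj_of_egirth hH hy.1.2.symm hy'.1.2.symm (q.reverse.append p)
          (fun h => ?_) ?_)
        · rw [SimpleGraph.Walk.mem_support_append_iff, SimpleGraph.Walk.support_reverse,
            List.mem_reverse] at h
          rcases h with h | h
          · exact (hq2 y h).elim hy'.1.2.ne' fun h => hy.2 (hmono i h)
          · exact (hp2 y h).elim hy.1.2.ne' fun h => hy.2 (hmono i h)
        · simp only [SimpleGraph.Walk.length_append, SimpleGraph.Walk.length_reverse]
          omega
      calc d ^ (i + 1 + 1) = d ^ (i + 1) * d := pow_succ _ _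
        _ ≤ (V (i + 1) \ V i).card * d := Nat.mul_le_mul_right _ (ih (by omega))
        _ ≤ ∑ x ∈ V (i + 1) \ V i, (S.filter (H.Adj x) \ V (i + 1)).card := by
          rw [← smul_eq_mul, ← Finset.sum_const]
          exact Finset.sum_le_sum h1
        _ = ((V (i + 1) \ V i).biUnion fun x => S.filter (H.Adj x) \ V (i + 1)).card := by
          rw [Finset.card_biUnion]
          intro x hx x' hx' hne
          exact h2 (by simpa using hx) (by simpa using hx') hne
        _ ≤ _ := by
          refine Finset.card_le_card fun y hy => ?_
          simp only [Finset.mem_biUnion, Finset.mem_sdiff, Finset.mem_filter] at hy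
          obtain ⟨x, hx, hy1, hy2⟩ := hy
          rw [Finset.mem_sdiff, hV (i + 1), Finset.mem_union, Finset.mem_filter]
          exact ⟨.inr ⟨hy1.1, x, hx.1, hy1.2⟩, hy2⟩
  obtain ⟨k, rfl⟩ : ∃ k, K = k + 1 := ⟨K - 1, by omega⟩
  have h1 := hgrow k (by omega)
  have h2 : (V (k + 1) \ V k).card < (Finset.univ : Finset (Fin n)).card :=
    Finset.card_lt_card ⟨Finset.subset_univ _, fun h => by
      have := h (Finset.mem_univ r)
      rw [Finset.mem_sdiff] at this
      exact this.2 (hr0 k)⟩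
  simp only [Finset.card_univ, Fintype.card_fin] at h2
  omega

/-- The Moore bound, by removing vertices of small degree one after the other. -/
lemma ncard_edgeSet_le_of_egirth {K d : ℕ} (hK : 1 ≤ K) (hH : ((2 * K + 1 : ℕ) : ℕ∞) ≤ H.egirth)
    (hd : n ≤ d ^ K) : H.edgeSet.ncard ≤ d * n := by
  classical
  have key : ∀ S : Finset (Fin n), (S.sym2.filter (· ∈ H.edgeSet)).card ≤ d * S.card := by
    intro S
    induction hm : S.card generalizing S with
    | zero =>
      rw [Finset.card_eq_zero] at hm
      simp [hm]
    | succ m ih =>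
      obtain ⟨x, hx, hdx⟩ := exists_low_degree hK hH hd (Finset.card_pos.1 (by omega : 0 < S.card))
      have h1 := ih (S.erase x) (by rw [Finset.card_erase_of_mem hx, hm]; rfl)
      calc (S.sym2.filter (· ∈ H.edgeSet)).card
          ≤ ((S.erase x).sym2.filter (· ∈ H.edgeSet) ∪
              (S.filter (H.Adj x)).image fun y => s(x, y)).card := by
            refine Finset.card_le_card fun e he => ?_
            induction e with | _ a b
            simp only [Finset.mem_filter, Finset.mk_mem_sym2_iff, SimpleGraph.mem_edgeSet,
              Finset.mem_union, Finset.mem_erase, Finset.mem_image] at he ⊢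
            by_cases ha : a = x
            · subst ha
              exact .inr ⟨b, ⟨he.1.2, he.2⟩, rfl⟩
            by_cases hb : b = x
            · subst hb
              exact .inr ⟨a, ⟨he.1.1, he.2.symm⟩, Sym2.eq_swap⟩
            exact .inl ⟨⟨⟨ha, he.1.1⟩, hb, he.1.2⟩, he.2⟩
        _ ≤ d * m + d :=
            (Finset.card_union_le _ _).trans (Nat.add_le_add h1 (Finset.card_image_le.trans hdx))
        _ = d * (m + 1) := by ring
  have h := key Finset.univ
  rw [Finset.card_univ, Fintype.card_fin] at h
  refine le_trans (le_of_eq ?_) h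
  rw [← Set.ncard_coe_finset]
  congr 1
  ext e
  simp

/-- A walk in a graph is replaced by a walk in a spanner, edge by edge. -/
lemma isSpanner_of_edges (hHG : H ≤ G) {t : ℕ}
    (h : ∀ a b, G.Adj a b → ∃ p : H.Walk a b, p.length ≤ t ∧ ∀ e ∈ p.edges, wt e ≤ wt s(a, b))
    {t' : ℝ} (ht0 : t ≠ 0) (ht : (t : ℝ) ≤ t') : IsSpanner wt G H t' := by
  refine ⟨hHG, fun u v => ?_⟩
  have key : ∀ {u v : Fin n} (p : G.Walk u v), ∃ q : H.Walk u v, len wt q ≤ t * len wt p := by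
    intro u v p
    induction p with
    | nil => exact ⟨.nil, by simp [len]⟩
    | cons hab p ih =>
      obtain ⟨q, hq⟩ := ih
      obtain ⟨r, hr1, hr2⟩ := h _ _ hab
      refine ⟨r.append q, ?_⟩
      rw [len_append, len_cons, mul_add]
      refine add_le_add ?_ hq
      calc len wt r ≤ (r.edges.map wt).length • wt s(_, _) :=
            List.sum_le_card_nsmul _ _ fun x hx => by
              obtain ⟨e, he, rfl⟩ := List.mem_map.1 hx
              exact hr2 e he
        _ ≤ _ := by
          rw [List.length_map, SimpleGraph.Walk.length_edges, nsmul_eq_mul]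
          gcongr
  have h1 : (t : ℝ≥0∞) ≤ ENNReal.ofReal t' := by
    rw [← ENNReal.ofReal_natCast]
    exact ENNReal.ofReal_le_ofReal ht
  refine le_trans ?_ (mul_le_mul_left h1 _)
  rw [dist, dist, ENNReal.mul_iInf_of_ne (by simpa using ht0) (by simp)]
  · refine le_iInf fun p => ?_
    obtain ⟨q, hq⟩ := key p
    refine (dist_le_len q).trans ?_
    exact_mod_cast hq

/-- Sparse spanners with a given integer parameter. -/
lemma exists_spanner (wt : Sym2 (Fin n) → ℝ≥0) (G : SimpleGraph (Fin n)) {K : ℕ} (hK : 1 ≤ K)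
    (hn : 1 ≤ n) {t : ℝ} (ht : 2 * K - 1 ≤ t) :
    ∃ H : SimpleGraph (Fin n), IsSpanner wt G H t ∧
      (H.edgeSet.ncard : ℝ) ≤ 2 * (n : ℝ) ^ (1 + 1 / K : ℝ) := by
  classical
  obtain ⟨H, h1, h2, h3⟩ := exists_greedy wt hK G.edgeFinset fun e he =>
    G.not_isDiag_of_mem_edgeSet (by simpa using he)
  refine ⟨H, isSpanner_of_edges (t := 2 * K - 1) ?_ ?_ (by omega) ?_, ?_⟩
  · rw [← SimpleGraph.edgeSet_subset_edgeSet]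
    simpa using h1
  · intro a b hab
    exact h3 a b (by simpa using hab)
  · rw [Nat.cast_sub (by omega)]
    push_cast
    exact ht
  · have hn' : (1 : ℝ) ≤ n := by exact_mod_cast hn
    have hx : 1 ≤ (n : ℝ) ^ (1 / K : ℝ) := Real.one_le_rpow hn' (by positivity)
    have hceil := (Nat.ceil_lt_add_one (zero_le_one.trans hx)).le
    have := ncard_edgeSet_le_of_egirth (d := ⌈(n : ℝ) ^ (1 / K : ℝ)⌉₊) hK h2 ?_
    · calc (H.edgeSet.ncard : ℝ) ≤ ((⌈(n : ℝ) ^ (1 / K : ℝ)⌉₊ * n : ℕ) : ℝ) := by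
            exact_mod_cast this
        _ = ⌈(n : ℝ) ^ (1 / K : ℝ)⌉₊ * n := by push_cast; ring
        _ ≤ (2 * (n : ℝ) ^ (1 / K : ℝ)) * n := by gcongr; linarith
        _ = _ := by
          rw [Real.rpow_add (by linarith), Real.rpow_one]
          ring
    · have h4 : (n : ℝ) ≤ (⌈(n : ℝ) ^ (1 / K : ℝ)⌉₊ : ℝ) ^ K := by
        calc (n : ℝ) = ((n : ℝ) ^ (1 / K : ℝ)) ^ K := by
              rw [one_div, Real.rpow_inv_natCast_pow (by linarith) (by omega)]
          _ ≤ _ := by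
              gcongr
              exact Nat.le_ceil _
      exact_mod_cast h4

lemma one_le_logb {n : ℕ} (hn : 2 ≤ n) : 1 ≤ Real.logb 2 n := by
  rw [Real.le_logb_iff_rpow_le (by norm_num) (by positivity)]
  simpa using hn

lemma rpow_one_div_logb {n : ℕ} (hn : 2 ≤ n) : (n : ℝ) ^ (1 / Real.logb 2 n) = 2 := by
  have h1 := one_le_logb hn
  have hn' : (0 : ℝ) < n := by positivity
  calc (n : ℝ) ^ (1 / Real.logb 2 n) = ((2 : ℝ) ^ Real.logb 2 n) ^ (1 / Real.logb 2 n) := by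
        rw [Real.rpow_logb (by norm_num) (by norm_num) hn']
    _ = 2 := by
        rw [← Real.rpow_mul (by norm_num), mul_one_div_cancel (by linarith), Real.rpow_one]

/-- In the range between `log n / log log n` and `log n`, the parameter `k` is at least `1`. -/
lemma one_le_param {n : ℕ} (hn : 3 ≤ n) {k : ℝ}
    (hk : Real.logb 2 n / Real.logb 2 (Real.logb 2 n) ≤ k) : 1 ≤ k := by
  have h1 : 1 < Real.logb 2 n := by
    rw [Real.lt_logb_iff_rpow_lt (by norm_num) (by positivity)]
    have : (2 : ℝ) < n := by exact_mod_cast hn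
    simpa using this
  have h2 : 0 < Real.logb 2 (Real.logb 2 n) := Real.logb_pos (by norm_num) h1
  refine le_trans ?_ hk
  rw [le_div_iff₀ h2, one_mul]
  have h3 : Real.logb 2 (Real.logb 2 n) ≤ Real.logb 2 n := by
    rw [Real.logb_le_iff_le_rpow (by norm_num) (by linarith)]
    have h4 : (n : ℝ) = 2 ^ Real.logb 2 n := by
      rw [Real.rpow_logb (by norm_num) (by norm_num) (by positivity)]
    have h5 : Real.logb 2 n < 2 ^ Real.logb 2 n := by
      have h6 := one_add_mul_self_le_rpow_one_add (s := 1) (by norm_num) h1.le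
      rw [one_add_one_eq_two] at h6
      linarith
    exact h5.le
  exact h3

/-- Both parts use the spanner with the integer parameter `⌈k⌉`, where `k = log n` in the first
part and `n ^ (1 / log n) = 2`. -/
lemma spanners_exist (n : ℕ) (hn : 2 ≤ n) (G : SimpleGraph (Fin n)) (wt : Sym2 (Fin n) → ℝ≥0) :
    (∃ H : SimpleGraph (Fin n), IsSpanner wt G H (4 * Real.logb 2 n) ∧
        (H.edgeSet.ncard : ℝ) ≤ 4 * n) ∧
      (3 ≤ n → ∀ k : ℝ, Real.logb 2 n / Real.logb 2 (Real.logb 2 n) ≤ k → k ≤ Real.logb 2 n →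
        ∃ H : SimpleGraph (Fin n), IsSpanner wt G H (4 * k) ∧
          (H.edgeSet.ncard : ℝ) ≤ 4 * (n : ℝ) ^ (1 + 1 / k)) := by
  have hn' : (1 : ℝ) ≤ n := by exact_mod_cast (by omega : 1 ≤ n)
  have main : ∀ k : ℝ, 1 ≤ k → ∃ H : SimpleGraph (Fin n), IsSpanner wt G H (4 * k) ∧
      (H.edgeSet.ncard : ℝ) ≤ 2 * (n : ℝ) ^ (1 + 1 / k) := by
    intro k hk
    have hc := Nat.ceil_lt_add_one (by linarith : 0 ≤ k)
    have hc' := Nat.le_ceil k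
    obtain ⟨H, h1, h2⟩ := exists_spanner (K := ⌈k⌉₊) wt G (Nat.one_le_iff_ne_zero.2
      (Nat.ceil_pos.2 (by linarith)).ne') (by omega) (t := 4 * k) (by linarith)
    refine ⟨H, h1, h2.trans ?_⟩
    gcongr
  refine ⟨?_, fun h3 k hk _ => ?_⟩
  · obtain ⟨H, h1, h2⟩ := main _ (one_le_logb hn)
    refine ⟨H, h1, h2.trans_eq ?_⟩
    rw [Real.rpow_add (by linarith), Real.rpow_one, rpow_one_div_logb hn]
    ring
  · obtain ⟨H, h1, h2⟩ := main k (one_le_param h3 hk)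
    exact ⟨H, h1, h2.trans (by gcongr; norm_num)⟩

end Spanner

/-! ### Canonical shortest paths -/

section Canonical

variable {n : ℕ} {H : SimpleGraph (Fin n)} {wt : Sym2 (Fin n) → ℝ≥0} {u v w x y z a b c : Fin n}

/-- A perturbed weight, in lexicographic order. The second components are distinct powers of two, so
that their sum determines a set of edges. -/
noncomputable def edgeCost (wt : Sym2 (Fin n) → ℝ≥0) (e : Sym2 (Fin n)) : ℝ≥0 ×ₗ ℕ :=
  toLex (wt e, 2 ^ (Fintype.equivFin (Sym2 (Fin n)) e : ℕ))

/-- The length of a walk with respect to the perturbed weights. -/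
noncomputable def cost (wt : Sym2 (Fin n) → ℝ≥0) (p : H.Walk u v) : ℝ≥0 ×ₗ ℕ :=
  (p.edges.map (edgeCost wt)).sum

lemma cost_cons (h : H.Adj u v) (p : H.Walk v w) :
    cost wt (.cons h p) = edgeCost wt s(u, v) + cost wt p := by simp [cost]

lemma cost_append (p : H.Walk u v) (q : H.Walk v w) :
    cost wt (p.append q) = cost wt p + cost wt q := by simp [cost]

@[simp] lemma cost_reverse (p : H.Walk u v) : cost wt p.reverse = cost wt p := by
  simp [cost, List.sum_reverse]

lemma cost_eq (p : H.Walk u v) : cost wt p = toLex (len wt p,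
    (p.edges.map fun e => 2 ^ (Fintype.equivFin (Sym2 (Fin n)) e : ℕ)).sum) := by
  unfold cost len
  induction p.edges with
  | nil => rfl
  | cons e l ih => simp only [List.map_cons, List.sum_cons, ih, edgeCost]; rfl

lemma edgeCost_pos (e : Sym2 (Fin n)) : 0 < edgeCost wt e := by
  refine Prod.Lex.toLex_lt_toLex.2 ?_
  rcases eq_or_lt_of_le (zero_le : 0 ≤ wt e) with h | h
  · exact .inr ⟨h, by positivity⟩
  · exact .inl h

/-- A walk of minimal cost. -/
def Best (wt : Sym2 (Fin n) → ℝ≥0) (p : H.Walk u v) : Prop :=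
  ∀ q : H.Walk u v, cost wt p ≤ cost wt q

lemma cost_bypass_le (p : H.Walk u v) : cost wt p.bypass ≤ cost wt p ∧
    (cost wt p ≤ cost wt p.bypass → p.IsPath) := by
  obtain ⟨l, hl⟩ := p.edges_bypass_sublist_edges.exists_perm_append
  have h1 : cost wt p = cost wt p.bypass + (l.map (edgeCost wt)).sum := by
    unfold cost
    rw [(hl.map (edgeCost wt)).sum_eq]
    simp
  have h2 : ∀ l : List (Sym2 (Fin n)), 0 ≤ (l.map (edgeCost wt)).sum ∧
      ((l.map (edgeCost wt)).sum ≤ 0 → l = []) := by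
    intro l
    cases l with
    | nil => simp
    | cons e l =>
      have h3 : 0 ≤ (l.map (edgeCost wt)).sum := List.sum_nonneg fun x hx => by
        obtain ⟨e, -, rfl⟩ := List.mem_map.1 hx
        exact (edgeCost_pos e).le
      have h4 : 0 < ((e :: l).map (edgeCost wt)).sum := by
        rw [List.map_cons, List.sum_cons]
        exact add_pos_of_pos_of_nonneg (edgeCost_pos e) h3
      exact ⟨h4.le, fun h => absurd h h4.not_ge⟩
  rw [h1]
  refine ⟨le_add_of_nonneg_right (h2 l).1, fun h => ?_⟩
  have h3 : l = [] := (h2 l).2 (by simpa using h)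
  subst h3
  have h4 := hl.length_eq
  simp only [List.append_nil, SimpleGraph.Walk.length_edges] at h4
  rw [← p.bypass_eq_self_of_length_le_length_bypass h4.le]
  exact p.bypass_isPath

lemma Best.isPath {p : H.Walk u v} (hp : Best wt p) : p.IsPath := (cost_bypass_le p).2 (hp _)

lemma Best.isShortest {p : H.Walk u v} (hp : Best wt p) : IsShortest wt p := fun q => by
  have := hp q
  rw [cost_eq, cost_eq, Prod.Lex.toLex_le_toLex] at this
  exact this.elim (fun h => h.le) fun h => h.1.le

lemma exists_best (h : H.Reachable u v) : ∃ p : H.Walk u v, Best wt p := by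
  classical
  obtain ⟨p₀⟩ := h
  obtain ⟨p, -, hp⟩ := (Finset.univ : Finset (H.Path u v)).exists_min_image
    (fun p => cost wt p.1) ⟨p₀.toPath, Finset.mem_univ _⟩
  exact ⟨p.1, fun q => (hp q.toPath (Finset.mem_univ _)).trans (cost_bypass_le q).1⟩

lemma Best.reverse {p : H.Walk u v} (hp : Best wt p) : Best wt p.reverse := fun q => by
  rw [cost_reverse, ← cost_reverse q]
  exact hp _

lemma Best.left {p : H.Walk u v} {q : H.Walk v w} (h : Best wt (p.append q)) : Best wt p :=
  fun r => by
    have := h (r.append q)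
    rw [cost_append, cost_append] at this
    exact le_of_add_le_add_right this

lemma Best.right {p : H.Walk u v} {q : H.Walk v w} (h : Best wt (p.append q)) : Best wt q :=
  fun r => by
    have := h (p.append r)
    rw [cost_append, cost_append] at this
    exact le_of_add_le_add_left this

lemma Best.tail {h : H.Adj u v} {p : H.Walk v w} (hp : Best wt (.cons h p)) : Best wt p :=
  Best.right (p := h.toWalk) hp

/-- A path is determined by its set of edges. -/
lemma eq_of_edges {p q : H.Walk u v} (hp : p.IsPath) (hq : q.IsPath)
    (h : ∀ e, e ∈ p.edges ↔ e ∈ q.edges) : p = q := by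
  induction p with
  | nil => exact (SimpleGraph.Walk.isPath_iff_nil.1 hq).eq_nil.symm
  | @cons u w v huw p ih =>
    cases q with
    | nil => simpa using SimpleGraph.Walk.isPath_iff_nil.1 hp
    | @cons _ w' _ huw' q =>
      rw [SimpleGraph.Walk.cons_isPath_iff] at hp hq
      have h1 := (h s(u, w')).2 (by simp)
      rw [SimpleGraph.Walk.edges_cons, List.mem_cons] at h1
      have h2 := h1.resolve_right fun h => hp.2 (p.fst_mem_support_of_mem_edges h)
      obtain rfl := Sym2.congr_right.1 h2
      rw [ih hp.1 hq.1 fun e => ?_]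
      have he := h e
      simp only [SimpleGraph.Walk.edges_cons, List.mem_cons] at he
      by_cases heq : e = s(u, w')
      · rw [heq]
        exact ⟨fun h => absurd (p.fst_mem_support_of_mem_edges h) hp.2,
          fun h => absurd (q.fst_mem_support_of_mem_edges h) hq.2⟩
      · simpa [heq] using he

/-- Walks of minimal cost are unique: the perturbation determines the set of edges. -/
lemma Best.eq {p q : H.Walk u v} (hp : Best wt p) (hq : Best wt q) : p = q := by
  classical
  have h1 := (hp q).antisymm (hq p)
  rw [cost_eq, cost_eq] at h1
  have h2 : ∀ {p : H.Walk u v}, Best wt p →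
      (p.edges.map fun e => 2 ^ (Fintype.equivFin (Sym2 (Fin n)) e : ℕ)).sum =
      ∑ i ∈ p.edges.toFinset.image fun e => (Fintype.equivFin (Sym2 (Fin n)) e : ℕ), 2 ^ i := by
    intro p hp
    rw [Finset.sum_image fun _ _ _ _ h => (Fintype.equivFin _).injective (Fin.ext h),
      List.sum_toFinset _ hp.isPath.1.1]
  have h3 := (Prod.ext_iff.1 (toLex_inj.1 h1)).2
  simp only [h2 hp, h2 hq] at h3
  have h4 := Finset.image_injective (fun _ _ h => (Fintype.equivFin _).injective (Fin.ext h))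
    (Finset.geomSum_injective le_rfl h3)
  exact eq_of_edges hp.isPath hq.isPath fun e => by
    simpa using Finset.ext_iff.1 h4 e

/-- The vertex `b` lies on the canonical path from `x` to `y`. -/
def On (wt : Sym2 (Fin n) → ℝ≥0) (H : SimpleGraph (Fin n)) (x b y : Fin n) : Prop :=
  ∃ p : H.Walk x y, Best wt p ∧ b ∈ p.support

open Classical in
/-- The next vertex after `x` on the canonical path from `x` to `y`. -/
noncomputable def hop (wt : Sym2 (Fin n) → ℝ≥0) (H : SimpleGraph (Fin n)) (x y : Fin n) : Fin n :=
  if h : H.Reachable x y then (exists_best (wt := wt) h).choose.snd else x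

lemma Best.hop_eq {p : H.Walk x y} (hp : Best wt p) : hop wt H x y = p.snd := by
  have h : H.Reachable x y := ⟨p⟩
  rw [hop, dif_pos h, (exists_best (wt := wt) h).choose_spec.eq hp]

lemma Best.on {p : H.Walk x y} (hp : Best wt p) (hb : b ∈ p.support) : On wt H x b y := ⟨p, hp, hb⟩

lemma On.symm (h : On wt H x b y) : On wt H y b x := by
  obtain ⟨p, hp, hb⟩ := h
  exact ⟨p.reverse, hp.reverse, by simpa using hb⟩

lemma Best.exists_append {p : H.Walk x y} (hp : Best wt p) (hb : b ∈ p.support) :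
    ∃ (q : H.Walk x b) (r : H.Walk b y), p = q.append r ∧ Best wt q ∧ Best wt r := by
  obtain ⟨q, r, -, -, rfl⟩ := hp.isPath.mem_support_iff_exists_append.1 hb
  exact ⟨q, r, rfl, hp.left, hp.right⟩

lemma On.hop_eq (h : On wt H x b y) (hb : b ≠ x) : hop wt H x b = hop wt H x y := by
  obtain ⟨p, hp, hbp⟩ := h
  obtain ⟨q, r, rfl, hq, hr⟩ := hp.exists_append hbp
  rw [hp.hop_eq, hq.hop_eq]
  cases q with
  | nil => exact absurd rfl hb
  | cons h q => simp

lemma On.trans (h : On wt H x a c) (h' : On wt H a b c) : On wt H x a b ∧ On wt H x b c := by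
  obtain ⟨p, hp, ha⟩ := h
  obtain ⟨q, r, rfl, hq, hr⟩ := hp.exists_append ha
  obtain ⟨r', hr', hb⟩ := h'
  obtain rfl := hr.eq hr'
  obtain ⟨s, t, rfl, hs, ht⟩ := hr.exists_append hb
  refine ⟨?_, hp.on ?_⟩
  · rw [SimpleGraph.Walk.append_assoc] at hp
    exact hp.left.on (by simp)
  · simp

/-- Two vertices of a canonical path lie on it in one order or the other. -/
lemma On.linear (ha : On wt H x a y) (hb : On wt H x b y) :
    (On wt H x a b ∧ On wt H a b y) ∨ (On wt H x b a ∧ On wt H b a y) := by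
  obtain ⟨p, hp, ha⟩ := ha
  obtain ⟨p', hp', hb⟩ := hb
  obtain rfl := hp.eq hp'
  obtain ⟨q, r, rfl, hq, hr⟩ := hp.exists_append ha
  rw [SimpleGraph.Walk.mem_support_append_iff] at hb
  rcases hb with hb | hb
  · refine .inr ⟨hq.on hb, ?_⟩
    obtain ⟨s, t, rfl, hs, ht⟩ := hq.exists_append hb
    rw [← SimpleGraph.Walk.append_assoc] at hp
    exact hp.right.on (by simp)
  · refine .inl ⟨?_, hr.on hb⟩
    obtain ⟨s, t, rfl, hs, ht⟩ := hr.exists_append hb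
    rw [SimpleGraph.Walk.append_assoc] at hp
    exact hp.left.on (by simp)

/-- The sum of the two neighbours of `v` on the canonical path between `x` and `y`. -/
noncomputable def hopSum (wt : Sym2 (Fin n) → ℝ≥0) (H : SimpleGraph (Fin n)) (x y v : Fin n) : ℕ :=
  hop wt H v x + hop wt H v y

/-- At an inner vertex of a canonical subpath, the sum of the two neighbours depends only on the
subpath. -/
lemma hopSum_eq_of_between (hab : a ≠ b) (hcb : c ≠ b) (h : On wt H a b c) (ha : On wt H x a y)
    (hc : On wt H x c y) : hopSum wt H x y b = hop wt H b a + hop wt H b c := by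
  rcases ha.linear hc with ⟨h1, h2⟩ | ⟨h1, h2⟩
  · rw [hopSum, ← (h1.trans h).1.symm.hop_eq hab, ← (h2.symm.trans h.symm).1.symm.hop_eq hcb]
  · rw [hopSum, ← (h1.trans h.symm).1.symm.hop_eq hcb, ← (h2.symm.trans h).1.symm.hop_eq hab,
      add_comm]

/-- The two canonical paths leave a common vertex in different directions. -/
structure Differ (wt : Sym2 (Fin n) → ℝ≥0) (H : SimpleGraph (Fin n)) (x y x' y' v : Fin n) :
    Prop where
  left : On wt H x v y
  right : On wt H x' v y'
  ne : hopSum wt H x y v ≠ hopSum wt H x' y' v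

open Classical in
/-- Of three common vertices of two canonical paths, one lies between the others on the canonical
path that joins them, and this path is a subpath of both. So the two paths differ at most at the
ends of their common part. -/
lemma card_differ_le (x y x' y' : Fin n) :
    (Finset.univ.filter (Differ wt H x y x' y')).card ≤ 2 := by
  by_contra! hcard
  obtain ⟨a, b, c, ha, hb, hc, hab, hac, hbc⟩ := Finset.two_lt_card_iff.1 hcard
  simp only [Finset.mem_filter_univ] at ha hb hc
  have key : ∀ {a b c : Fin n}, Differ wt H x y x' y' a → Differ wt H x y x' y' b →
      Differ wt H x y x' y' c → a ≠ b → c ≠ b → On wt H a b c → False := by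
    intro a b c ha hb hc hab hcb h
    apply hb.ne
    rw [hopSum_eq_of_between hab hcb h ha.left hc.left,
      hopSum_eq_of_between hab hcb h ha.right hc.right]
  have order : ∀ {a b c : Fin n}, Differ wt H x y x' y' a → Differ wt H x y x' y' b →
      Differ wt H x y x' y' c → a ≠ b → a ≠ c → b ≠ c → On wt H x a b → False := by
    intro a b c ha hb hc hab hac hbc h
    rcases hb.left.linear hc.left with ⟨h1, h2⟩ | ⟨h1, h2⟩
    · exact key ha hb hc hab hbc.symm (h1.symm.trans h.symm).1.symm
    · rcases h.linear h1 with ⟨h3, h4⟩ | ⟨h3, h4⟩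
      · exact key ha hc hb hac hbc h4
      · exact key hc ha hb hac.symm hab.symm h4
  rcases ha.left.linear hb.left with ⟨h1, -⟩ | ⟨h1, -⟩
  · exact order ha hb hc hab hac hbc h1
  · exact order hb ha hc hab.symm hbc hac h1

/-! ### Trees of shortest paths to the landmarks -/

/-- A walk of minimal cost from its start to a set of vertices. -/
def BestTo (wt : Sym2 (Fin n) → ℝ≥0) (S : Finset (Fin n)) (p : H.Walk u v) : Prop :=
  v ∈ S ∧ ∀ x ∈ S, ∀ q : H.Walk u x, cost wt p ≤ cost wt q

lemma exists_bestTo {S : Finset (Fin n)} (h : distTo wt H S u < ⊤) :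
    ∃ (v : Fin n) (p : H.Walk u v), BestTo wt S p := by
  classical
  obtain ⟨x, hx, hux⟩ := distTo_lt_iff.1 h
  obtain ⟨y, -, hy⟩ := (S.filter (H.Reachable u)).attach.exists_min_image
    (fun y => cost wt (exists_best (wt := wt) (Finset.mem_filter.1 y.2).2).choose)
    ⟨⟨x, Finset.mem_filter.2 ⟨hx, dist_lt_top_iff.1 hux⟩⟩, Finset.mem_attach _ _⟩
  refine ⟨y, (exists_best (wt := wt) (Finset.mem_filter.1 y.2).2).choose,
    (Finset.mem_filter.1 y.2).1, fun z hz q => ?_⟩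
  have h1 := hy ⟨z, Finset.mem_filter.2 ⟨hz, ⟨q⟩⟩⟩ (Finset.mem_attach _ _)
  exact h1.trans ((exists_best (wt := wt) ⟨q⟩).choose_spec q)

lemma BestTo.best {S : Finset (Fin n)} {p : H.Walk u v} (hp : BestTo wt S p) : Best wt p :=
  hp.2 v hp.1

lemma BestTo.len_eq {S : Finset (Fin n)} {p : H.Walk u v} (hp : BestTo wt S p) :
    (len wt p : ℝ≥0∞) = distTo wt H S u := by
  refine le_antisymm (le_iInf₂ fun x hx => le_iInf fun q => ?_) ?_
  · have := hp.2 x hx q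
    rw [cost_eq, cost_eq, Prod.Lex.toLex_le_toLex] at this
    exact ENNReal.coe_le_coe.2 (this.elim (fun h => h.le) fun h => h.1.le)
  · exact (distTo_le hp.1).trans (dist_le_len p)

open Classical in
/-- The pointers towards the nearest vertices of `S`. -/
noncomputable def pointer (wt : Sym2 (Fin n) → ℝ≥0) (H : SimpleGraph (Fin n)) (S : Finset (Fin n))
    (u : Fin n) : ℕ :=
  if h : distTo wt H S u < ⊤ then
    let p := (exists_bestTo h).choose_spec.choose
    if p.length = 0 then 0 else p.snd + 1
  else 0

lemma pointer_le (S : Finset (Fin n)) (u : Fin n) : pointer wt H S u ≤ n := by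
  unfold pointer
  split_ifs with h
  · dsimp only
    split_ifs
    · exact Nat.zero_le _
    · exact (Fin.is_lt _)
  · exact Nat.zero_le _

/-- The pointers need not lead along the walk that was chosen at `u`, but each step decreases the
remaining cost by that of the edge; the second component of the cost bounds the number of steps,
also if there are edges of weight `0`. -/
lemma exists_follows_bestTo {S : Finset (Fin n)} (f : ℕ → ℕ)
    (hf : ∀ v : Fin n, f v = pointer wt H S v)
    (h : distTo wt H S u < ⊤) : ∃ (v : Fin n) (p : H.Walk u v), BestTo wt S p ∧ Follows f p := by
  have key : ∀ (k : ℕ) (u : Fin n), (∃ (v : Fin n) (p : H.Walk u v), BestTo wt S p ∧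
      (p.edges.map fun e => 2 ^ (Fintype.equivFin (Sym2 (Fin n)) e : ℕ)).sum < k) →
      ∃ (v : Fin n) (p : H.Walk u v), BestTo wt S p ∧ Follows f p := by
    intro k
    induction k with
    | zero => rintro u ⟨v, p, -, hp⟩; omega
    | succ k ih =>
      rintro u ⟨v, p, hp, hk⟩
      have hu : distTo wt H S u < ⊤ := by
        rw [← hp.len_eq]
        exact ENNReal.coe_lt_top
      have hfu := hf u
      rw [pointer, dif_pos hu] at hfu
      have hp' := (exists_bestTo hu).choose_spec.choose_spec
      have hcost := (hp.2 _ hp'.1 (exists_bestTo hu).choose_spec.choose).antisymm (hp'.2 _ hp.1 p)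
      dsimp only at hfu
      generalize (exists_bestTo hu).choose_spec.choose = q at *
      generalize (exists_bestTo hu).choose = x at *
      rw [cost_eq, cost_eq] at hcost
      have hsnd := (Prod.ext_iff.1 (toLex_inj.1 hcost)).2
      simp only at hsnd
      rw [hsnd] at hk
      cases q with
      | nil => exact ⟨_, .nil, hp', by simpa [Follows] using hfu⟩
      | @cons _ w _ huw q =>
        have hq : BestTo wt S q := ⟨hp'.1, fun y hy r => by
          have := hp'.2 y hy (.cons huw r)
          rw [cost_cons, cost_cons] at this
          exact le_of_add_le_add_left this⟩
        obtain ⟨y, r, hr, hr'⟩ := ih w ⟨_, q, hq, by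
          rw [SimpleGraph.Walk.edges_cons, List.map_cons, List.sum_cons] at hk
          have : 0 < 2 ^ (Fintype.equivFin (Sym2 (Fin n)) s(u, w) : ℕ) := by positivity
          omega⟩
        refine ⟨y, .cons huw r, ⟨hr.1, fun z hz t => ?_⟩, ?_, hr'⟩
        · refine le_trans ?_ (hp'.2 z hz t)
          rw [cost_cons, cost_cons]
          exact add_le_add_right (hr.2 _ hp'.1 q) _
        · simpa using hfu
  obtain ⟨v, p, hp⟩ := exists_bestTo h
  exact key _ u ⟨v, p, hp, Nat.lt_succ_self _⟩

open Classical in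
/-- The nearest vertex of `S`, to which the pointers lead. -/
noncomputable def nearest (wt : Sym2 (Fin n) → ℝ≥0) (H : SimpleGraph (Fin n)) (S : Finset (Fin n))
    (u : Fin n) : Fin n :=
  if h : distTo wt H S u < ⊤ then
    (exists_follows_bestTo (fun x => if hx : x < n then pointer wt H S ⟨x, hx⟩ else 0)
      (fun v => by simp) h).choose
  else u

lemma exists_follows_nearest {S : Finset (Fin n)} (f : ℕ → ℕ)
    (hf : ∀ v : Fin n, f v = pointer wt H S v) (h : distTo wt H S u < ⊤) :
    ∃ p : H.Walk u (nearest wt H S u), BestTo wt S p ∧ Follows f p := by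
  rw [nearest, dif_pos h]
  obtain ⟨p, hp, hp'⟩ := (exists_follows_bestTo (fun x => if hx : x < n then
    pointer wt H S ⟨x, hx⟩ else 0) (fun v => by simp) h).choose_spec
  exact ⟨p, hp, follows_congr p (fun x _ => by simp [hf x]) hp'⟩

/-! ### The encoding of a canonical path -/

/-- The entries in the list for a path: the second vertex (if `first` holds), and the successors of
the vertices in `bad`. -/
def entries (bad : Fin n → Bool) : Bool → {u v : Fin n} → H.Walk u v → List ℕ
  | _, _, _, .nil => []
  | first, _, _, .cons (v := w) _ p =>
    if first then (w : ℕ) :: entries bad (bad w) p else entries bad (bad w) p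

lemma length_entries_le (bad : Fin n → Bool) (first : Bool) (p : H.Walk u v) :
    (entries bad first p).length ≤ (if first then 1 else 0) +
      (p.support.tail.filter fun x => bad x).length := by
  induction p generalizing first with
  | nil => simp [entries]
  | @cons u w v h p ih =>
    have := ih (bad w)
    have h2 : (p.support.filter fun x => bad x).length =
        (if bad w then 1 else 0) + (p.support.tail.filter fun x => bad x).length := by
      cases p <;> (simp [List.filter_cons]; split_ifs <;> simp [add_comm])
    rw [SimpleGraph.Walk.support_cons, List.tail_cons, h2]
    unfold entries
    split_ifs <;> simp_all <;> omega

/-- The list of entries and the numbers `sum` encode a canonical path. The argument `first` tells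
whether the next vertex has to be read from the list, because `u` is the start of the whole path or
a vertex in `bad`. -/
lemma traced_entries {N : ℕ} {sum lst : ℕ → ℕ} {bad : Fin n → Bool}
    (hbad : ∀ z : Fin n, sum z = 0 ↔ bad z) (p : H.Walk u v) (hp : Best wt p)
    (hsum : ∀ z ∈ p.support, z ≠ u → z ≠ v → ¬ bad z → sum z = hopSum wt H u v z) (first : Bool)
    {s y i : ℕ} (hs : s = 0 ↔ first) (hs' : ¬ first → u ≠ v → s = y + hop wt H u v)
    (hi : i + (entries bad first p).length ≤ N)
    (hlst : ∀ k e, (entries bad first p)[k]? = some e → lst (i + k) = e) :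
    Traced N sum lst s y i p := by
  induction p generalizing first s y i with
  | nil => trivial
  | @cons u w v h p ih =>
    have huv : u ≠ v := by
      rintro rfl
      simpa using SimpleGraph.Walk.isPath_iff_nil.1 hp.isPath
    have hu : u ∉ p.support := ((SimpleGraph.Walk.cons_isPath_iff _ _).1 hp.isPath).2
    have hhop : hop wt H u v = w := by simpa using hp.hop_eq
    have hback : ∀ z ∈ p.support, On wt H u w z := by
      intro z hz
      obtain ⟨q, r, rfl, hq, hr⟩ := hp.tail.exists_append hz
      exact Best.on (p := .cons h q) (Best.left (q := r) hp) (by simp)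
    have hsum' : ∀ z ∈ p.support, z ≠ w → z ≠ v → ¬ bad z → sum z = hopSum wt H w v z := by
      intro z hz hzw hzv hbz
      rw [hsum z (by simp [hz]) (fun h => hu (h ▸ hz)) hzv hbz, hopSum, hopSum,
        (hback z hz).symm.hop_eq (Ne.symm hzw)]
    have hsw : ¬ bad w → w ≠ v → sum w = u + hop wt H w v := by
      intro hbw hwv
      rw [hsum w (by simp) h.ne' hwv hbw, hopSum]
      have : Best wt h.toWalk := Best.left (q := p) hp
      simp [this.reverse.hop_eq]
    cases first with
    | true =>
      have hs0 : s = 0 := by simpa using hs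
      simp only [entries, if_true, List.length_cons] at hi hlst
      rw [Traced, if_pos hs0]
      refine ⟨by omega, by simpa using hlst 0 w (by simp), ih hp.tail hsum' (bad w) (hbad w) hsw
        (by omega) fun k e hk => ?_⟩
      have := hlst (k + 1) e (by simpa using hk)
      rwa [← add_assoc, add_right_comm] at this
    | false =>
      have hs0 : s ≠ 0 := by simpa using hs
      simp only [entries, Bool.false_eq_true, if_false] at hi hlst
      rw [Traced, if_neg hs0]
      refine ⟨?_, ih hp.tail hsum' (bad w) (hbad w) hsw hi hlst⟩
      rw [hs' (by simp) huv, hhop]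
      omega

end Canonical

/-! ### The stored paths -/

section Stored

variable {n h : ℕ} {H : SimpleGraph (Fin n)} {wt : Sym2 (Fin n) → ℝ≥0} {u v w x y z a b c : Fin n}

/-- The landmarks that bound the balls around the `j`-landmarks; there are none at the top level. -/
def upper (L : Hierarchy h n) (j : ℕ) : Finset (Fin n) := if j < h then landmarks L (j + 1) else ∅

/-- The `j`-landmarks closer to `c` than the `(j + 1)`-landmarks. -/
noncomputable def near (wt : Sym2 (Fin n) → ℝ≥0) (H : SimpleGraph (Fin n)) (L : Hierarchy h n)
    (j : ℕ) (c : Fin n) : Finset (Fin n) :=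
  landmarks L j ∩ ball wt H c (distTo wt H (upper L j) c)

/-- The sum of the cubes of the numbers of `j`-landmarks in the balls around `j`-landmarks. It
bounds the size of the data for the stored paths of level `j`. -/
noncomputable def cube (wt : Sym2 (Fin n) → ℝ≥0) (H : SimpleGraph (Fin n)) (L : Hierarchy h n)
    (j : ℕ) : ℕ :=
  ∑ c ∈ landmarks L j, (near wt H L j c).card ^ 3

open Classical in
/-- The pairs of `j`-landmarks whose canonical path is stored. -/
noncomputable def stored (wt : Sym2 (Fin n) → ℝ≥0) (H : SimpleGraph (Fin n)) (L : Hierarchy h n)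
    (j : ℕ) : Finset (Fin n × Fin n) :=
  Finset.univ.filter fun π => π.1 ∈ landmarks L j ∧ π.2 ∈ landmarks L j ∧ H.Reachable π.1 π.2 ∧
    Stops wt H L j π.1 π.2

open Classical in
/-- The vertices where two of the stored paths of level `j` branch. -/
noncomputable def branches (wt : Sym2 (Fin n) → ℝ≥0) (H : SimpleGraph (Fin n)) (L : Hierarchy h n)
    (j : ℕ) (v : Fin n) : Bool :=
  decide (∃ π ∈ stored wt H L j, ∃ π' ∈ stored wt H L j, Differ wt H π.1 π.2 π'.1 π'.2 v)

open Classical in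
/-- The sum of the two neighbours of `v` on the stored paths of level `j` through `v`, if this
number is the same for all of them, and `0` otherwise. Where no stored path needs the number, it is
`1`, as `0` means that the next vertex is read from a list. -/
noncomputable def traceSum (wt : Sym2 (Fin n) → ℝ≥0) (H : SimpleGraph (Fin n)) (L : Hierarchy h n)
    (j : ℕ) (v : Fin n) : ℕ :=
  if branches wt H L j v then 0
  else if h : ∃ π ∈ stored wt H L j, On wt H π.1 v π.2 ∧ v ≠ π.1 ∧ v ≠ π.2 then
    hopSum wt H h.choose.1 h.choose.2 v
  else 1

lemma hopSum_pos (h : On wt H x v y) (hy : v ≠ y) : hopSum wt H x y v ≠ 0 := by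
  obtain ⟨p, hp, hv⟩ := h
  obtain ⟨q, r, rfl, hq, hr⟩ := hp.exists_append hv
  rw [hopSum, hq.reverse.hop_eq, hr.hop_eq]
  have h1 : q.reverse.snd ∈ q.support := by
    simp
  have h2 : r.snd ≠ v := by
    cases r with
    | nil => exact absurd rfl hy
    | cons h t => simpa using h.ne'
  have h3 := hp.isPath.ne_of_mem_support_of_append h2 h1 (r.getVert_mem_support 1)
  intro h0
  apply h3
  ext
  omega

lemma traceSum_eq_zero_iff (L : Hierarchy h n) (j : ℕ) (v : Fin n) :
    traceSum wt H L j v = 0 ↔ branches wt H L j v := by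
  unfold traceSum
  split_ifs with h1 h2
  · simp [h1]
  · simp only [h1]
    obtain ⟨-, h3, -, h5⟩ := h2.choose_spec
    simpa using hopSum_pos h3 h5
  · simp [h1]

lemma traceSum_lt (L : Hierarchy h n) (j : ℕ) (v : Fin n) : traceSum wt H L j v < 2 * n := by
  have := v.2
  unfold traceSum
  split_ifs with h1 h2
  · omega
  · unfold hopSum
    omega
  · omega

lemma traceSum_eq {L : Hierarchy h n} {j : ℕ} (hxy : (x, y) ∈ stored wt H L j) (hv : On wt H x v y)
    (hx : v ≠ x) (hy : v ≠ y) (hb : ¬ branches wt H L j v) :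
    traceSum wt H L j v = hopSum wt H x y v := by
  have h2 : ∃ π ∈ stored wt H L j, On wt H π.1 v π.2 ∧ v ≠ π.1 ∧ v ≠ π.2 := ⟨_, hxy, hv, hx, hy⟩
  classical
  rw [traceSum, if_neg hb, dif_pos h2]
  by_contra hne
  apply hb
  rw [branches, decide_eq_true_eq]
  exact ⟨_, h2.choose_spec.1, _, hxy, h2.choose_spec.2.1, hv, hne⟩

/-- The list entries for the canonical path from `x` to `y`, as a path of level `j`. -/
noncomputable def pathEntries (wt : Sym2 (Fin n) → ℝ≥0) (H : SimpleGraph (Fin n))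
    (L : Hierarchy h n) (j : ℕ) {x y : Fin n} (h : H.Reachable x y) : List ℕ :=
  entries (branches wt H L j) true (exists_best (wt := wt) h).choose

lemma lt_of_mem_entries {bad : Fin n → Bool} {first : Bool} {p : H.Walk u v} {e : ℕ}
    (he : e ∈ entries bad first p) : e < n := by
  induction p generalizing first with
  | nil => simp [entries] at he
  | @cons u w v h p ih =>
    unfold entries at he
    split_ifs at he
    · rcases List.mem_cons.1 he with rfl | he
      · exact w.2
      · exact ih he
    · exact ih he

lemma dist_le_of_on (h : On wt H x v y) : dist wt H x v ≤ dist wt H x y ∧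
    dist wt H v y ≤ dist wt H x y := by
  obtain ⟨p, hp, hv⟩ := h
  obtain ⟨q, r, rfl, -, -⟩ := hp.exists_append hv
  rw [← hp.isShortest.len_eq, len_append]
  exact ⟨(dist_le_len q).trans (by simp), (dist_le_len r).trans (by simp)⟩

/-- At the top level, the distance to the empty set is infinite. -/
lemma stops_radius {L : Hierarchy h n} {j : ℕ} (hj : j ∈ Finset.Icc 1 h) (hr : H.Reachable x y)
    (hs : Stops wt H L j x y) : 3 * dist wt H x y < distTo wt H (upper L j) x ∨
      3 * dist wt H x y < distTo wt H (upper L j) y := by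
  rw [Finset.mem_Icc] at hj
  unfold Stops at hs
  rw [if_neg (by omega)] at hs
  unfold upper
  split_ifs at hs ⊢ with h1 h2 h2
  · omega
  · have h3 : ∀ a b : ℝ≥0∞, a < b / 3 → 3 * a < b := fun a b hab => by
      rw [mul_comm]
      exact ENNReal.lt_div_iff_mul_lt (by simp) (by simp) |>.1 hab
    rw [dist_comm y x] at hs
    exact hs.imp (h3 _ _) (h3 _ _)
  · left
    simpa [distTo] using ENNReal.mul_lt_top (by simp) (dist_lt_top_iff.2 hr)
  · omega

/-- If the paths of two stored pairs meet, then the four landmarks are close to one of them. -/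
lemma exists_center {L : Hierarchy h n} {j : ℕ} (hj : j ∈ Finset.Icc 1 h) {π π' : Fin n × Fin n}
    (h1 : π ∈ stored wt H L j) (h2 : π' ∈ stored wt H L j) (hz : On wt H π.1 z π.2)
    (hz' : On wt H π'.1 z π'.2) : ∃ c, (c = π.1 ∨ c = π.2 ∨ c = π'.1 ∨ c = π'.2) ∧
      π.1 ∈ near wt H L j c ∧ π.2 ∈ near wt H L j c ∧ π'.1 ∈ near wt H L j c ∧
      π'.2 ∈ near wt H L j c := by
  have key : ∀ {x y x' y' : Fin n}, (x, y) ∈ stored wt H L j → (x', y') ∈ stored wt H L j →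
      On wt H x z y → On wt H x' z y' → dist wt H x' y' ≤ dist wt H x y →
      ∃ c, (c = x ∨ c = y) ∧ x ∈ near wt H L j c ∧ y ∈ near wt H L j c ∧ x' ∈ near wt H L j c ∧
        y' ∈ near wt H L j c := by
    intro x y x' y' h1 h2 hz hz' hle
    simp only [stored, Finset.mem_filter_univ] at h1 h2
    obtain ⟨a1, a2, a3, a4⟩ := h1
    obtain ⟨b1, b2, b3, b4⟩ := h2
    have hz1 := dist_le_of_on hz
    have hz2 := dist_le_of_on hz'
    have hnear : ∀ c, (c = x ∨ c = y) → 3 * dist wt H x y < distTo wt H (upper L j) c →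
        ∀ w, w ∈ landmarks L j → dist wt H w z ≤ dist wt H x y → w ∈ near wt H L j c := by
      intro c hc hr w hw hwz
      simp only [near, ball, Finset.mem_inter, hw, true_and, Finset.mem_filter_univ]
      refine lt_of_le_of_lt ?_ hr
      have hzc : dist wt H z c ≤ dist wt H x y := by
        rcases hc with rfl | rfl
        · rw [dist_comm]
          exact hz1.1
        · exact hz1.2
      calc dist wt H w c ≤ dist wt H w z + dist wt H z c := dist_triangle _ _ _
        _ ≤ dist wt H x y + dist wt H x y := add_le_add hwz hzc
        _ = 2 * dist wt H x y := (two_mul _).symm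
        _ ≤ 3 * dist wt H x y := by gcongr; norm_num
    have hall : ∀ c, (c = x ∨ c = y) → 3 * dist wt H x y < distTo wt H (upper L j) c →
        x ∈ near wt H L j c ∧ y ∈ near wt H L j c ∧ x' ∈ near wt H L j c ∧
        y' ∈ near wt H L j c := fun c hc hr =>
      ⟨hnear c hc hr x a1 hz1.1, hnear c hc hr y a2 (by rw [dist_comm]; exact hz1.2),
        hnear c hc hr x' b1 (hz2.1.trans hle),
        hnear c hc hr y' b2 (by rw [dist_comm]; exact hz2.2.trans hle)⟩
    rcases stops_radius hj a3 a4 with hr | hr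
    · exact ⟨x, .inl rfl, hall x (.inl rfl) hr⟩
    · exact ⟨y, .inr rfl, hall y (.inr rfl) hr⟩
  rcases le_total (dist wt H π'.1 π'.2) (dist wt H π.1 π.2) with hle | hle
  · obtain ⟨c, hc, h⟩ := key h1 h2 hz hz' hle
    exact ⟨c, by tauto, h⟩
  · obtain ⟨c, hc, h3, h4, h5, h6⟩ := key h2 h1 hz' hz hle
    exact ⟨c, by tauto, h5, h6, h3, h4⟩

open Classical in
/-- The pairs of stored pairs whose paths meet. -/
noncomputable def meeting (wt : Sym2 (Fin n) → ℝ≥0) (H : SimpleGraph (Fin n)) (L : Hierarchy h n)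
    (j : ℕ) : Finset ((Fin n × Fin n) × (Fin n × Fin n)) :=
  (stored wt H L j ×ˢ stored wt H L j).filter fun π =>
    ∃ z, On wt H π.1.1 z π.1.2 ∧ On wt H π.2.1 z π.2.2

/-- Two stored pairs whose paths meet are four landmarks; one of them is the centre of a ball that
contains the other three. -/
lemma card_meeting_le {L : Hierarchy h n} {j : ℕ} (hj : j ∈ Finset.Icc 1 h) :
    (meeting wt H L j).card ≤ 4 * cube wt H L j := by
  classical
  let T : Finset ((c : Fin n) × (Fin n × Fin n × Fin n)) := (landmarks L j).sigma fun c =>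
    near wt H L j c ×ˢ (near wt H L j c ×ˢ near wt H L j c)
  have hT : T.card = cube wt H L j := by
    rw [Finset.card_sigma, cube]
    refine Finset.sum_congr rfl fun c _ => ?_
    rw [Finset.card_product, Finset.card_product]
    ring
  have hsub : meeting wt H L j ⊆ T.image (fun t => ((t.1, t.2.1), t.2.2.1, t.2.2.2)) ∪
      (T.image (fun t => ((t.2.1, t.1), t.2.2.1, t.2.2.2)) ∪
      (T.image (fun t => ((t.2.1, t.2.2.1), t.1, t.2.2.2)) ∪
      T.image (fun t => ((t.2.1, t.2.2.1), t.2.2.2, t.1)))) := by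
    rintro ⟨⟨x, y⟩, x', y'⟩ hπ
    simp only [meeting, Finset.mem_filter, Finset.mem_product] at hπ
    obtain ⟨⟨h1, h2⟩, z, hz, hz'⟩ := hπ
    obtain ⟨c, hc, a1, a2, a3, a4⟩ := exists_center hj h1 h2 hz hz'
    have hcL : c ∈ landmarks L j := by
      rcases hc with rfl | rfl | rfl | rfl
      exacts [(Finset.mem_inter.1 a1).1, (Finset.mem_inter.1 a2).1, (Finset.mem_inter.1 a3).1,
        (Finset.mem_inter.1 a4).1]
    have hmem : ∀ p q r, p ∈ near wt H L j c → q ∈ near wt H L j c → r ∈ near wt H L j c →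
        (⟨c, p, q, r⟩ : (c : Fin n) × (Fin n × Fin n × Fin n)) ∈ T := fun p q r hp hq hr => by
      simp [T, hcL, hp, hq, hr]
    simp only [Finset.mem_union, Finset.mem_image]
    rcases hc with rfl | rfl | rfl | rfl
    · exact .inl ⟨_, hmem _ _ _ a2 a3 a4, rfl⟩
    · exact .inr (.inl ⟨_, hmem _ _ _ a1 a3 a4, rfl⟩)
    · exact .inr (.inr (.inl ⟨_, hmem _ _ _ a1 a2 a4, rfl⟩))
    · exact .inr (.inr (.inr ⟨_, hmem _ _ _ a1 a2 a3, rfl⟩))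
  calc (meeting wt H L j).card ≤ T.card + (T.card + (T.card + T.card)) := by
        refine (Finset.card_le_card hsub).trans ((Finset.card_union_le _ _).trans (Nat.add_le_add
          Finset.card_image_le ((Finset.card_union_le _ _).trans (Nat.add_le_add
          Finset.card_image_le ((Finset.card_union_le _ _).trans (Nat.add_le_add
          Finset.card_image_le Finset.card_image_le))))))
    _ = 4 * cube wt H L j := by rw [hT]; ring

/-- A stored path meets itself. -/
lemma card_stored_le {L : Hierarchy h n} {j : ℕ} (hj : j ∈ Finset.Icc 1 h) :
    (stored wt H L j).card ≤ 4 * cube wt H L j := by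
  classical
  refine le_trans ?_ (card_meeting_le hj)
  refine Finset.card_le_card_of_injOn (fun π => (π, π)) (fun π hπ => ?_) fun _ _ _ _ h =>
    (Prod.ext_iff.1 h).1
  have hπ' : π ∈ stored wt H L j := hπ
  simp only [meeting, Finset.coe_filter, Finset.mem_product, Set.mem_ofPred_eq, hπ', true_and]
  simp only [stored, Finset.mem_filter_univ] at hπ'
  obtain ⟨p, hp⟩ := exists_best (wt := wt) hπ'.2.2.1
  exact ⟨π.1, hp.on (by simp), hp.on (by simp)⟩

/-- The lists for the stored paths are short, as two paths branch at most twice. -/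
lemma sum_length_pathEntries_le {L : Hierarchy h n} {j : ℕ} (hj : j ∈ Finset.Icc 1 h)
    (f : Fin n × Fin n → ℕ) (hf : ∀ π ∈ stored wt H L j, ∃ hr : H.Reachable π.1 π.2,
      f π = (pathEntries wt H L j hr).length) :
    ∑ π ∈ stored wt H L j, f π ≤ 12 * cube wt H L j := by
  classical
  have h1 : ∀ π ∈ stored wt H L j, f π ≤ 1 + ∑ π' ∈ stored wt H L j,
      2 * if (π, π') ∈ meeting wt H L j then 1 else 0 := by
    intro π hπ
    obtain ⟨hr, hfπ⟩ := hf π hπ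
    rw [hfπ]
    have hp := (exists_best (wt := wt) hr).choose_spec
    refine (length_entries_le _ _ _).trans (Nat.add_le_add (by simp) ?_)
    set p := (exists_best (wt := wt) hr).choose
    have hnd : (p.support.tail.filter fun x => branches wt H L j x).Nodup :=
      (hp.isPath.support_nodup.sublist (List.tail_sublist _)).filter _
    rw [← List.toFinset_card_of_nodup hnd]
    calc _ ≤ ((stored wt H L j).biUnion fun π' =>
          Finset.univ.filter (Differ wt H π.1 π.2 π'.1 π'.2)).card := by
          refine Finset.card_le_card fun z hz => ?_
          rw [List.mem_toFinset, List.mem_filter] at hz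
          have hz1 : On wt H π.1 z π.2 := hp.on (List.mem_of_mem_tail hz.1)
          have hz2 := hz.2
          rw [branches, decide_eq_true_eq] at hz2
          obtain ⟨π₁, h1, π₂, h2, hd⟩ := hz2
          rw [Finset.mem_biUnion]
          by_cases heq : hopSum wt H π.1 π.2 z = hopSum wt H π₁.1 π₁.2 z
          · exact ⟨π₂, h2, by simpa using ⟨hz1, hd.right, fun h => hd.ne (heq.symm.trans h)⟩⟩
          · exact ⟨π₁, h1, by simpa using ⟨hz1, hd.left, heq⟩⟩
      _ ≤ ∑ π' ∈ stored wt H L j, (Finset.univ.filter (Differ wt H π.1 π.2 π'.1 π'.2)).card :=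
          Finset.card_biUnion_le
      _ ≤ _ := by
          refine Finset.sum_le_sum fun π' hπ' => ?_
          split_ifs with hm
          · simpa using card_differ_le π.1 π.2 π'.1 π'.2
          · rw [mul_zero, Nat.le_zero, Finset.card_eq_zero, Finset.filter_eq_empty_iff]
            intro z _ hd
            exact hm (by simpa [meeting, hπ, hπ'] using ⟨z, hd.left, hd.right⟩)
  calc ∑ π ∈ stored wt H L j, f π ≤ (stored wt H L j).card + 2 * (meeting wt H L j).card := by
        refine (Finset.sum_le_sum h1).trans_eq ?_
        have h2 : meeting wt H L j = (stored wt H L j ×ˢ stored wt H L j).filter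
            (· ∈ meeting wt H L j) := by
          ext π
          simp [meeting]
        rw [Finset.sum_add_distrib, ← Finset.card_eq_sum_ones, ← Finset.sum_product',
          ← Finset.mul_sum, ← Finset.card_filter, ← h2]
    _ ≤ 4 * cube wt H L j + 2 * (4 * cube wt H L j) :=
        Nat.add_le_add (card_stored_le hj) (Nat.mul_le_mul_left _ (card_meeting_le hj))
    _ = 12 * cube wt H L j := by ring

lemma cube_le (L : Hierarchy h n) (j : ℕ) : cube wt H L j ≤ n ^ 4 := by
  have hc : ∀ S : Finset (Fin n), S.card ≤ n := fun S => S.card_le_univ.trans_eq (by simp)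
  calc cube wt H L j ≤ (landmarks L j).card • n ^ 3 :=
        Finset.sum_le_card_nsmul _ _ _ fun c _ => Nat.pow_le_pow_left (hc _) _
    _ ≤ n * n ^ 3 := Nat.mul_le_mul_right _ (hc _)
    _ = n ^ 4 := by ring

end Stored

/-! ### The contents of the memory -/

section Concatenation

variable {α : Type*} (l : ℕ → List α)

/-- The concatenation of the first `k` lists. -/
def joined (k : ℕ) : List α := (List.range k).flatMap l

lemma joined_succ (k : ℕ) : joined l (k + 1) = joined l k ++ l k := by
  simp [joined, List.range_succ]

lemma length_joined (k : ℕ) : (joined l k).length = ∑ i ∈ Finset.range k, (l i).length := by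
  induction k with
  | zero => simp [joined]
  | succ k ih => rw [joined_succ, List.length_append, ih, Finset.sum_range_succ]

lemma getElem?_joined {i k t : ℕ} (hi : i < k) {e : α} (he : (l i)[t]? = some e) :
    (joined l k)[(joined l i).length + t]? = some e := by
  induction k with
  | zero => omega
  | succ k ih =>
    rw [joined_succ]
    rcases Nat.lt_succ_iff_lt_or_eq.1 hi with h | rfl
    · rw [List.getElem?_append_left]
      · exact ih h
      · by_contra hlt
        have := ih h
        rw [List.getElem?_eq_none (not_lt.1 hlt)] at this
        simp at this
    · rw [List.getElem?_append_right (by omega)]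
      simpa using he

lemma length_joined_mono {i k : ℕ} (h : i ≤ k) : (joined l i).length ≤ (joined l k).length := by
  rw [length_joined, length_joined]
  exact Finset.sum_le_sum_of_subset (Finset.range_subset_range.2 h)

end Concatenation

section Memory

variable {n h : ℕ} {H : SimpleGraph (Fin n)} {wt : Sym2 (Fin n) → ℝ≥0} {u v w x y z a b c : Fin n}

/-- An array with an entry for every vertex. -/
def ext {α : Type*} [Zero α] (g : Fin n → α) (x : ℕ) : α := if h : x < n then g ⟨x, h⟩ else 0

@[simp] lemma ext_val {α : Type*} [Zero α] (g : Fin n → α) (x : Fin n) : ext g x = g x := by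
  simp [ext]

lemma ext_induction {α : Type*} [Zero α] (g : Fin n → α) {P : α → Prop} (h0 : P 0)
    (h : ∀ x, P (g x)) (x : ℕ) : P (ext g x) := by
  unfold ext
  split_ifs
  · exact h _
  · exact h0

lemma getD_induction {α : Type*} (l : List α) (d : α) {P : α → Prop} (h0 : P d)
    (h : ∀ x ∈ l, P x) (i : ℕ) : P (l.getD i d) := by
  rcases lt_or_ge i l.length with hi | hi
  · rw [List.getD_eq_getElem _ _ hi]
    exact h _ (List.getElem_mem hi)
  · rw [List.getD_eq_default _ _ hi]
    exact h0

open Classical in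
/-- The list of the neighbours of a vertex. -/
noncomputable def neighbours (H : SimpleGraph (Fin n)) (x : Fin n) : List (Fin n) :=
  (Finset.univ.filter (H.Adj x)).toList

lemma mem_neighbours : y ∈ neighbours H x ↔ H.Adj x y := by simp [neighbours]

lemma length_neighbours (x : Fin n) : (neighbours H x).length = (H.neighborSet x).ncard := by
  classical
  rw [neighbours, Finset.length_toList, ← Set.ncard_coe_finset]
  congr 1
  ext y
  simp

lemma sum_length_neighbours : ∑ x, (neighbours H x).length = 2 * H.edgeSet.ncard := by
  classical
  have h1 := H.sum_degrees_eq_twice_card_edges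
  have h2 : H.edgeSet.ncard = H.edgeFinset.card := by
    rw [← Set.ncard_coe_finset, SimpleGraph.coe_edgeFinset]
  rw [h2, ← h1]
  refine Finset.sum_congr rfl fun x _ => ?_
  rw [length_neighbours, ← SimpleGraph.card_neighborFinset_eq_degree, ← Set.ncard_coe_finset,
    SimpleGraph.coe_neighborFinset]

/-- The neighbours of a vertex with the weights of the edges. -/
noncomputable def arcs (wt : Sym2 (Fin n) → ℝ≥0) (H : SimpleGraph (Fin n)) (x : ℕ) :
    List (Fin n × ℝ≥0) :=
  if h : x < n then (neighbours H ⟨x, h⟩).map fun y => (y, wt s(⟨x, h⟩, y)) else []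

lemma arcs_val (x : Fin n) : arcs wt H x = (neighbours H x).map fun y => (y, wt s(x, y)) := by
  simp [arcs]

lemma length_joined_arcs_le (k : ℕ) : (joined (arcs wt H) k).length ≤ 2 * H.edgeSet.ncard := by
  rw [← sum_length_neighbours (H := H)]
  have h1 : (joined (arcs wt H) n).length = ∑ x : Fin n, (neighbours H x).length := by
    rw [length_joined, Finset.sum_range]
    exact Finset.sum_congr rfl fun x _ => by rw [arcs_val, List.length_map]
  rw [← h1]
  rcases le_total k n with hk | hk
  · exact length_joined_mono _ hk
  · rw [length_joined, length_joined]
    refine (Finset.sum_subset (Finset.range_subset_range.2 hk) fun x _ hx => ?_).ge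
    simp [arcs, Finset.mem_range.not.1 hx]

lemma exists_of_mem_joined_arcs {k : ℕ} {e : Fin n × ℝ≥0} (he : e ∈ joined (arcs wt H) k) :
    ∃ x : Fin n, H.Adj x e.1 ∧ e.2 = wt s(x, e.1) := by
  simp only [joined, List.mem_flatMap] at he
  obtain ⟨x, -, hx⟩ := he
  unfold arcs at hx
  split_ifs at hx with h
  · obtain ⟨y, hy, rfl⟩ := List.mem_map.1 hx
    exact ⟨⟨x, h⟩, mem_neighbours.1 hy, rfl⟩
  · simp at hx

/-- The search key of the stored pair `(x, y)` of level `j`, for the triple `(j, x, y)`. -/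
def key (n : ℕ) (t : ℕ × Fin n × Fin n) : ℕ := (t.1 * n + t.2.1) * n + t.2.2

lemma key_injective : Function.Injective (key n) := by
  rintro ⟨j, x, y⟩ ⟨j', x', y'⟩ h
  have hn : 0 < n := x.pos
  have h1 : ∀ (a : ℕ) (b : Fin n), (a * n + b) % n = b ∧ (a * n + b) / n = a := fun a b => by
    rw [mul_comm, Nat.mul_add_mod, Nat.mod_eq_of_lt b.2, Nat.mul_add_div hn, Nat.div_eq_of_lt b.2]
    simp
  simp only [key] at h
  have h2 := congrArg (· % n) h
  have h3 := congrArg (· / n) h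
  simp only [(h1 _ _).1, (h1 _ _).2] at h2 h3
  have h4 := congrArg (· % n) h3
  have h5 := congrArg (· / n) h3
  simp only [(h1 _ _).1, (h1 _ _).2] at h4 h5
  rw [Fin.ext h2, Fin.ext h4, h5]

/-- The pairs of all levels for which a path is stored. -/
noncomputable def triples (wt : Sym2 (Fin n) → ℝ≥0) (H : SimpleGraph (Fin n)) (L : Hierarchy h n) :
    Finset (ℕ × Fin n × Fin n) :=
  (Finset.Icc 1 h).biUnion fun j => (stored wt H L j).image fun π => (j, π)

lemma mem_triples {L : Hierarchy h n} {t : ℕ × Fin n × Fin n} :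
    t ∈ triples wt H L ↔ t.1 ∈ Finset.Icc 1 h ∧ t.2 ∈ stored wt H L t.1 := by
  obtain ⟨j, π⟩ := t
  simp only [triples, Finset.mem_biUnion, Finset.mem_image, Prod.mk.injEq]
  constructor
  · rintro ⟨j, hj, π, hπ, rfl, rfl⟩
    exact ⟨hj, hπ⟩
  · rintro ⟨hj, hπ⟩
    exact ⟨j, hj, π, hπ, rfl, rfl⟩

lemma reachable_of_mem_triples {L : Hierarchy h n} {t : ℕ × Fin n × Fin n}
    (ht : t ∈ triples wt H L) : H.Reachable t.2.1 t.2.2 := by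
  have := (mem_triples.1 ht).2
  simp only [stored, Finset.mem_filter_univ] at this
  exact this.2.2.1

/-- The sorted list of the search keys. -/
noncomputable def keys (wt : Sym2 (Fin n) → ℝ≥0) (H : SimpleGraph (Fin n)) (L : Hierarchy h n) :
    List ℕ := ((triples wt H L).image (key n)).sort (· ≤ ·)

lemma mem_keys {L : Hierarchy h n} {k : ℕ} :
    k ∈ keys wt H L ↔ ∃ t ∈ triples wt H L, key n t = k := by
  simp [keys]

lemma length_keys (L : Hierarchy h n) : (keys wt H L).length = (triples wt H L).card := by
  rw [keys, Finset.length_sort, Finset.card_image_of_injective _ key_injective]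

open Classical in
/-- The list entries, the number of edges and the length of the path with a given key. -/
noncomputable def keyData (wt : Sym2 (Fin n) → ℝ≥0) (H : SimpleGraph (Fin n)) (L : Hierarchy h n)
    (k : ℕ) : List ℕ × ℕ × ℝ≥0 :=
  if hk : ∃ t ∈ triples wt H L, key n t = k then
    (pathEntries wt H L hk.choose.1 (reachable_of_mem_triples hk.choose_spec.1),
      (exists_best (wt := wt) (reachable_of_mem_triples hk.choose_spec.1)).choose.length,
      len wt (exists_best (wt := wt) (reachable_of_mem_triples hk.choose_spec.1)).choose)
  else ([], 0, 0)

lemma keyData_key {L : Hierarchy h n} {t : ℕ × Fin n × Fin n} (ht : t ∈ triples wt H L) :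
    keyData wt H L (key n t) = (pathEntries wt H L t.1 (reachable_of_mem_triples ht),
      (exists_best (wt := wt) (reachable_of_mem_triples ht)).choose.length,
      len wt (exists_best (wt := wt) (reachable_of_mem_triples ht)).choose) := by
  have hk : ∃ t' ∈ triples wt H L, key n t' = key n t := ⟨t, ht, rfl⟩
  have h1 : hk.choose = t := key_injective hk.choose_spec.2
  rw [keyData, dif_pos hk]
  congr!

/-- The entries for the path with the `i`-th key. -/
noncomputable def entryLists (wt : Sym2 (Fin n) → ℝ≥0) (H : SimpleGraph (Fin n))
    (L : Hierarchy h n) (i : ℕ) : List ℕ := (keyData wt H L ((keys wt H L).getD i 0)).1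

lemma sum_triples {M : Type*} [AddCommMonoid M] (L : Hierarchy h n) (f : ℕ × Fin n × Fin n → M) :
    ∑ t ∈ triples wt H L, f t =
      ∑ j ∈ Finset.Icc 1 h, ∑ π ∈ stored wt H L j, f (j, π) := by
  rw [triples, Finset.sum_biUnion]
  · exact Finset.sum_congr rfl fun j _ => Finset.sum_image fun _ _ _ _ h => (Prod.ext_iff.1 h).2
  · intro i _ j _ hij
    rw [Function.onFun, Finset.disjoint_left]
    rintro t hi hj
    obtain ⟨_, -, rfl⟩ := Finset.mem_image.1 hi
    obtain ⟨_, -, h⟩ := Finset.mem_image.1 hj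
    exact hij (Prod.ext_iff.1 h).1.symm

lemma length_keys_le (L : Hierarchy h n) :
    (keys wt H L).length ≤ 4 * ∑ j ∈ Finset.Icc 1 h, cube wt H L j := by
  rw [length_keys, Finset.card_eq_sum_ones, sum_triples, Finset.mul_sum]
  refine Finset.sum_le_sum fun j hj => ?_
  rw [← Finset.card_eq_sum_ones]
  exact card_stored_le hj

lemma length_joined_entryLists_le (L : Hierarchy h n) :
    (joined (entryLists wt H L) (keys wt H L).length).length ≤
      12 * ∑ j ∈ Finset.Icc 1 h, cube wt H L j := by
  have h1 : (joined (entryLists wt H L) (keys wt H L).length).length =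
      ∑ t ∈ triples wt H L, (keyData wt H L (key n t)).1.length := by
    rw [length_joined, ← Finset.sum_image (f := fun k => (keyData wt H L k).1.length)
      key_injective.injOn]
    have h2 := Finset.sum_range (n := (keys wt H L).length)
      (f := fun i => (entryLists wt H L i).length)
    rw [h2]
    calc _ = ((keys wt H L).map fun k => (keyData wt H L k).1.length).sum := by
          rw [← Fin.sum_univ_fun_getElem]
          refine Finset.sum_congr rfl fun i _ => ?_
          simp [entryLists]
      _ = _ := by
          rw [keys, ← List.sum_toFinset _ (Finset.sort_nodup _ _)]
          congr 1
          simp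
  rw [h1, sum_triples, Finset.mul_sum]
  refine Finset.sum_le_sum fun j hj => sum_length_pathEntries_le hj _ fun π hπ => ?_
  have ht : (j, π) ∈ triples wt H L := mem_triples.2 ⟨hj, hπ⟩
  exact ⟨reachable_of_mem_triples ht, by rw [keyData_key ht]⟩

/-- The number of cells of each array. -/
noncomputable def cells (wt : Sym2 (Fin n) → ℝ≥0) (H : SimpleGraph (Fin n)) (L : Hierarchy h n) :
    ℕ :=
  (h + 4) * n + 4 + 2 * H.edgeSet.ncard + 12 * ∑ j ∈ Finset.Icc 1 h, cube wt H L j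

open Classical in
/-- The integer arrays of the oracle, with the layout described at `Oracle`. -/
noncomputable def arrays (wt : Sym2 (Fin n) → ℝ≥0) (H : SimpleGraph (Fin n)) (L : Hierarchy h n)
    (f x : ℕ) : ℕ :=
  match f with
  | 0 => if x = 0 then cells wt H L else if x = 1 then n else if x = 2 then (keys wt H L).length
    else 0
  | 1 => ext (fun v => ((H.connectedComponentMk v).out : ℕ)) x
  | 2 => (joined (arcs wt H) x).length
  | 3 => ((joined (arcs wt H) n).map fun e => (e.1 : ℕ)).getD x 0
  | 9 => (keys wt H L).getD x 0
  | 10 => if x < (keys wt H L).length then (joined (entryLists wt H L) x).length else 0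
  | 11 => (keyData wt H L ((keys wt H L).getD x 0)).2.1
  | 12 => (joined (entryLists wt H L) (keys wt H L).length).getD x 0
  | 13 => ext (fun v => if distTo wt H (landmarks L 1) v = ⊤ then 1 else 0) x
  | f =>
    if f < 20 then 0
    else if f % 2 = 0 then ext (pointer wt H (landmarks L ((f - 20) / 2))) x
    else ext (traceSum wt H L ((f - 20) / 2)) x

/-- The weight arrays of the oracle, with the layout described at `Oracle`. -/
noncomputable def weights (wt : Sym2 (Fin n) → ℝ≥0) (H : SimpleGraph (Fin n)) (L : Hierarchy h n)
    (f x : ℕ) : ℝ≥0 :=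
  match f with
  | 3 => ((joined (arcs wt H) n).map fun e => e.2).getD x 0
  | 9 => (keyData wt H L ((keys wt H L).getD x 0)).2.2
  | f =>
    if f < 20 then 0
    else if f % 2 = 0 then ext (fun v => (distTo wt H (landmarks L ((f - 20) / 2)) v).toNNReal) x
    else 0

lemma arrays_pointer (L : Hierarchy h n) (j x : ℕ) :
    arrays wt H L (20 + 2 * j) x = ext (pointer wt H (landmarks L j)) x := by
  rw [arrays]
  · rw [if_neg (by omega), if_pos (by omega), show (20 + 2 * j - 20) / 2 = j by omega]
  all_goals intro h; omega

lemma arrays_traceSum (L : Hierarchy h n) (j x : ℕ) :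
    arrays wt H L (21 + 2 * j) x = ext (traceSum wt H L j) x := by
  rw [arrays]
  · rw [if_neg (by omega), if_neg (by omega), show (21 + 2 * j - 20) / 2 = j by omega]
  all_goals intro h; omega

lemma weights_dist (L : Hierarchy h n) (j x : ℕ) : weights wt H L (20 + 2 * j) x =
    ext (fun v => (distTo wt H (landmarks L j) v).toNNReal) x := by
  rw [weights]
  · rw [if_neg (by omega), if_pos (by omega), show (20 + 2 * j - 20) / 2 = j by omega]
  all_goals intro h; omega

lemma key_lt {t : ℕ × Fin n × Fin n} (ht : t.1 ≤ h) : key n t < (h + 1) * n * n := by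
  obtain ⟨j, x, y⟩ := t
  have h1 : j * n + x + 1 ≤ (h + 1) * n := by
    have : j * n ≤ h * n := Nat.mul_le_mul_right _ ht
    rw [add_mul, one_mul]
    have := x.2
    omega
  have h2 := Nat.mul_le_mul_right n h1
  have := y.2
  rw [add_mul, one_mul] at h2
  simp only [key]
  omega

lemma arrays_lt {W : ℕ} (hn : 2 ≤ n) (L : Hierarchy h n) (hW : (h + 1) * n * n < W)
    (hW' : cells wt H L < W) (f x : ℕ) : arrays wt H L f x < W := by
  have hc : 4 * n + 4 ≤ cells wt H L := by
    have : (h + 4) * n = h * n + 4 * n := by ring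
    unfold cells
    omega
  have hdata : ∀ k, (∀ e ∈ (keyData wt H L k).1, e < n) ∧ (keyData wt H L k).2.1 < n := by
    intro k
    unfold keyData
    split_ifs with hk
    · refine ⟨fun e he => lt_of_mem_entries he, ?_⟩
      simpa using (exists_best (wt := wt) (reachable_of_mem_triples
        hk.choose_spec.1)).choose_spec.isPath.length_lt
    · simp
      omega
  have hkeys := length_keys_le (wt := wt) (H := H) L
  have hent := length_joined_entryLists_le (wt := wt) (H := H) L
  have hcells : cells wt H L = (h + 4) * n + 4 + 2 * H.edgeSet.ncard +
    12 * ∑ j ∈ Finset.Icc 1 h, cube wt H L j := rfl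
  unfold arrays
  split
  · split_ifs <;> omega
  · refine ext_induction (P := (· < W)) _ (by omega) (fun v => ?_) x
    have := (H.connectedComponentMk v).out.2
    omega
  · have := length_joined_arcs_le (wt := wt) (H := H) x
    omega
  · refine getD_induction (P := (· < W)) _ _ (by omega) (fun y hy => ?_) x
    obtain ⟨e, -, rfl⟩ := List.mem_map.1 hy
    have := e.1.2
    omega
  · refine getD_induction (P := (· < W)) _ _ (by omega) (fun y hy => ?_) x
    obtain ⟨t, ht, rfl⟩ := mem_keys.1 hy
    exact (key_lt (Finset.mem_Icc.1 (mem_triples.1 ht).1).2).trans hW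
  · split_ifs with hx
    · have := length_joined_mono (entryLists wt H L) hx.le
      omega
    · omega
  · have := (hdata ((keys wt H L).getD x 0)).2
    omega
  · refine getD_induction (P := (· < W)) _ _ (by omega) (fun y hy => ?_) x
    simp only [joined, List.mem_flatMap] at hy
    obtain ⟨i, -, hi⟩ := hy
    have := (hdata _).1 y hi
    omega
  · refine ext_induction (P := (· < W)) _ (by omega) (fun v => ?_) x
    split_ifs <;> omega
  · split_ifs
    · omega
    · refine ext_induction (P := (· < W)) _ (by omega) (fun v => ?_) x
      have := pointer_le (wt := wt) (H := H) (landmarks L ((f - 20) / 2)) v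
      omega
    · refine ext_induction (P := (· < W)) _ (by omega) (fun v => ?_) x
      have := traceSum_lt (wt := wt) (H := H) L ((f - 20) / 2) v
      omega

lemma distTo_eq_len (S : Finset (Fin n)) (v : Fin n) :
    ∃ (x y : Fin n) (p : H.Walk x y), p.IsPath ∧ (distTo wt H S v).toNNReal = len wt p := by
  by_cases hv : distTo wt H S v < ⊤
  · obtain ⟨x, p, hp⟩ := exists_bestTo hv
    exact ⟨v, x, p, hp.best.isPath, by rw [← hp.len_eq, ENNReal.toNNReal_coe]⟩
  · rw [not_lt, top_le_iff] at hv
    exact ⟨v, v, .nil, .nil, by simp [hv, len]⟩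

/-- All weights in the memory are lengths of paths; `0` is the length of a trivial path. -/
lemma weights_eq_len (hn : 0 < n) (L : Hierarchy h n) (f x : ℕ) :
    ∃ (u v : Fin n) (p : H.Walk u v), p.IsPath ∧ weights wt H L f x = len wt p := by
  have h0 : ∃ (u v : Fin n) (p : H.Walk u v), p.IsPath ∧ 0 = len wt p :=
    ⟨⟨0, hn⟩, ⟨0, hn⟩, .nil, .nil, by simp [len]⟩
  unfold weights
  split
  · refine getD_induction (P := fun d => ∃ (u v : Fin n) (p : H.Walk u v), p.IsPath ∧ d = len wt p)
      _ _ h0 (fun d hd => ?_) x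
    obtain ⟨e, he, rfl⟩ := List.mem_map.1 hd
    obtain ⟨y, hy, he2⟩ := exists_of_mem_joined_arcs he
    exact ⟨y, e.1, hy.toWalk, SimpleGraph.Walk.IsPath.of_adj hy, by simp [len, he2]⟩
  · unfold keyData
    split_ifs with hk
    · exact ⟨_, _, _, (exists_best (wt := wt)
        (reachable_of_mem_triples hk.choose_spec.1)).choose_spec.isPath, rfl⟩
    · exact h0
  · split_ifs
    · exact h0
    · exact ext_induction (P := fun d => ∃ (u v : Fin n) (p : H.Walk u v), p.IsPath ∧ d = len wt p)
        _ h0 (fun v => distTo_eq_len _ v) x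
    · exact h0

/-- The nearest landmarks that the pointers lead to. -/
noncomputable def home (wt : Sym2 (Fin n) → ℝ≥0) (H : SimpleGraph (Fin n)) (L : Hierarchy h n)
    (i : ℕ) (v : Fin n) : Fin n := nearest wt H (landmarks L i) v

lemma isNearest_home (L : Hierarchy h n) : IsNearest wt H L (home wt H L) := by
  intro i _ v hv
  obtain ⟨p, hp, -⟩ := exists_follows_nearest (ext (pointer wt H (landmarks L i)))
    (fun v => by simp) hv
  exact ⟨hp.1, by rw [← hp.len_eq]; exact hp.best.isShortest.len_eq.symm⟩

lemma adjacency_arrays (L : Hierarchy h n) : Adjacency wt H (cells wt H L) (arrays wt H L 2)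
    (arrays wt H L 3) (weights wt H L 3) (neighbours H) where
  mem x y := mem_neighbours
  succ x := by
    simp only [arrays, joined_succ, arcs_val, List.length_append, List.length_map]
  le x := by
    have := length_joined_arcs_le (wt := wt) (H := H) (x + 1)
    simp only [arrays, cells]
    omega
  get x i y hy := by
    have h1 : (arcs wt H x)[i]? = some (y, wt s(x, y)) := by
      rw [arcs_val, List.getElem?_map, hy]
      rfl
    have h2 := getElem?_joined _ x.2 h1
    simp only [arrays, weights, List.getD_eq_getElem?_getD, List.getElem?_map]
    rw [h2]
    exact ⟨rfl, rfl⟩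

lemma oracle_arrays {W : ℕ} (hn : 2 ≤ n) (L : Hierarchy h n) (hW : (h + 1) * n * n < W)
    (hW' : cells wt H L < W) :
    Oracle h wt H L (home wt H L) (neighbours H) W (cells wt H L) (arrays wt H L)
      (weights wt H L) := by
  have hkeys := length_keys_le (wt := wt) (H := H) L
  have hent := length_joined_entryLists_le (wt := wt) (H := H) L
  have hcells : cells wt H L = (h + 4) * n + 4 + 2 * H.edgeSet.ncard +
    12 * ∑ j ∈ Finset.Icc 1 h, cube wt H L j := rfl
  have hcnt : arrays wt H L 0 2 = (keys wt H L).length := by simp [arrays]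
  refine ⟨isNearest_home L, by simp [arrays], by simp [arrays], ?_, adjacency_arrays L, ?_, ?_, ?_,
    ?_, ?_, ?_, ?_, ?_, ?_, arrays_lt hn L hW hW'⟩
  · intro u v
    simp only [arrays, ext_val]
    rw [← SimpleGraph.ConnectedComponent.eq]
    constructor
    · intro h1
      rw [← Quot.out_eq (H.connectedComponentMk u), ← Quot.out_eq (H.connectedComponentMk v),
        Fin.ext h1]
    · intro h1
      rw [h1]
  · intro g h1 h2
    funext x
    interval_cases g <;> simp [arrays]
  · funext x
    simp [weights]
  · intro v
    rw [weights_dist L 1]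
    by_cases hv : distTo wt H (landmarks L 1) v = ⊤
    · exact .inr ⟨by simp [arrays, hv], hv, by simp [hv]⟩
    · exact .inl ⟨by simp [arrays, hv], by simp [hv]⟩
  · intro i j hij hj
    rw [hcnt] at hj
    simp only [arrays]
    rw [List.getD_eq_getElem _ _ hj, List.getD_eq_getElem _ _ (hij.trans hj)]
    exact (Finset.sortedLT_sort _).getElem_lt_getElem_iff.2 hij
  · intro i hi
    rw [hcnt] at hi
    simp [arrays, hi]
  · rw [hcnt]
    omega
  · intro i _ v hv
    obtain ⟨p, hp, hp'⟩ := exists_follows_nearest (arrays wt H L (20 + 2 * i))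
      (fun v => by rw [arrays_pointer, ext_val]) hv
    refine ⟨p, hp', hp.best.isPath, hp.best.isShortest, ?_⟩
    rw [weights_dist, ext_val, ← hp.len_eq, ENNReal.toNNReal_coe]
    rfl
  · intro j hj x hx y hy hxy hs
    have hπ : (x, y) ∈ stored wt H L j := by simp [stored, hx, hy, hxy, hs]
    have ht : (j, x, y) ∈ triples wt H L := mem_triples.2 ⟨hj, hπ⟩
    obtain ⟨i, hi, hik⟩ := List.getElem_of_mem (mem_keys.2 ⟨_, ht, rfl⟩ :
      key n (j, x, y) ∈ keys wt H L)
    have hik' : (keys wt H L).getD i 0 = key n (j, x, y) := by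
      rw [List.getD_eq_getElem _ _ hi, hik]
    have hp := (exists_best (wt := wt) (reachable_of_mem_triples ht)).choose_spec
    have hel : entryLists wt H L i = pathEntries wt H L j (reachable_of_mem_triples ht) := by
      rw [entryLists, hik', keyData_key ht]
    refine ⟨i, by rwa [hcnt], ?_, (exists_best (wt := wt) (reachable_of_mem_triples ht)).choose,
      hp.isShortest, hp.isPath, ?_, ?_, fun z => ?_⟩
    · simp only [arrays]
      rw [hik']
      rfl
    · simp only [arrays]
      rw [hik', keyData_key ht]
    · simp only [weights]
      rw [hik', keyData_key ht]
    · have h10 : arrays wt H L 10 i = (joined (entryLists wt H L) i).length := by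
        simp [arrays, hi]
      refine traced_entries (bad := branches wt H L j) (fun z => ?_) _ hp
        (fun z hz hzx hzy hb => ?_)
        true (by simp) (by simp) ?_ fun k e hk => ?_
      · rw [arrays_traceSum, ext_val, traceSum_eq_zero_iff]
      · rw [arrays_traceSum, ext_val, traceSum_eq hπ (hp.on hz) hzx hzy hb]
      · have h1 := length_joined_mono (entryLists wt H L) (show i + 1 ≤ _ from hi)
        rw [joined_succ, List.length_append, hel, pathEntries] at h1
        rw [h10]
        omega
      · have h1 := getElem?_joined (entryLists wt H L) hi (t := k) (e := e) (by rw [hel]; exact hk)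
        simp only [arrays, List.getD_eq_getElem?_getD]
        rw [if_pos hi, h1]
        rfl
  · intro j hj x y hs i hi hkey
    rw [hcnt] at hi
    simp only [arrays] at hkey
    rw [List.getD_eq_getElem _ _ hi] at hkey
    obtain ⟨t, ht, htk⟩ := mem_keys.1 (List.getElem_mem hi)
    have : t = (j, x, y) := key_injective (htk.trans hkey)
    subst this
    have := (mem_triples.1 ht).2
    simp only [stored, Finset.mem_filter_univ] at this
    exact hs this.2.2.2

end Memory

/-! ### The stretch -/

section Stretch

variable {n h : ℕ} {H : SimpleGraph (Fin n)} {wt : Sym2 (Fin n) → ℝ≥0}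

/-- The stretch of an answer, as a function of the number of levels above. -/
def stretch : ℕ → ℕ
  | 0 => 1
  | i + 1 => 6 + 7 * stretch i

lemma one_le_stretch (i : ℕ) : 1 ≤ stretch i := by
  cases i <;> simp [stretch]
  omega

/-- Climbing one level costs at most six times the distance, and leads to vertices whose distance
is at most seven times as large. -/
lemma IsAnswer.len_le (hh : 1 ≤ h) {L : Hierarchy h n} {ell : ℕ → Fin n → Fin n}
    (hell : IsNearest wt H L ell) {j : ℕ} {x y : Fin n} {p : H.Walk x y}
    (hp : IsAnswer wt H L ell j x y p) (hj : j ≤ h) :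
    (len wt p : ℝ≥0∞) ≤ stretch (h - j) * dist wt H x y := by
  induction hp with
  | here j x y p _ hp =>
    rw [hp.len_eq]
    exact le_mul_of_one_le_left (by simp) (by exact_mod_cast one_le_stretch _)
  | up j x y p q r hs hp hq _ ih =>
    have hjh : j < h := by
      refine lt_of_le_of_ne hj fun hjh => hs ?_
      unfold Stops
      rw [if_neg (by omega), if_pos hjh]
      trivial
    have hfin : dist wt H x y < ⊤ :=
      dist_lt_top_iff.2 (SimpleGraph.Reachable.trans ⟨p⟩ (SimpleGraph.Reachable.trans ⟨r⟩
        ⟨q.reverse⟩))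
    obtain ⟨h1, h2⟩ := distTo_of_not_stops hjh hs
    have h3 : 3 * dist wt H x y < ⊤ := ENNReal.mul_lt_top (by simp) hfin
    have hm : j + 1 ∈ Finset.Icc 1 h := by simp; omega
    have hp' : (len wt p : ℝ≥0∞) ≤ 3 * dist wt H x y := by
      rw [hp.len_eq, (hell _ hm x (h1.trans_lt h3)).2]
      exact h1
    have hq' : (len wt q : ℝ≥0∞) ≤ 3 * dist wt H x y := by
      rw [hq.len_eq, (hell _ hm y (h2.trans_lt h3)).2]
      exact h2
    have hd : dist wt H (ell (j + 1) x) (ell (j + 1) y) ≤ 7 * dist wt H x y := by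
      refine (dist_triangle _ x _).trans ((add_le_add_right (dist_triangle x y _) _).trans ?_)
      rw [dist_comm _ x, ← hp.len_eq, ← hq.len_eq]
      refine (add_le_add hp' (add_le_add_right hq' _)).trans_eq ?_
      ring
    rw [len_append, len_append, len_reverse, show h - j = h - (j + 1) + 1 by omega]
    push_cast
    calc (len wt p : ℝ≥0∞) + (len wt r + len wt q)
        ≤ 3 * dist wt H x y + (stretch (h - (j + 1)) * (7 * dist wt H x y) + 3 * dist wt H x y) :=
          add_le_add hp' (add_le_add ((ih (by omega)).trans (mul_le_mul_right hd _)) hq')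
      _ = _ := by
          simp only [stretch]
          push_cast
          ring

end Stretch

/-! ### Random sets with independent elements -/

section Probability

variable {n h : ℕ} {H : SimpleGraph (Fin n)} {wt : Sym2 (Fin n) → ℝ≥0}

/-- The expansion of a product of sums. -/
lemma sum_prod_ite {ι : Type*} [DecidableEq ι] (S : Finset ι) (f g : ι → ℝ) :
    ∑ T ∈ S.powerset, ∏ z ∈ S, (if z ∈ T then f z else g z) = ∏ z ∈ S, (f z + g z) := by
  rw [Finset.prod_add]
  refine Finset.sum_congr rfl fun T hT => ?_
  rw [Finset.mem_powerset] at hT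
  rw [Finset.prod_ite, Finset.filter_mem_eq_inter, Finset.inter_eq_right.2 hT,
    Finset.filter_notMem_eq_sdiff]

/-- The probability of a set, if its elements are chosen independently with probabilities `s`. -/
noncomputable def setProb (s : Fin n → ℝ) (S : Finset (Fin n)) : ℝ :=
  ∏ v, if v ∈ S then s v else 1 - s v

lemma setProb_nonneg {s : Fin n → ℝ} (hs : ∀ v, 0 ≤ s v ∧ s v ≤ 1) (S : Finset (Fin n)) :
    0 ≤ setProb s S := by
  refine Finset.prod_nonneg fun v _ => ?_
  have := hs v
  split_ifs <;> linarith

lemma sum_setProb (s : Fin n → ℝ) : ∑ S, setProb s S = 1 := by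
  have := sum_prod_ite Finset.univ s fun v => 1 - s v
  simpa [setProb] using this

/-- The third moment of the number of elements of `D` in a random set, on the event that the set
contains `c`. It is bounded by the exponential moment with parameter `θ`. -/
lemma sum_setProb_mul_card_pow_le {s : Fin n → ℝ} (hs : ∀ v, 0 ≤ s v ∧ s v ≤ 1) {θ : ℝ}
    (hθ : 0 < θ) (hθ' : θ ≤ 1 / 2) (c : Fin n) (D : Finset (Fin n)) :
    ∑ S, setProb s S * (if c ∈ S then ((S ∩ D).card : ℝ) ^ 3 else 0) ≤
      6 / θ ^ 3 * (3 * s c * Real.exp (2 * θ * ∑ v ∈ D, s v)) := by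
  have hexp : Real.exp θ ≤ 1 + 2 * θ := by
    refine (Real.exp_bound_div_one_sub_of_interval hθ.le (by linarith)).trans ?_
    rw [div_le_iff₀ (by linarith)]
    nlinarith
  have h1 : ∀ S : Finset (Fin n), setProb s S * (if c ∈ S then ((S ∩ D).card : ℝ) ^ 3 else 0) ≤
      6 / θ ^ 3 * ∏ v, (if v ∈ S then s v * (if v ∈ D then Real.exp θ else 1)
        else if v = c then 0 else 1 - s v) := by
    intro S
    by_cases hc : c ∈ S
    · have h2 : ∏ v, (if v ∈ S then s v * (if v ∈ D then Real.exp θ else 1)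
          else if v = c then 0 else 1 - s v) = setProb s S * Real.exp (θ * (S ∩ D).card) := by
        have h3 : Real.exp (θ * (S ∩ D).card) =
            ∏ v, if v ∈ S then if v ∈ D then Real.exp θ else 1 else 1 := by
          rw [mul_comm, Real.exp_nat_mul, ← Finset.prod_const, ← Finset.prod_ite_mem_eq]
          refine Finset.prod_congr rfl fun v _ => ?_
          by_cases hv : v ∈ S <;> simp [hv]
        rw [h3, setProb, ← Finset.prod_mul_distrib]
        refine Finset.prod_congr rfl fun v _ => ?_
        by_cases hv : v ∈ S
        · simp [hv]
        · have : v ≠ c := fun h => hv (h ▸ hc)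
          simp [hv, this]
      rw [h2, if_pos hc]
      have h4 := Real.pow_div_factorial_le_exp _ (mul_nonneg hθ.le (Nat.cast_nonneg (S ∩ D).card)) 3
      have h5 : ((S ∩ D).card : ℝ) ^ 3 ≤ 6 / θ ^ 3 * Real.exp (θ * (S ∩ D).card) := by
        rw [mul_pow, show (Nat.factorial 3 : ℝ) = 6 by norm_num [Nat.factorial]] at h4
        rw [div_mul_eq_mul_div, le_div_iff₀ (by positivity)]
        rw [div_le_iff₀ (by norm_num)] at h4
        linarith
      have := mul_le_mul_of_nonneg_left h5 (setProb_nonneg hs S)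
      linarith
    · rw [if_neg hc, mul_zero]
      rw [Finset.prod_eq_zero (Finset.mem_univ c) (by simp [hc]), mul_zero]
  have h2 : ∏ v, (s v * (if v ∈ D then Real.exp θ else 1) + if v = c then 0 else 1 - s v) ≤
      3 * s c * Real.exp (2 * θ * ∑ v ∈ D, s v) := by
    calc _ ≤ ∏ v, ((if v = c then 3 * s c else 1) *
          Real.exp (2 * θ * if v ∈ D then s v else 0)) := by
          refine Finset.prod_le_prod (fun v _ => ?_) fun v _ => ?_
          · have := hs v
            have h3 : 0 ≤ s v * (if v ∈ D then Real.exp θ else 1) :=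
              mul_nonneg this.1 (by split_ifs <;> positivity)
            split_ifs at h3 ⊢ <;> linarith
          · obtain ⟨h3, h4⟩ := hs v
            have h5 : 0 ≤ θ * s v := mul_nonneg hθ.le h3
            have h6 := Real.add_one_le_exp (2 * θ * s v)
            by_cases hvc : v = c
            · subst hvc
              have h7 : 1 ≤ Real.exp (2 * θ * if v ∈ D then s v else 0) :=
                Real.one_le_exp (by split_ifs <;> nlinarith)
              have h8 : (if v ∈ D then Real.exp θ else 1) ≤ 3 := by split_ifs <;> linarith
              simp only [if_true, add_zero]
              nlinarith [mul_le_mul_of_nonneg_left h8 h3, mul_nonneg h3 (sub_nonneg.2 h7)]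
            · simp only [hvc, if_false, one_mul]
              split_ifs
              · nlinarith [mul_le_mul_of_nonneg_left hexp h3]
              · simp
      _ = _ := by
          rw [Finset.prod_mul_distrib, Finset.prod_ite_eq' Finset.univ c, if_pos
            (Finset.mem_univ c),
            ← Real.exp_sum, ← Finset.mul_sum]
          simp
  calc _ ≤ ∑ S, 6 / θ ^ 3 * ∏ v, (if v ∈ S then s v * (if v ∈ D then Real.exp θ else 1)
        else if v = c then 0 else 1 - s v) := Finset.sum_le_sum fun S _ => h1 S
    _ = 6 / θ ^ 3 * ∏ v, (s v * (if v ∈ D then Real.exp θ else 1) +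
        if v = c then 0 else 1 - s v) := by
        rw [← Finset.mul_sum, ← sum_prod_ite, Finset.powerset_univ]
    _ ≤ _ := mul_le_mul_of_nonneg_left h2 (by positivity)

/-- The number of copies of vertices that are nearer than all vertices with a selected copy has a
geometric tail, if copies are selected independently with probability `q`: vertices are removed in
the order of the distance `d`. -/
lemma sum_exp_le_two {q : ℝ} (hq : 0 ≤ q) (hq' : q ≤ 1) (k : Fin n → ℕ) (d : Fin n → ℝ≥0∞)
    (S : Finset (Fin n)) :
    ∑ T ∈ S.powerset, (∏ z ∈ S, if z ∈ T then 1 - (1 - q) ^ k z else (1 - q) ^ k z) *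
      Real.exp (q / 2 * ∑ z ∈ S with ∀ t ∈ T, d z < d t, (k z : ℝ)) ≤ 2 := by
  induction S using Finset.induction_on_min_value d with
  | empty => simp
  | insert a S ha hmin ih =>
    set t := (1 - q) ^ k a with ht
    set E := Real.exp (q / 2 * k a) with hE
    have ht0 : 0 ≤ t := pow_nonneg (by linarith) _
    have hE1 : 1 ≤ E := Real.one_le_exp (by positivity)
    have htE : t * E ^ 2 ≤ 1 := by
      have h1 : (1 - q) * Real.exp q ≤ 1 := by
        calc (1 - q) * Real.exp q ≤ Real.exp (-q) * Real.exp q :=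
              mul_le_mul_of_nonneg_right (Real.one_sub_le_exp_neg q) (Real.exp_pos _).le
          _ = 1 := by rw [← Real.exp_add]; simp
      calc t * E ^ 2 = ((1 - q) * Real.exp q) ^ k a := by
            rw [mul_pow, ← Real.exp_nat_mul q, hE, ← Real.exp_nat_mul]
            congr 2
            push_cast
            ring
        _ ≤ 1 := pow_le_one₀ (mul_nonneg (by linarith) (Real.exp_pos _).le) h1
    have hprod : ∀ T T' : Finset (Fin n), (∀ z ∈ S, z ∈ T' ↔ z ∈ T) →
        ∏ z ∈ S, (if z ∈ T' then 1 - (1 - q) ^ k z else (1 - q) ^ k z) =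
          ∏ z ∈ S, (if z ∈ T then 1 - (1 - q) ^ k z else (1 - q) ^ k z) := fun T T' hT' =>
      Finset.prod_congr rfl fun z hz => if_congr (hT' z hz) rfl rfl
    have hpos : ∀ T : Finset (Fin n),
        0 ≤ ∏ z ∈ S, (if z ∈ T then 1 - (1 - q) ^ k z else (1 - q) ^ k z) := fun T =>
      Finset.prod_nonneg fun z _ => by
        have h1 : (1 - q) ^ k z ≤ 1 := pow_le_one₀ (by linarith) (by linarith)
        have h2 : 0 ≤ (1 - q) ^ k z := pow_nonneg (by linarith) _
        split_ifs <;> linarith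
    rw [Finset.sum_powerset_insert ha]
    -- no copy of the nearest vertex `a` is selected
    have h1 : ∑ T ∈ S.powerset, (∏ z ∈ insert a S, if z ∈ T then 1 - (1 - q) ^ k z
        else (1 - q) ^ k z) * Real.exp (q / 2 * ∑ z ∈ insert a S with ∀ t ∈ T, d z < d t,
          (k z : ℝ)) ≤
        t * E * 2 := by
      refine le_trans ?_ (mul_le_mul_of_nonneg_left ih (by positivity))
      rw [Finset.mul_sum]
      refine Finset.sum_le_sum fun T hT => ?_
      have haT : a ∉ T := fun h => ha (Finset.mem_powerset.1 hT h)
      rw [Finset.prod_insert ha, if_neg haT, ← ht]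
      have h2 : Real.exp (q / 2 * ∑ z ∈ insert a S with ∀ t ∈ T, d z < d t, (k z : ℝ)) ≤
          E * Real.exp (q / 2 * ∑ z ∈ S with ∀ t ∈ T, d z < d t, (k z : ℝ)) := by
        rw [hE, ← Real.exp_add, ← mul_add]
        refine Real.exp_le_exp.2 (mul_le_mul_of_nonneg_left ?_ (by linarith))
        rw [Finset.filter_insert]
        split_ifs
        · rw [Finset.sum_insert (by simp [ha])]
        · simp
      have := mul_le_mul_of_nonneg_left h2 (mul_nonneg ht0 (hpos T))
      linarith
    -- a copy of `a` is selected, and the sum in the exponent is empty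
    have h2 : ∑ T ∈ S.powerset, (∏ z ∈ insert a S, if z ∈ insert a T then 1 - (1 - q) ^ k z
        else (1 - q) ^ k z) * Real.exp (q / 2 * ∑ z ∈ insert a S with ∀ t ∈ insert a T, d z < d t,
        (k z : ℝ)) = 1 - t := by
      have h3 : ∀ T ∈ S.powerset, (∏ z ∈ insert a S, if z ∈ insert a T then 1 - (1 - q) ^ k z
        else (1 - q) ^ k z) * Real.exp (q / 2 * ∑ z ∈ insert a S with ∀ t ∈ insert a T, d z < d t,
        (k z : ℝ)) = (1 - t) * ∏ z ∈ S, (if z ∈ T then 1 - (1 - q) ^ k z else (1 - q) ^ k z) := by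
        intro T _
        have hempty : (insert a S).filter (fun z => ∀ t ∈ insert a T, d z < d t) = ∅ := by
          rw [Finset.filter_eq_empty_iff]
          intro z hz hlt
          rcases Finset.mem_insert.1 hz with rfl | hz
          · exact absurd (hlt z (by simp)) (lt_irrefl _)
          · exact absurd (hlt a (by simp)) (not_lt.2 (hmin z hz))
        rw [hempty, Finset.prod_insert ha, if_pos (by simp), hprod T]
        · rw [Finset.sum_empty, mul_zero, Real.exp_zero, mul_one]
        · intro z hz
          have : z ≠ a := fun h => ha (h ▸ hz)
          simp [this]
      rw [Finset.sum_congr rfl h3, ← Finset.mul_sum, sum_prod_ite]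
      simp
    rw [h2]
    -- `2 * t * E ≤ t + t * E ^ 2 ≤ t + 1`
    nlinarith [mul_le_mul_of_nonneg_left (sq_nonneg (E - 1)) ht0]

/-! ### The landmark probabilities -/

lemma rate_nonneg (h n i : ℕ) : 0 ≤ rate h n i := by unfold rate; positivity

lemma rate_le_one (hn : 1 ≤ n) (i : ℕ) : rate h n i ≤ 1 := by
  have hn' : (1 : ℝ) ≤ n := by exact_mod_cast hn
  rw [rate, div_le_one (by linarith)]
  refine (Real.rpow_le_rpow_of_exponent_le hn' (?_ : _ ≤ (1 : ℝ))).trans_eq (Real.rpow_one _)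
  have : 0 ≤ (3 / 4 : ℝ) ^ (h + 1 - i) := by positivity
  linarith

lemma rate_eq (hn : 1 ≤ n) (i : ℕ) : rate h n i = (n : ℝ) ^ (-(3 / 4 : ℝ) ^ (h + 1 - i)) := by
  have hn' : (0 : ℝ) < n := by exact_mod_cast hn
  rw [rate, Real.rpow_sub hn', Real.rpow_one, Real.rpow_neg hn'.le]
  field_simp

lemma rate_pos (hn : 1 ≤ n) (i : ℕ) : 0 < rate h n i := by
  have hn' : (0 : ℝ) < n := by exact_mod_cast hn
  rw [rate_eq hn]
  positivity

/-- The rates are chosen to balance the costs of consecutive levels. -/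
lemma rate_pow_four (hn : 1 ≤ n) {j : ℕ} (hj : j ≤ h) :
    rate h n j ^ 4 = rate h n (j + 1) ^ 3 := by
  have hn' : (0 : ℝ) ≤ n := by positivity
  rw [rate_eq hn, rate_eq hn, ← Real.rpow_mul_natCast hn', ← Real.rpow_mul_natCast hn',
    show h + 1 - j = h + 1 - (j + 1) + 1 by omega, pow_succ]
  congr 1
  push_cast
  ring

lemma rate_succ_le (hn : 1 ≤ n) {j : ℕ} : rate h n (j + 1) ≤ rate h n j := by
  have hn' : (1 : ℝ) ≤ n := by exact_mod_cast hn
  rw [rate_eq hn, rate_eq hn]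
  refine Real.rpow_le_rpow_of_exponent_le hn' (neg_le_neg ?_)
  exact pow_le_pow_of_le_one (by norm_num) (by norm_num) (by omega)

lemma selProb_mem (hn : 1 ≤ n) (i : ℕ) (v : Fin n) :
    0 ≤ selProb h H i v ∧ selProb h H i v ≤ 1 := by
  have h1 := rate_nonneg h n i
  have h2 := rate_le_one (h := h) hn i
  have h3 : (1 - rate h n i) ^ copies H v ≤ 1 := pow_le_one₀ (by linarith) (by linarith)
  have h4 : 0 ≤ (1 - rate h n i) ^ copies H v := pow_nonneg (by linarith) _
  unfold selProb
  constructor <;> linarith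

lemma selProb_le (hn : 1 ≤ n) (i : ℕ) (v : Fin n) :
    selProb h H i v ≤ rate h n i * copies H v := by
  have h2 := rate_le_one (h := h) hn i
  have := one_add_mul_le_pow (a := -rate h n i) (by linarith) (copies H v)
  unfold selProb
  rw [← sub_eq_add_neg] at this
  linarith

/-- By the handshake lemma, the degrees are `2 m` in total. -/
lemma sum_copies_le (H : SimpleGraph (Fin n)) : (∑ v, copies H v : ℝ) ≤ 3 * n := by
  have h1 : ∀ v, (copies H v : ℝ) ≤ ((H.neighborSet v).ncard : ℝ) / (H.edgeSet.ncard / n) + 1 :=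
    fun v => (Nat.ceil_lt_add_one (by positivity)).le
  have h2 : (∑ v, ((H.neighborSet v).ncard : ℝ)) = 2 * H.edgeSet.ncard := by
    have := sum_length_neighbours (H := H)
    simp only [length_neighbours] at this
    exact_mod_cast this
  calc (∑ v, copies H v : ℝ) ≤ ∑ v, (((H.neighborSet v).ncard : ℝ) / (H.edgeSet.ncard / n) + 1) :=
        Finset.sum_le_sum fun v _ => h1 v
    _ = 2 * H.edgeSet.ncard / (H.edgeSet.ncard / n) + n := by
        rw [Finset.sum_add_distrib, ← Finset.sum_div, h2]
        simp
    _ ≤ 2 * n + n := by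
        gcongr
        rcases eq_or_ne (H.edgeSet.ncard : ℝ) 0 with h0 | h0
        · simp [h0]
        · rcases eq_or_ne (n : ℝ) 0 with hn | hn
          · simp [hn]
          · exact le_of_eq (by field_simp)
    _ = 3 * n := by ring

lemma prob_eq (H : SimpleGraph (Fin n)) (L : Hierarchy h n) :
    prob H L = ∏ i : ↥(Finset.Icc 1 h), setProb (selProb h H i) (L i) := rfl

lemma prob_nonneg (hn : 1 ≤ n) (H : SimpleGraph (Fin n)) (L : Hierarchy h n) : 0 ≤ prob H L :=
  Finset.prod_nonneg fun i _ => setProb_nonneg (selProb_mem hn i) _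

lemma sum_prob (H : SimpleGraph (Fin n)) : ∑ L : Hierarchy h n, prob H L = 1 := by
  simp only [prob_eq]
  rw [← Fintype.piFinset_univ, ← Finset.prod_univ_sum]
  exact Finset.prod_eq_one fun i _ => sum_setProb _

/-- An expectation does not change if one of the landmark sets is chosen anew. -/
lemma sum_prob_update (H : SimpleGraph (Fin n)) (i : ↥(Finset.Icc 1 h)) (F : Hierarchy h n → ℝ) :
    ∑ L, prob H L * F L =
      ∑ L, prob H L * ∑ S, setProb (selProb h H i) S * F (Function.update L i S) := by
  have h1 : ∀ (L : Hierarchy h n) (S : Finset (Fin n)), prob H L * setProb (selProb h H i) S =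
      prob H (Function.update L i S) * setProb (selProb h H i) (L i) := by
    intro L S
    have h2 : ∀ L : Hierarchy h n, prob H L = setProb (selProb h H i) (L i) *
        ∏ k ∈ Finset.univ.erase i, setProb (selProb h H k) (L k) := fun L => by
      rw [prob_eq, Finset.mul_prod_erase _ (fun k : ↥(Finset.Icc 1 h) => setProb (selProb h H k)
        (L k))
        (Finset.mem_univ i)]
    have h3 : ∏ k ∈ Finset.univ.erase i, setProb (selProb h H k) (Function.update L i S k) =
        ∏ k ∈ Finset.univ.erase i, setProb (selProb h H k) (L k) :=
      Finset.prod_congr rfl fun k hk => by rw [Function.update_of_ne (Finset.ne_of_mem_erase hk)]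
    rw [h2 L, h2 (Function.update L i S), Function.update_self, h3]
    ring
  calc ∑ L, prob H L * F L
      = ∑ L, ∑ S, prob H L * setProb (selProb h H i) S * F L := by
        refine Finset.sum_congr rfl fun L _ => ?_
        rw [← Finset.sum_mul, ← Finset.mul_sum, sum_setProb, mul_one]
    _ = ∑ p : Hierarchy h n × Finset (Fin n),
          prob H p.1 * setProb (selProb h H i) p.2 * F p.1 := by
        rw [Fintype.sum_prod_type]
    _ = ∑ p : Hierarchy h n × Finset (Fin n), prob H p.1 * setProb (selProb h H i) p.2 *
          F (Function.update p.1 i p.2) := by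
        refine Finset.sum_nbij' (fun p => (Function.update p.1 i p.2, p.1 i))
          (fun p => (Function.update p.1 i p.2, p.1 i)) (fun _ _ => Finset.mem_univ _)
          (fun _ _ => Finset.mem_univ _) (fun p _ => by simp) (fun p _ => by simp) fun p _ => ?_
        rw [h1 p.1 p.2]
        simp
    _ = ∑ L, ∑ S, prob H L * setProb (selProb h H i) S * F (Function.update L i S) := by
        rw [Fintype.sum_prod_type]
    _ = _ := by
        refine Finset.sum_congr rfl fun L _ => ?_
        rw [Finset.mul_sum]
        exact Finset.sum_congr rfl fun S _ => mul_assoc _ _ _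

/-- The number of copies of the vertices in the ball around `c` that is bounded by the landmarks
`S`. -/
noncomputable def load (wt : Sym2 (Fin n) → ℝ≥0) (H : SimpleGraph (Fin n)) (S : Finset (Fin n))
    (c : Fin n) : ℝ := ∑ z ∈ ball wt H c (distTo wt H S c), (copies H z : ℝ)

/-- The balls bounded by the landmarks have exponential moments. -/
lemma sum_exp_load_le (hn : 1 ≤ n) (i : ℕ) (c : Fin n) :
    ∑ S, setProb (selProb h H i) S * Real.exp (rate h n i / 2 * load wt H S c) ≤ 2 := by
  have h1 := sum_exp_le_two (rate_nonneg h n i) (rate_le_one hn i) (copies H)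
    (fun z => dist wt H z c) Finset.univ
  rw [Finset.powerset_univ] at h1
  refine le_trans (Finset.sum_le_sum fun S _ => ?_) h1
  refine mul_le_mul ?_ (Real.exp_le_exp.2 (mul_le_mul_of_nonneg_left
    (Finset.sum_le_sum_of_subset_of_nonneg ?_ fun _ _ _ => by positivity)
    (by have := rate_nonneg h n i; positivity))) (Real.exp_pos _).le ?_
  · simp [setProb, selProb]
  · intro z hz
    simp only [ball, Finset.mem_filter_univ] at hz ⊢
    intro t ht
    refine hz.trans_le ?_
    rw [dist_comm t c]
    exact distTo_le ht
  · refine le_of_le_of_eq (setProb_nonneg (selProb_mem (h := h) (H := H) hn i) S) ?_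
    simp [setProb, selProb]

/-! ### The expected size of the stored paths -/

lemma landmarks_eq {L : Hierarchy h n} {j : ℕ} (hj : j ∈ Finset.Icc 1 h) :
    landmarks L j = L ⟨j, hj⟩ := by
  rw [landmarks, dif_pos hj]

lemma upper_update (L : Hierarchy h n) {j : ℕ} (hj : j ∈ Finset.Icc 1 h) (S : Finset (Fin n)) :
    upper (Function.update L ⟨j, hj⟩ S) j = upper L j := by
  unfold upper
  split_ifs with h1
  · have hj' : j + 1 ∈ Finset.Icc 1 h := by simp; omega
    rw [landmarks_eq hj', landmarks_eq hj', Function.update_of_ne]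
    simp
  · rfl

/-- The expectation over the `j`-landmarks alone, while the `(j + 1)`-landmarks, and with them the
balls, are fixed. -/
lemma sum_setProb_mul_cube_le (hn : 1 ≤ n) (L : Hierarchy h n) {j : ℕ} (hj : j ∈ Finset.Icc 1 h) :
    ∑ S, setProb (selProb h H j) S * (cube wt H (Function.update L ⟨j, hj⟩ S) j : ℝ) ≤
      ∑ c, 1152 * (copies H c * Real.exp (rate h n (j + 1) / 2 * load wt H (upper L j) c)) := by
  have hp := rate_pos (h := h) hn j
  have hq := rate_pos (h := h) hn (j + 1)
  have hqp := rate_succ_le (h := h) (j := j) hn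
  have h1 : ∀ S : Finset (Fin n), (cube wt H (Function.update L ⟨j, hj⟩ S) j : ℝ) =
      ∑ c, if c ∈ S then ((S ∩ ball wt H c (distTo wt H (upper L j) c)).card : ℝ) ^ 3 else 0 := by
    intro S
    have h2 : landmarks (Function.update L ⟨j, hj⟩ S) j = S := by
      rw [landmarks_eq hj, Function.update_self]
    rw [cube, h2, ← Finset.sum_filter, Finset.filter_univ_mem]
    push_cast
    refine Finset.sum_congr rfl fun c _ => ?_
    rw [near, h2, upper_update]
  simp only [h1, Finset.mul_sum]
  rw [Finset.sum_comm]
  refine Finset.sum_le_sum fun c _ => ?_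
  -- with this parameter, the load of the ball enters the exponent with the factor
  -- `rate h n (j + 1) / 2`, as in `sum_exp_load_le`
  set θ := rate h n (j + 1) / (4 * rate h n j) with hθ
  have hθ0 : 0 < θ := by positivity
  have hθ1 : θ ≤ 1 / 2 := by
    rw [hθ, div_le_iff₀ (by positivity)]
    linarith
  refine (sum_setProb_mul_card_pow_le (selProb_mem hn j) hθ0 hθ1 c _).trans ?_
  have h2 : 2 * θ * ∑ v ∈ ball wt H c (distTo wt H (upper L j) c), selProb h H j v ≤
      rate h n (j + 1) / 2 * load wt H (upper L j) c := by
    calc _ ≤ 2 * θ * ∑ v ∈ ball wt H c (distTo wt H (upper L j) c), rate h n j * copies H v := by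
          gcongr with v
          exact selProb_le hn j v
      _ = _ := by
          rw [← Finset.mul_sum, load, hθ]
          field_simp
          ring
  calc _ ≤ 6 / θ ^ 3 * (3 * (rate h n j * copies H c) *
        Real.exp (rate h n (j + 1) / 2 * load wt H (upper L j) c)) := by
        have h3 := selProb_le (h := h) (H := H) hn j c
        have h4 := (selProb_mem (h := h) (H := H) hn j c).1
        refine mul_le_mul_of_nonneg_left (mul_le_mul (by linarith) (Real.exp_le_exp.2 h2)
          (Real.exp_pos _).le (by linarith)) (by positivity)
    _ = 1152 * (rate h n j ^ 4 / rate h n (j + 1) ^ 3) * (copies H c *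
        Real.exp (rate h n (j + 1) / 2 * load wt H (upper L j) c)) := by
        rw [hθ]
        field_simp
        ring
    _ = _ := by
        rw [rate_pow_four hn (Finset.mem_Icc.1 hj).2, div_self (by positivity), mul_one]

/-- The expected size of the stored paths of each level is linear, whatever the level. -/
lemma sum_prob_mul_cube_le (hn : 1 ≤ n) {j : ℕ} (hj : j ∈ Finset.Icc 1 h) :
    ∑ L : Hierarchy h n, prob H L * (cube wt H L j : ℝ) ≤ 20000 * n := by
  have hexp : ∀ c, ∑ L : Hierarchy h n, prob H L *
      Real.exp (rate h n (j + 1) / 2 * load wt H (upper L j) c) ≤ 5 := by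
    intro c
    by_cases hjh : j < h
    · have hj' : j + 1 ∈ Finset.Icc 1 h := by simp; omega
      rw [sum_prob_update H ⟨j + 1, hj'⟩]
      calc _ ≤ ∑ L : Hierarchy h n, prob H L * 2 := by
            refine Finset.sum_le_sum fun L _ => mul_le_mul_of_nonneg_left ?_ (prob_nonneg hn H L)
            refine le_of_eq_of_le ?_ (sum_exp_load_le (wt := wt) (h := h) (H := H) hn (j + 1) c)
            refine Finset.sum_congr rfl fun S _ => ?_
            rw [upper, if_pos hjh, landmarks_eq hj', Function.update_self]
        _ ≤ 5 := by
            rw [← Finset.sum_mul, sum_prob]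
            norm_num
    · -- at the top level the balls are components, and the next rate would be `1 / n`
      have hjh : j = h := le_antisymm (Finset.mem_Icc.1 hj).2 (not_lt.1 hjh)
      have hn' : (0 : ℝ) < n := by exact_mod_cast hn
      have hq : rate h n (j + 1) = 1 / n := by
        rw [rate, hjh]
        simp
      have hload : ∀ L : Hierarchy h n, load wt H (upper L j) c ≤ 3 * n := fun L =>
        le_trans (Finset.sum_le_sum_of_subset_of_nonneg (Finset.subset_univ _)
          fun _ _ _ => by positivity) (sum_copies_le H)
      have he : Real.exp (3 / 2) ≤ 5 := by
        have h1 := Real.exp_one_lt_d9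
        have h2 : Real.exp (3 / 2) ^ 2 = Real.exp 1 ^ 3 := by
          rw [← Real.exp_nat_mul, ← Real.exp_nat_mul]
          norm_num
        have h3 : Real.exp 1 ^ 3 ≤ 2.7182818286 ^ 3 := by gcongr
        nlinarith [Real.exp_pos (3 / 2)]
      calc _ ≤ ∑ L : Hierarchy h n, prob H L * 5 := by
            refine Finset.sum_le_sum fun L _ => mul_le_mul_of_nonneg_left (le_trans ?_ he)
              (prob_nonneg hn H L)
            refine Real.exp_le_exp.2 ?_
            calc rate h n (j + 1) / 2 * load wt H (upper L j) c ≤ 1 / n / 2 * (3 * n) := by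
                  rw [hq]
                  gcongr
                  exact hload L
              _ = 3 / 2 := by field_simp
        _ ≤ 5 := by rw [← Finset.sum_mul, sum_prob]; norm_num
  rw [sum_prob_update H ⟨j, hj⟩]
  calc _ ≤ ∑ L : Hierarchy h n, prob H L * ∑ c, 1152 * (copies H c *
        Real.exp (rate h n (j + 1) / 2 * load wt H (upper L j) c)) :=
        Finset.sum_le_sum fun L _ => mul_le_mul_of_nonneg_left (sum_setProb_mul_cube_le hn L hj)
          (prob_nonneg hn H L)
    _ = ∑ c, 1152 * copies H c * ∑ L : Hierarchy h n, prob H L *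
        Real.exp (rate h n (j + 1) / 2 * load wt H (upper L j) c) := by
        simp only [Finset.mul_sum]
        rw [Finset.sum_comm]
        refine Finset.sum_congr rfl fun c _ => Finset.sum_congr rfl fun L _ => ?_
        ring
    _ ≤ ∑ c, 1152 * (copies H c : ℝ) * 5 := by
        gcongr with c
        exact hexp c
    _ = 5760 * ∑ c, (copies H c : ℝ) := by
        rw [Finset.mul_sum]
        exact Finset.sum_congr rfl fun c _ => by ring
    _ ≤ 20000 * n := by
        have := sum_copies_le H
        have hn' : (0 : ℝ) ≤ n := by positivity
        linarith

/-! ### The good event -/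

open Classical in
/-- The event that no ball around a vertex is much larger than expected. -/
noncomputable def good (h : ℕ) (wt : Sym2 (Fin n) → ℝ≥0) (H : SimpleGraph (Fin n)) :
    Finset (Hierarchy h n) :=
  Finset.univ.filter fun L => ∀ c, rate h n 1 / 2 * load wt H (landmarks L 1) c ≤
    Real.log (2 * (n : ℝ) ^ 3)

/-- A union bound over the `n` centres: by Markov's inequality for the exponential moment, each of
them fails with probability at most `1 / n ^ 3`. -/
lemma sum_prob_good (hn : 1 ≤ n) (hh : 1 ≤ h) :
    1 - 1 / (n : ℝ) ^ 2 ≤ ∑ L ∈ good h wt H, prob H L := by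
  classical
  have hn' : (0 : ℝ) < n := by exact_mod_cast hn
  have h1 : (1 : ℕ) ∈ Finset.Icc 1 h := by simpa using hh
  have hbad : ∑ L ∈ (good h wt H)ᶜ, prob H L ≤ 1 / (n : ℝ) ^ 2 := by
    calc ∑ L ∈ (good h wt H)ᶜ, prob H L
        ≤ ∑ L ∈ (good h wt H)ᶜ, prob H L * ∑ c, 1 / (2 * (n : ℝ) ^ 3) *
          Real.exp (rate h n 1 / 2 * load wt H (landmarks L 1) c) := by
          refine Finset.sum_le_sum fun L hL => le_mul_of_one_le_right (prob_nonneg hn H L) ?_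
          simp only [good, Finset.mem_compl, Finset.mem_filter_univ, not_forall, not_le] at hL
          obtain ⟨c, hc⟩ := hL
          refine le_trans ?_ (Finset.single_le_sum (f := fun c => 1 / (2 * (n : ℝ) ^ 3) *
            Real.exp (rate h n 1 / 2 * load wt H (landmarks L 1) c)) (fun c _ => by positivity)
            (Finset.mem_univ c))
          rw [Real.log_lt_iff_lt_exp (by positivity)] at hc
          rw [one_div, ← div_eq_inv_mul, one_le_div (by positivity)]
          exact hc.le
      _ ≤ ∑ L : Hierarchy h n, prob H L * ∑ c, 1 / (2 * (n : ℝ) ^ 3) *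
          Real.exp (rate h n 1 / 2 * load wt H (landmarks L 1) c) :=
          Finset.sum_le_sum_of_subset_of_nonneg (Finset.subset_univ _) fun L _ _ =>
            mul_nonneg (prob_nonneg hn H L) (Finset.sum_nonneg fun c _ => by positivity)
      _ = ∑ c, 1 / (2 * (n : ℝ) ^ 3) * ∑ L : Hierarchy h n, prob H L *
          Real.exp (rate h n 1 / 2 * load wt H (landmarks L 1) c) := by
          simp only [Finset.mul_sum]
          rw [Finset.sum_comm]
          refine Finset.sum_congr rfl fun c _ => Finset.sum_congr rfl fun L _ => ?_
          ring
      _ ≤ ∑ _c : Fin n, 1 / (2 * (n : ℝ) ^ 3) * 2 := by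
          gcongr with c
          rw [sum_prob_update H ⟨1, h1⟩]
          calc _ ≤ ∑ L : Hierarchy h n, prob H L * 2 := by
                refine Finset.sum_le_sum fun L _ => mul_le_mul_of_nonneg_left ?_
                  (prob_nonneg hn H L)
                refine le_of_eq_of_le ?_ (sum_exp_load_le (wt := wt) (h := h) (H := H) hn 1 c)
                refine Finset.sum_congr rfl fun S _ => ?_
                rw [landmarks_eq h1, Function.update_self]
            _ = 2 := by rw [← Finset.sum_mul, sum_prob, one_mul]
      _ = 1 / (n : ℝ) ^ 2 := by
          simp
          field_simp
  have := Finset.sum_add_sum_compl (good h wt H) (prob H)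
  rw [sum_prob] at this
  linarith

/-- By Markov's inequality, the good event and a size of at most four times the expected one occur
together with probability at least `1 / 2`. -/
lemma half_le_sum_prob (hn : 2 ≤ n) (hh : 1 ≤ h) (f : Hierarchy h n → ℝ) (hf : ∀ L, 0 ≤ f L) {E : ℝ}
    (hE : 0 < E) (hfE : ∑ L, prob H L * f L ≤ E) :
    1 / 2 ≤ ∑ L ∈ good h wt H with f L ≤ 4 * E, prob H L := by
  classical
  have hn' : (2 : ℝ) ≤ n := by exact_mod_cast hn
  have h1 := sum_prob_good (wt := wt) (H := H) (by omega : 1 ≤ n) hh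
  have h2 := Finset.sum_filter_add_sum_filter_not (good h wt H) (fun L => f L ≤ 4 * E) (prob H)
  have h3 : ∑ L ∈ good h wt H with ¬ f L ≤ 4 * E, prob H L ≤ 1 / 4 := by
    calc _ ≤ ∑ L ∈ good h wt H with ¬ f L ≤ 4 * E, prob H L * f L / (4 * E) := by
          refine Finset.sum_le_sum fun L hL => ?_
          rw [Finset.mem_filter, not_le] at hL
          rw [mul_div_assoc]
          refine le_mul_of_one_le_right (prob_nonneg (by omega) H L) ?_
          rw [one_le_div (by positivity)]
          exact hL.2.le
      _ ≤ ∑ L, prob H L * f L / (4 * E) :=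
          Finset.sum_le_sum_of_subset_of_nonneg (Finset.subset_univ _) fun L _ _ =>
            div_nonneg (mul_nonneg (prob_nonneg (by omega) H L) (hf L)) (by positivity)
      _ ≤ E / (4 * E) := by
          rw [← Finset.sum_div]
          gcongr
      _ = 1 / 4 := by field_simp
  have h4 : 1 / (n : ℝ) ^ 2 ≤ 1 / 4 := by
    apply one_div_le_one_div_of_le (by norm_num)
    nlinarith
  linarith

end Probability

/-! ### The oracle -/

section Oracle

variable {n h : ℕ} {G H : SimpleGraph (Fin n)} {wt : Sym2 (Fin n) → ℝ≥0}

/-- The query program of the oracle with `h` levels, for the machine, which receives the two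
vertices in its registers `0` and `1`. The number of cells of the arrays is read from the first
cell. -/
def program (h : ℕ) : Prog :=
  .seq (.seq (.iload 2 4) (.seq (.iop .add 6 1 4) (.iop .add 5 0 4))) (query h)

/-- The number of arrays. -/
def fields (h : ℕ) : ℕ := 22 + 2 * h

/-- Words are below `n ^ wordExp h`, which suffices for the addresses: a constant factor `a` is
below `n ^ a`. -/
def wordExp (h : ℕ) : ℕ := 4 + fields h * (13 * h + 9)

/-- The data structure for a hierarchy of landmarks. -/
noncomputable def store (wt : Sym2 (Fin n) → ℝ≥0) (H : SimpleGraph (Fin n)) (L : Hierarchy h n) :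
    Store :=
  ⟨fields h * cells wt H L, fun a => arrays wt H L (a / cells wt H L) (a % cells wt H L),
    fun a => weights wt H L (a / cells wt H L) (a % cells wt H L)⟩

lemma two_mul_ncard_edgeSet_le (H : SimpleGraph (Fin n)) : 2 * H.edgeSet.ncard ≤ n ^ 2 := by
  rw [← sum_length_neighbours]
  calc ∑ x, (neighbours H x).length ≤ ∑ _x : Fin n, n := Finset.sum_le_sum fun x _ => by
        have : (neighbours H x).Nodup := Finset.nodup_toList _
        simpa using this.length_le_card
    _ = n ^ 2 := by simp [sq]

lemma cells_lt (hn : 2 ≤ n) (L : Hierarchy h n) :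
    fields h * cells wt H L < n ^ wordExp h ∧ (h + 1) * n * n < n ^ wordExp h := by
  have h1 : cells wt H L ≤ (13 * h + 9) * n ^ 4 := by
    have h2 := two_mul_ncard_edgeSet_le H
    have h3 : ∑ j ∈ Finset.Icc 1 h, cube wt H L j ≤ h * n ^ 4 := by
      refine (Finset.sum_le_card_nsmul _ _ _ fun j _ => cube_le L j).trans_eq ?_
      simp
    have h4 : n ≤ n ^ 4 := Nat.le_self_pow (by norm_num) n
    have h5 : n ^ 2 ≤ n ^ 4 := Nat.pow_le_pow_right (by omega) (by norm_num)
    have h6 : (h + 4) * n ≤ (h + 4) * n ^ 4 := Nat.mul_le_mul_left _ h4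
    have h7 : 1 ≤ n ^ 4 := Nat.one_le_pow _ _ (by omega)
    unfold cells
    nlinarith
  have hK : fields h * (13 * h + 9) < n ^ (fields h * (13 * h + 9)) :=
    Nat.lt_pow_self (by omega)
  have hpow : n ^ wordExp h = n ^ 4 * n ^ (fields h * (13 * h + 9)) := by rw [wordExp, pow_add]
  have hn4 : 0 < n ^ 4 := by positivity
  have hlt : fields h * (13 * h + 9) * n ^ 4 < n ^ wordExp h := by
    rw [hpow, mul_comm]
    exact Nat.mul_lt_mul_of_pos_left hK hn4
  refine ⟨lt_of_le_of_lt ?_ hlt, lt_of_le_of_lt ?_ hlt⟩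
  · rw [mul_assoc]
    exact Nat.mul_le_mul_left _ h1
  · have h8 : n ^ 2 ≤ n ^ 4 := Nat.pow_le_pow_right (by omega) (by norm_num)
    calc (h + 1) * n * n = (h + 1) * n ^ 2 := by ring
      _ ≤ (fields h * (13 * h + 9)) * n ^ 4 := Nat.mul_le_mul (by unfold fields; nlinarith) h8

lemma store_admissible (hn : 2 ≤ n) (L : Hierarchy h n) :
    (store wt H L).Admissible (n ^ wordExp h) wt H := by
  obtain ⟨h1, h2⟩ := cells_lt (wt := wt) (H := H) hn L
  have h3 : cells wt H L < n ^ wordExp h :=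
    lt_of_le_of_lt (Nat.le_mul_of_pos_left _ (by unfold fields; omega)) h1
  exact ⟨fun a => arrays_lt hn L h2 h3 _ _, fun a => weights_eq_len (by omega) L _ _⟩

/-- The largest bound `searchTime` for a search at level `0`. -/
noncomputable def searchBound (wt : Sym2 (Fin n) → ℝ≥0) (H : SimpleGraph (Fin n))
    (L : Hierarchy h n) : ℕ :=
  Finset.univ.sup fun s =>
    searchTime n (neighbours H) (ball wt H s (distTo wt H (landmarks L 1) s))

lemma store_query (hn : 2 ≤ n) (hh : 1 ≤ h) (L : Hierarchy h n) (u v : Fin n) :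
    (H.Reachable u v → ∃ (p : H.Walk u v) (τ : ℕ), IsAnswer wt H L (home wt H L) 0 u v p ∧
      (store wt H L).Query (n ^ wordExp h) (program h) u v (verts p) (len wt p) τ ∧
      τ ≤ 3 * searchBound wt H L + 70 * Nat.log 2 (2 * n) +
        (120 + 20 * Nat.log 2 (n ^ wordExp h)) * h + 300 + 62 * p.length) ∧
    (¬ H.Reachable u v → ∃ τ, (store wt H L).Query (n ^ wordExp h) (program h) u v [] 0 τ ∧
      τ ≤ 300) := by
  obtain ⟨h1, h2⟩ := cells_lt (wt := wt) (H := H) hn L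
  have hc : (h + 4) * n + 4 ≤ cells wt H L := by unfold cells; omega
  have hc1 : (h + 4) * n = h * n + 4 * n := by ring
  have hc2 : (h + 1) * n = h * n + n := by ring
  have h3 : 2 * cells wt H L < n ^ wordExp h :=
    lt_of_le_of_lt (Nat.mul_le_mul_right _ (by unfold fields; omega)) h1
  obtain ⟨h4, h5⟩ := query_spec (F := fields h) (oracle_arrays (wt := wt) (H := H)
    (W := n ^ wordExp h) hn L h2 (by omega)) ⟨hn, by omega, h3, by unfold fields; omega⟩ hh
    (by unfold fields; omega) h2 (by omega) h1.le (X := searchBound wt H L)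
    (fun s => Finset.le_sup (f := fun s => searchTime n (neighbours H)
      (ball wt H s (distTo wt H (landmarks L 1) s))) (Finset.mem_univ s)) u v (D := store wt H L)
        rfl
    (Q := program h) rfl
  refine ⟨fun huv => ?_, h5⟩
  obtain ⟨p, τ, h6, h7, h8⟩ := h4 huv
  refine ⟨p, τ, h6, h7, h8.trans ?_⟩
  have := Nat.log_mono_right (b := 2) h3.le
  gcongr

lemma nat_log_le {m : ℕ} : (Nat.log 2 m : ℝ) ≤ Real.logb 2 m := by
  exact_mod_cast Real.natLog_le_logb m 2

/-- A ball that contains few copies contains few edges. -/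
lemma sum_degree_le (hn : 1 ≤ n) (S : Finset (Fin n)) (c : Fin n) :
    (∑ z ∈ ball wt H c (distTo wt H S c), ((neighbours H z).length + 1 : ℝ)) ≤
      1 + 2 * (H.edgeSet.ncard / n) * load wt H S c := by
  have hn' : (0 : ℝ) < n := by exact_mod_cast hn
  by_cases hc : neighbours H c = []
  · have hsub : ball wt H c (distTo wt H S c) ⊆ {c} := by
      intro z hz
      simp only [ball, Finset.mem_filter_univ] at hz
      obtain ⟨p⟩ := dist_lt_top_iff.1 (hz.trans_le le_top)
      have := p.reverse
      cases this with
      | nil => simp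
      | cons hadj _ =>
        have := mem_neighbours.2 hadj
        rw [hc] at this
        simp at this
    refine (Finset.sum_le_sum_of_subset_of_nonneg hsub fun z _ _ => by positivity).trans ?_
    rw [Finset.sum_singleton, hc]
    have : 0 ≤ load wt H S c := Finset.sum_nonneg fun z _ => by positivity
    simp
    positivity
  · rw [load, Finset.mul_sum]
    refine le_trans (Finset.sum_le_sum fun z hz => ?_) (le_add_of_nonneg_left zero_le_one)
    have hz1 : 1 ≤ (neighbours H z).length := by
      simp only [ball, Finset.mem_filter_univ] at hz
      obtain ⟨p⟩ := dist_lt_top_iff.1 (hz.trans_le le_top)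
      cases p with
      | nil => exact List.length_pos_iff.2 hc
      | cons hadj _ => exact List.length_pos_of_mem (mem_neighbours.2 hadj)
    have hm : 0 < (H.edgeSet.ncard : ℝ) / n := by
      have h1 := sum_length_neighbours (H := H)
      have h2 : (neighbours H z).length ≤ ∑ x, (neighbours H x).length :=
        Finset.single_le_sum (f := fun x => (neighbours H x).length)
          (fun x _ => Nat.zero_le _) (Finset.mem_univ z)
      have h3 : 0 < H.edgeSet.ncard := by omega
      positivity
    have h4 := Nat.le_ceil (((H.neighborSet z).ncard : ℝ) / ((H.edgeSet.ncard : ℝ) / n))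
    rw [div_le_iff₀ hm] at h4
    have h5 : ((neighbours H z).length : ℝ) ≤ copies H z * (H.edgeSet.ncard / n) := by
      rw [length_neighbours]
      exact h4
    have h6 : (1 : ℝ) ≤ (neighbours H z).length := by exact_mod_cast hz1
    linarith

lemma logb_two_mul {n : ℕ} (hn : 2 ≤ n) : Real.logb 2 (2 * n : ℕ) ≤ 2 * Real.logb 2 n := by
  have h1 := one_le_logb hn
  have hn' : (n : ℝ) ≠ 0 := by positivity
  push_cast
  rw [Real.logb_mul (by norm_num) hn', Real.logb_self_eq_one (by norm_num)]
  linarith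

/-- The time of a search is proportional to the number of edges in the ball, up to a logarithmic
factor, and on the good event the ball contains `O(n ^ (3 / 4) ^ h * log n)` copies. -/
lemma searchBound_le (hn : 2 ≤ n) {L : Hierarchy h n} (hL : L ∈ good h wt H) {c M : ℝ} (hc : 1 ≤ c)
    (hM : n ≤ M) (hm : (H.edgeSet.ncard : ℝ) ≤ c * M) :
    (searchBound wt H L : ℝ) ≤
      3502 * c * (M / n * (n : ℝ) ^ ((3 / 4 : ℝ) ^ h) * Real.logb 2 n ^ 2) := by
  have hl := one_le_logb hn
  have hn' : (0 : ℝ) < n := by positivity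
  have hn1 : (1 : ℝ) ≤ n := by exact_mod_cast (by omega : 1 ≤ n)
  set l := Real.logb 2 n with hldef
  set y := (n : ℝ) ^ ((3 / 4 : ℝ) ^ h) with hy
  have hy1 : 1 ≤ y := Real.one_le_rpow hn1 (by positivity)
  have hM0 : 0 < M := hn'.trans_le hM
  have hMn : 1 ≤ M / n := by rwa [one_le_div hn']
  have hrate : rate h n 1 = y⁻¹ := by
    rw [rate_eq (by omega), Real.rpow_neg hn'.le, Nat.add_sub_cancel]
  have hlog : Real.log (2 * (n : ℝ) ^ 3) ≤ 4 * l := by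
    have h1 : Real.log (2 * (n : ℝ) ^ 3) = Real.log 2 + 3 * Real.log n := by
      rw [Real.log_mul (by norm_num) (by positivity), Real.log_pow]
      norm_num
    have h2 : Real.log n ≤ l := by
      rw [hldef, Real.logb, le_div_iff₀ (Real.log_pos (by norm_num))]
      have h3 : Real.log 2 ≤ 1 := by
        have := Real.log_two_lt_d9
        linarith
      have h4 := Real.log_nonneg hn1
      nlinarith
    have h3 : Real.log 2 ≤ 1 := by
      have := Real.log_two_lt_d9
      linarith
    linarith
  have hload : ∀ s, load wt H (landmarks L 1) s ≤ 8 * y * l := by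
    intro s
    simp only [good, Finset.mem_filter_univ] at hL
    have h1 := (hL s).trans hlog
    rw [hrate, inv_div_left, inv_mul_le_iff₀ (by positivity)] at h1
    linarith
  have hfac : ((70 * Nat.log 2 (2 * n) + 66 : ℕ) : ℝ) ≤ 206 * l := by
    have h1 := nat_log_le (m := 2 * n)
    have h2 := logb_two_mul hn
    push_cast
    linarith
  have hone : ∀ s, (searchTime n (neighbours H) (ball wt H s (distTo wt H (landmarks L 1) s)) : ℝ) ≤
      3502 * c * (M / n * y * l ^ 2) := by
    intro s
    have h1 := sum_degree_le (wt := wt) (H := H) (by omega) (landmarks L 1) s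
    have h2 : 2 * ((H.edgeSet.ncard : ℝ) / n) * load wt H (landmarks L 1) s ≤
        2 * (c * M / n) * (8 * y * l) := by
      have h0 : 0 ≤ load wt H (landmarks L 1) s := Finset.sum_nonneg fun z _ => by positivity
      refine mul_le_mul ?_ (hload s) h0 (by positivity)
      gcongr
    have h3 : 1 ≤ c * (M / n * y * l) := by
      have : 1 ≤ M / n * y * l := one_le_mul_of_one_le_of_one_le
        (one_le_mul_of_one_le_of_one_le hMn hy1) hl
      exact one_le_mul_of_one_le_of_one_le hc this
    calc (searchTime n (neighbours H) (ball wt H s (distTo wt H (landmarks L 1) s)) : ℝ)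
        = ((70 * Nat.log 2 (2 * n) + 66 : ℕ) : ℝ) * ∑ z ∈ ball wt H s
          (distTo wt H (landmarks L 1) s),
          ((neighbours H z).length + 1 : ℝ) := by
          rw [searchTime, ← Finset.mul_sum]
          push_cast
          rfl
      _ ≤ 206 * l * (1 + 2 * (c * M / n) * (8 * y * l)) := by
          refine mul_le_mul hfac (by linarith) (Finset.sum_nonneg fun z _ => by positivity)
            (by linarith)
      _ ≤ 206 * l * (c * (M / n * y * l) + 2 * (c * M / n) * (8 * y * l)) := by gcongr
      _ = _ := by ring
  have hnn : 0 ≤ 3502 * c * (M / n * y * l ^ 2) := by positivity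
  have : searchBound wt H L ≤ ⌊3502 * c * (M / n * y * l ^ 2)⌋₊ :=
    Finset.sup_le fun s _ => Nat.le_floor (hone s)
  exact (Nat.cast_le.2 this).trans (Nat.floor_le hnn)

lemma IsSpanner.reachable_iff {t : ℝ} (hs : IsSpanner wt G H t) {u v : Fin n} :
    G.Reachable u v ↔ H.Reachable u v := by
  refine ⟨fun h => ?_, fun h => h.mono hs.1⟩
  rw [← dist_lt_top_iff (wt := wt)] at h ⊢
  exact (hs.2 u v).trans_lt (ENNReal.mul_lt_top ENNReal.ofReal_lt_top h)

/-- The constant in the expected space. -/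
noncomputable def spaceConst (h : ℕ) (c : ℝ) : ℝ := fields h * (h + 6 + 2 * c + 240000 * h)

lemma sum_prob_mul_size_le (hn : 2 ≤ n) {c M : ℝ} (hM : n ≤ M)
    (hm : (H.edgeSet.ncard : ℝ) ≤ c * M) :
    ∑ L : Hierarchy h n, prob H L * ((store wt H L).size : ℝ) ≤ spaceConst h c * M := by
  have hn' : (2 : ℝ) ≤ n := by exact_mod_cast hn
  have h1 : ∀ L : Hierarchy h n, prob H L * ((store wt H L).size : ℝ) =
      fields h * (((h + 4) * n + 4 + 2 * H.edgeSet.ncard) * prob H L +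
        12 * ∑ j ∈ Finset.Icc 1 h, prob H L * (cube wt H L j : ℝ)) := by
    intro L
    rw [← Finset.mul_sum]
    simp only [store, cells]
    push_cast
    ring
  simp only [h1]
  rw [← Finset.mul_sum, Finset.sum_add_distrib, ← Finset.mul_sum, ← Finset.mul_sum, sum_prob,
    Finset.sum_comm]
  have h2 : ∑ j ∈ Finset.Icc 1 h, ∑ L : Hierarchy h n, prob H L * (cube wt H L j : ℝ) ≤
      h * (20000 * n) := by
    refine (Finset.sum_le_card_nsmul _ _ _ fun j hj =>
      sum_prob_mul_cube_le (by omega) hj).trans_eq ?_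
    simp
  have h3 : (h : ℝ) * n ≤ h * M := by gcongr
  rw [spaceConst, mul_assoc]
  refine mul_le_mul_of_nonneg_left ?_ (by positivity)
  nlinarith

/-- The constant of the oracle, where `c` bounds the density of the graph, and `c'` the growth of
the logarithmic factors. -/
noncomputable def oracleConst (h : ℕ) (c c' : ℝ) : ℝ :=
  4 * spaceConst h c + (10506 * c + 440 + 120 * h + 20 * wordExp h * h) * c' + 362 + stretch h * c

lemma implementsLambda (hn : 2 ≤ n) (hh : 1 ≤ h) {t c c' M α T : ℝ} (hs : IsSpanner wt G H t)
    (hα : stretch h * t ≤ α) (hc : 1 ≤ c) (hc' : 1 ≤ c') (hM : n ≤ M)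
    (hm : (H.edgeSet.ncard : ℝ) ≤ c * M) (hT1 : 1 ≤ T)
    (hT : M / n * (n : ℝ) ^ ((3 / 4 : ℝ) ^ h) * Real.logb 2 n ^ 2 ≤ c' * T) :
    ImplementsLambda (program h) (n ^ wordExp h) h wt G H (oracleConst h c c') M α T := by
  have hn' : (0 : ℝ) < n := by positivity
  have hn1 : (1 : ℝ) ≤ n := by exact_mod_cast (by omega : 1 ≤ n)
  have hsp : 0 < spaceConst h c := by
    unfold spaceConst fields
    positivity
  have hM0 : 0 < M := by linarith
  set B : ℝ := 10506 * c + 440 + 120 * h + 20 * wordExp h * h with hB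
  have hB0 : 440 ≤ B := by
    have : 0 ≤ 10506 * c + 120 * h + 20 * wordExp h * h := by positivity
    rw [hB]
    linarith
  have hst : (0 : ℝ) ≤ stretch h * c := by positivity
  have hC1 : 4 * spaceConst h c ≤ oracleConst h c c' := by
    have : 0 ≤ B * c' := by positivity
    unfold oracleConst
    linarith
  have hC2 : B * c' + 362 ≤ oracleConst h c c' := by
    unfold oracleConst
    linarith
  have hBc : 0 ≤ B * c' := by positivity
  have hsize : 4 * (spaceConst h c * M) ≤ oracleConst h c c' * M := by
    rw [← mul_assoc]
    gcongr
  refine ⟨fun L => store wt H L, fun L => home wt H L, good h wt H, fun L =>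
    ⟨store_admissible hn L, isNearest_home L, fun u v => ⟨fun huv => ?_, fun huv => ?_⟩⟩,
    sum_prob_good (by omega) hh, ?_, ?_⟩
  · rw [hs.reachable_iff] at huv
    obtain ⟨p, τ, h1, h2, h3⟩ := (store_query (wt := wt) hn hh L u v).1 huv
    refine ⟨p, τ, by simpa [verts, List.map_eq_flatMap] using h2, h1, ?_, fun hL => ?_⟩
    · calc (len wt p : ℝ≥0∞) ≤ stretch h * dist wt H u v := by
            simpa using h1.len_le hh (isNearest_home L) (Nat.zero_le h)
        _ ≤ stretch h * (ENNReal.ofReal t * dist wt G u v) := by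
            gcongr
            exact hs.2 u v
        _ = ENNReal.ofReal (stretch h * t) * dist wt G u v := by
            rw [ENNReal.ofReal_mul (by positivity), ENNReal.ofReal_natCast, mul_assoc]
        _ ≤ _ := by gcongr
    · have hl := one_le_logb hn
      have hX := searchBound_le hn hL hc hM hm
      have h4 := nat_log_le (m := 2 * n)
      have h5 := logb_two_mul hn
      have h6 := nat_log_le (m := n ^ wordExp h)
      rw [Nat.cast_pow, Real.logb_pow] at h6
      have hy1 : 1 ≤ (n : ℝ) ^ ((3 / 4 : ℝ) ^ h) := Real.one_le_rpow hn1 (by positivity)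
      have hMn : 1 ≤ M / n := by rwa [one_le_div hn']
      set Z := M / n * (n : ℝ) ^ ((3 / 4 : ℝ) ^ h) * Real.logb 2 n ^ 2 with hZ
      have hlZ : Real.logb 2 n ≤ Z := by
        have h7 : 1 ≤ M / n * (n : ℝ) ^ ((3 / 4 : ℝ) ^ h) :=
          one_le_mul_of_one_le_of_one_le hMn hy1
        calc Real.logb 2 n ≤ Real.logb 2 n ^ 2 := by nlinarith
          _ ≤ Z := le_mul_of_one_le_left (by positivity) h7
      have h3' : (τ : ℝ) ≤ 3 * searchBound wt H L + 70 * Nat.log 2 (2 * n) +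
        (120 + 20 * Nat.log 2 (n ^ wordExp h)) * h + 300 + 62 * p.length := by exact_mod_cast h3
      have h8 : (20 * (Nat.log 2 (n ^ wordExp h) : ℝ)) * h ≤ 20 * wordExp h * h * Z := by
        calc (20 * (Nat.log 2 (n ^ wordExp h) : ℝ)) * h ≤ (20 * (wordExp h * Z)) * h := by
              gcongr
              exact h6.trans (by gcongr)
          _ = _ := by ring
      have h9 : (120 : ℝ) * h ≤ 120 * h * Z := le_mul_of_one_le_right (by positivity) (by linarith)
      have h10 : (τ : ℝ) ≤ B * Z + 62 * p.length := by
        rw [hB]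
        linarith
      have h11 : B * Z ≤ B * c' * T := by
        rw [mul_assoc]
        gcongr
      have h12 : (0 : ℝ) ≤ p.length := by positivity
      have h13 : (B * c' + 362) * (T + p.length) ≤ oracleConst h c c' * (T + p.length) := by gcongr
      nlinarith [mul_nonneg hBc h12]
  · rw [hs.reachable_iff] at huv
    obtain ⟨τ, h1, h2⟩ := (store_query (wt := wt) hn hh L u v).2 huv
    refine ⟨0, τ, h1, fun _ => ?_⟩
    have h2' : (τ : ℝ) ≤ 300 := by exact_mod_cast h2
    nlinarith
  · refine (sum_prob_mul_size_le hn hM hm).trans ?_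
    nlinarith [mul_pos hsp hM0]
  · refine (half_le_sum_prob (wt := wt) (H := H) hn hh (fun L => ((store wt H L).size : ℝ))
      (fun L => by positivity) (mul_pos hsp hM0) (sum_prob_mul_size_le hn hM hm)).trans ?_
    refine Finset.sum_le_sum_of_subset_of_nonneg (fun L hL => ?_)
      fun L _ _ => prob_nonneg (by omega) H L
    rw [Finset.mem_filter] at hL ⊢
    exact ⟨hL.1, hL.2.trans hsize⟩

/-- The logarithmic factors are absorbed by a gap between the exponents. -/
lemma exists_growth_const {β ε : ℝ} (hβ : β ≤ ε) : ∃ C : ℝ, 1 ≤ C ∧ ∀ n : ℕ, 2 ≤ n →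
    (n : ℝ) ^ β * Real.logb 2 n ^ 2 ≤
      C * ((n : ℝ) ^ ε * Real.logb 2 n ^ (if β < ε then 0 else 2)) := by
  by_cases hlt : β < ε
  · set δ := (ε - β) / 2 with hδ
    have hδ0 : 0 < δ := by linarith
    have hl2 : 0 < Real.log 2 := Real.log_pos (by norm_num)
    refine ⟨max 1 (1 / (δ * Real.log 2) ^ 2), le_max_left _ _, fun n hn => ?_⟩
    have hn' : (0 : ℝ) < n := by positivity
    have hl := one_le_logb hn
    have h1 : Real.logb 2 n ≤ (n : ℝ) ^ δ / (δ * Real.log 2) := by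
      rw [Real.logb, ← div_div]
      gcongr
      exact Real.log_le_rpow_div hn'.le hδ0
    rw [if_pos hlt, pow_zero, mul_one]
    calc (n : ℝ) ^ β * Real.logb 2 n ^ 2 ≤ (n : ℝ) ^ β * ((n : ℝ) ^ δ / (δ * Real.log 2)) ^ 2 := by
          gcongr
      _ = 1 / (δ * Real.log 2) ^ 2 * (n : ℝ) ^ ε := by
          have h2 : (n : ℝ) ^ ε = (n : ℝ) ^ β * ((n : ℝ) ^ δ) ^ 2 := by
            rw [← Real.rpow_mul_natCast hn'.le, ← Real.rpow_add hn']
            congr 1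
            push_cast
            linarith
          rw [h2, div_pow]
          ring
      _ ≤ _ := by
          gcongr
          exact le_max_right _ _
  · refine ⟨1, le_rfl, fun n hn => ?_⟩
    rw [if_neg hlt, le_antisymm hβ (not_lt.1 hlt), one_mul]

lemma oracles_exist {ε : ℝ} (hε : 0 < ε) (hh : 1 ≤ h) (hh' : ⌈Real.logb (4 / 3) ε⁻¹⌉ ≤ (h : ℤ))
    (c : ℝ) : ∃ (Q : Prog) (b : ℕ) (C : ℝ) (a : ℕ), ((3 / 4 : ℝ) ^ h < ε → a = 0) ∧
      ∀ n : ℕ, 2 ≤ n → ∀ (G H : SimpleGraph (Fin n)) (wt : Sym2 (Fin n) → ℝ≥0),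
        (IsSpanner wt G H (c * Real.logb 2 n) → (H.edgeSet.ncard : ℝ) ≤ c * n →
          ImplementsLambda Q (n ^ b) h wt G H C n (C * Real.logb 2 n)
            ((n : ℝ) ^ ε * Real.logb 2 n ^ a)) ∧
        (3 ≤ n → ∀ k : ℝ, Real.logb 2 n / Real.logb 2 (Real.logb 2 n) ≤ k →
          k ≤ Real.logb 2 n → IsSpanner wt G H (c * k) →
          (H.edgeSet.ncard : ℝ) ≤ c * (n : ℝ) ^ (1 + 1 / k) →
          ImplementsLambda Q (n ^ b) h wt G H C ((n : ℝ) ^ (1 + 1 / k)) (C * k)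
            ((n : ℝ) ^ (ε + 1 / k) * Real.logb 2 n ^ a)) := by
  have hβ : (3 / 4 : ℝ) ^ h ≤ ε := by
    have h1 : Real.logb (4 / 3) ε⁻¹ ≤ h := by
      have := (Int.le_ceil _).trans (Int.cast_le.2 hh' : ((_ : ℤ) : ℝ) ≤ _)
      simpa using this
    rw [Real.logb_le_iff_le_rpow (by norm_num) (by positivity), Real.rpow_natCast] at h1
    rw [show (3 / 4 : ℝ) = (4 / 3)⁻¹ by norm_num, inv_pow]
    exact inv_le_of_inv_le₀ hε h1
  obtain ⟨c', hc', hgrow⟩ := exists_growth_const hβ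
  set c₁ := max c 1 with hc₁
  have hc1 : 1 ≤ c₁ := le_max_right _ _
  have hcc : c ≤ c₁ := le_max_left _ _
  have hst : (0 : ℝ) ≤ stretch h := by positivity
  have hα : stretch h * c₁ ≤ oracleConst h c₁ c' := by
    unfold oracleConst spaceConst
    have : 0 ≤ 4 * (fields h * (h + 6 + 2 * c₁ + 240000 * h)) +
      (10506 * c₁ + 440 + 120 * h + 20 * wordExp h * h) * c' := by positivity
    linarith
  have hα' : ∀ k : ℝ, 0 ≤ k → stretch h * (c * k) ≤ oracleConst h c₁ c' * k := by
    intro k hk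
    calc stretch h * (c * k) ≤ stretch h * (c₁ * k) := by gcongr
      _ = stretch h * c₁ * k := by ring
      _ ≤ _ := by gcongr
  refine ⟨program h, wordExp h, oracleConst h c₁ c', if (3 / 4 : ℝ) ^ h < ε then 0 else 2,
    fun hlt => if_pos hlt, fun n hn G H wt => ⟨fun hs hm => ?_, fun h3 k hk _ hs hm => ?_⟩⟩
  all_goals
    have hn1 : (1 : ℝ) ≤ n := by exact_mod_cast (by omega : 1 ≤ n)
    have hn' : (0 : ℝ) < n := by linarith
    have hl := one_le_logb hn
    have hg := hgrow n hn
    have hlp : 1 ≤ Real.logb 2 n ^ (if (3 / 4 : ℝ) ^ h < ε then 0 else 2) := one_le_pow₀ hl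
  · refine implementsLambda hn hh hs (hα' _ (by linarith)) hc1 hc' le_rfl (hm.trans (by gcongr))
      (one_le_mul_of_one_le_of_one_le (Real.one_le_rpow hn1 hε.le) hlp) ?_
    rwa [div_self hn'.ne', one_mul]
  · have hk1 := one_le_param h3 hk
    have hk0 : 0 ≤ 1 / k := by positivity
    have hMn : (n : ℝ) ^ (1 + 1 / k) = n * (n : ℝ) ^ (1 / k) := by
      rw [Real.rpow_add hn', Real.rpow_one]
    have hk2 : 1 ≤ (n : ℝ) ^ (1 / k) := Real.one_le_rpow hn1 hk0
    refine implementsLambda hn hh hs (hα' _ (by linarith)) hc1 hc' ?_ (hm.trans (by gcongr))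
      (one_le_mul_of_one_le_of_one_le (Real.one_le_rpow hn1 (by positivity)) hlp) ?_
    · rw [hMn]
      exact le_mul_of_one_le_right hn'.le hk2
    · rw [hMn, mul_div_cancel_left₀ _ hn'.ne', Real.rpow_add hn']
      calc (n : ℝ) ^ (1 / k) * (n : ℝ) ^ ((3 / 4 : ℝ) ^ h) * Real.logb 2 n ^ 2
          = (n : ℝ) ^ (1 / k) * ((n : ℝ) ^ ((3 / 4 : ℝ) ^ h) * Real.logb 2 n ^ 2) := by ring
        _ ≤ (n : ℝ) ^ (1 / k) * (c' * ((n : ℝ) ^ ε *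
            Real.logb 2 n ^ (if (3 / 4 : ℝ) ^ h < ε then 0 else 2))) := by gcongr
        _ = _ := by ring

end Oracle

end PathOracle

theorem theorem5 :
    -- sparse spanners exist
    (∃ c₀ : ℝ, ∀ n : ℕ, 2 ≤ n → ∀ (G : SimpleGraph (Fin n)) (wt : Sym2 (Fin n) → NNReal),
      (∃ H : SimpleGraph (Fin n), PathOracle.IsSpanner wt G H (c₀ * Real.logb 2 n) ∧
        (H.edgeSet.ncard : ℝ) ≤ c₀ * n) ∧
      (3 ≤ n → ∀ k : ℝ, Real.logb 2 n / Real.logb 2 (Real.logb 2 n) ≤ k → k ≤ Real.logb 2 n →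
        ∃ H : SimpleGraph (Fin n), PathOracle.IsSpanner wt G H (c₀ * k) ∧
          (H.edgeSet.ncard : ℝ) ≤ c₀ * (n : ℝ) ^ (1 + 1 / k))) ∧
    -- the multilevel oracle on any such spanner
    (∀ ε : ℝ, 0 < ε → ∀ h : ℕ, 1 ≤ h → ⌈Real.logb (4 / 3) ε⁻¹⌉ ≤ (h : ℤ) → ∀ c : ℝ,
      ∃ (Q : PathOracle.Prog) (b : ℕ) (C : ℝ) (a : ℕ), ((3 / 4 : ℝ) ^ h < ε → a = 0) ∧
        ∀ n : ℕ, 2 ≤ n → ∀ (G H : SimpleGraph (Fin n)) (wt : Sym2 (Fin n) → NNReal),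
          (PathOracle.IsSpanner wt G H (c * Real.logb 2 n) → (H.edgeSet.ncard : ℝ) ≤ c * n →
            PathOracle.ImplementsLambda Q (n ^ b) h wt G H C n (C * Real.logb 2 n)
              ((n : ℝ) ^ ε * Real.logb 2 n ^ a)) ∧
          (3 ≤ n → ∀ k : ℝ, Real.logb 2 n / Real.logb 2 (Real.logb 2 n) ≤ k →
            k ≤ Real.logb 2 n →
            PathOracle.IsSpanner wt G H (c * k) →
            (H.edgeSet.ncard : ℝ) ≤ c * (n : ℝ) ^ (1 + 1 / k) →
            PathOracle.ImplementsLambda Q (n ^ b) h wt G H C ((n : ℝ) ^ (1 + 1 / k)) (C * k)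
              ((n : ℝ) ^ (ε + 1 / k) * Real.logb 2 n ^ a))) :=
  ⟨⟨4, fun n hn G wt => PathOracle.spanners_exist n hn G wt⟩,
    fun _ hε _ hh hh' c => PathOracle.oracles_exist hε hh hh' c⟩
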